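/- Let $k$ be a field and let $X$ be a smooth projective surface over $k$ (an integral scheme, projective over $k$ and smooth of relative dimension $2$). Let $E$ be a vector bundle of rank $2$ on $X$ and let $s\in H^0(X,E)$ be a nonzero section. Let $\pi:\mathbb P(E)=\operatorname{Proj}(\operatorname{Sym}E)\to X$ be the projective bundle of invertible quotients of $E$, let $\mathcal O_{\mathbb P(E)}(1)$ be the tautological quotient of $\pi^*E$, and let $\varphi(s)\in H^0(\mathbb P(E),\mathcal O_{\mathbb P(E)}(1))$ be the section corresponding to $s$, that is, the image of $\pi^*s$. Let $I\subseteq\mathcal O_X$ be the ideal sheaf of the zero scheme $Z(s)$. Let $V_1(s)$ be the one-dimensional part of $Z(s)$: the closed subscheme whose ideal sheaf $F$ consists of the functions whose germs lie in $I_x$ at every point $x$ of codimension one (locally $F$ is the intersection of the primary components of $I$ that belong to primes of height one). Let $V_0(s)$ be the zero-dimensional part of $Z(s)$: the subscheme residual to $V_1(s)$ in $Z(s)$, with ideal sheaf $(I:F)$. (If $Z(s)$ has no embedded points, $V_0(s)$ is the union of the zero-dimensional components of $Z(s)$.) Then there are closed subschemes $W_0,W_1\subseteq\mathbb P(E)$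 such that the zero scheme of $\varphi(s)$ is $W_0\cup W_1$ (its ideal sheaf is the intersection of those of $W_0$ and $W_1$); $W_0$, with the morphism $\pi|_{W_0}$ to $X$, is the blow-up of $X$ along $V_0(s)$; and $W_1$ is isomorphic over $X$ to $\mathbb P(E|_{V_1(s)})$. -/

import Mathlib

open CategoryTheory Limits AlgebraicGeometry TopologicalSpace HomogeneousLocalization
open scoped HomogeneousIdeal

universe u

noncomputable section

namespace ProjBundle

section SymmetricAlgebra

variable (R M : Type u) [CommRing R] [AddCommGroup M] [Module R M]

/-- The degree `n` part of the symmetric algebra. -/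
def symPow (n : ℕ) : Submodule R (SymmetricAlgebra R M) :=
  LinearMap.range (SymmetricAlgebra.ι R M) ^ n

lemma ι_mem_symPow (m : M) : SymmetricAlgebra.ι R M m ∈ symPow R M 1 := by
  simpa only [symPow, pow_one] using LinearMap.mem_range_self _ m

instance : SetLike.GradedMonoid (symPow R M) where
  one_mem := by simp [symPow, Submodule.one_le.mp le_rfl]
  mul_mem i j x y hx hy := by
    rw [symPow, pow_add]; exact Submodule.mul_mem_mul hx hy

/-- The degree one inclusion into the direct sum of the graded pieces. -/
def symGradedι : M →ₗ[R] DirectSum ℕ fun i => ↥(symPow R M i) :=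
  DirectSum.lof R ℕ (fun i => ↥(symPow R M i)) 1 ∘ₗ
    (SymmetricAlgebra.ι R M).codRestrict _ (ι_mem_symPow R M)

instance : GradedAlgebra (symPow R M) :=
  GradedAlgebra.ofAlgHom _ (SymmetricAlgebra.lift (symGradedι R M))
    (by
      apply SymmetricAlgebra.algHom_ext
      ext m
      simp [symGradedι, DirectSum.lof_eq_of])
    fun i x => by
    obtain ⟨x, hx⟩ := x
    dsimp only [DirectSum.lof_eq_of]
    induction hx using Submodule.pow_induction_on_left' with
    | algebraMap r =>
      rw [AlgHom.commutes, DirectSum.algebraMap_apply]; rfl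
    | add x y i hx hy ihx ihy =>
      rw [map_add, ihx, ihy, ← map_add]
      rfl
    | mem_mul m hm i x hx ih =>
      obtain ⟨m, rfl⟩ := hm
      rw [map_mul, ih, SymmetricAlgebra.lift_ι_apply]
      change DirectSum.of _ 1 _ * _ = _
      rw [DirectSum.of_mul_of]
      exact DirectSum.of_eq_of_gradedMonoid_eq (Sigma.subtype_ext (add_comm _ _) rfl)

variable {R M}
variable {R' M' : Type u} [CommRing R'] [AddCommGroup M'] [Module R' M']
variable {R'' M'' : Type u} [CommRing R''] [AddCommGroup M''] [Module R'' M'']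

/-- The map of symmetric algebras induced by a semilinear map. -/
def symMap (φ : R →+* R') (g : M →ₛₗ[φ] M') : SymmetricAlgebra R M →+* SymmetricAlgebra R' M' :=
  letI : Algebra R (SymmetricAlgebra R' M') := ((algebraMap R' _).comp φ).toAlgebra
  (SymmetricAlgebra.lift (R := R) (A := SymmetricAlgebra R' M')
    { toFun := fun m => SymmetricAlgebra.ι R' M' (g m)
      map_add' := by simp
      map_smul' := fun r m => by
        simp [Algebra.smul_def, RingHom.algebraMap_toAlgebra] }).toRingHom

@[simp]
lemma symMap_algebraMap (φ : R →+* R') (g : M →ₛₗ[φ] M') (r : R) :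
    symMap φ g (algebraMap R _ r) = algebraMap R' _ (φ r) :=
  letI : Algebra R (SymmetricAlgebra R' M') := ((algebraMap R' _).comp φ).toAlgebra
  AlgHom.commutes _ r

@[simp]
lemma symMap_ι (φ : R →+* R') (g : M →ₛₗ[φ] M') (m : M) :
    symMap φ g (SymmetricAlgebra.ι R M m) = SymmetricAlgebra.ι R' M' (g m) :=
  letI : Algebra R (SymmetricAlgebra R' M') := ((algebraMap R' _).comp φ).toAlgebra
  SymmetricAlgebra.lift_ι_apply _ _

lemma sym_ringHom_ext {B : Type*} [CommSemiring B] {f g : SymmetricAlgebra R M →+* B}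
    (h₁ : ∀ r, f (algebraMap R _ r) = g (algebraMap R _ r))
    (h₂ : ∀ m, f (SymmetricAlgebra.ι R M m) = g (SymmetricAlgebra.ι R M m)) : f = g := by
  refine RingHom.ext fun x => ?_
  induction x using SymmetricAlgebra.induction with
  | algebraMap r => exact h₁ r
  | ι x => exact h₂ x
  | mul a b ha hb => rw [map_mul, map_mul, ha, hb]
  | add a b ha hb => rw [map_add, map_add, ha, hb]

lemma symMap_mem (φ : R →+* R') (g : M →ₛₗ[φ] M') {n : ℕ} {x : SymmetricAlgebra R M}
    (hx : x ∈ symPow R M n) : symMap φ g x ∈ symPow R' M' n := by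
  induction hx using Submodule.pow_induction_on_left' with
  | algebraMap r => rw [symMap_algebraMap]; simp [symPow]
  | add x y i hx hy ihx ihy => rw [map_add]; exact add_mem ihx ihy
  | mem_mul m hm i x hx ih =>
    obtain ⟨m, rfl⟩ := hm
    rw [map_mul, symMap_ι, symPow, pow_succ']
    exact Submodule.mul_mem_mul (LinearMap.mem_range_self _ _) ih

/-- `symMap` as a homomorphism of graded rings. -/
def symGradedMap (φ : R →+* R') (g : M →ₛₗ[φ] M') : symPow R M →+*ᵍ symPow R' M' where
  __ := symMap φ g
  map_mem := symMap_mem φ g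

@[simp]
lemma symGradedMap_apply (φ : R →+* R') (g : M →ₛₗ[φ] M') (x) :
    symGradedMap φ g x = symMap φ g x := rfl

/-- The symmetric algebra commutes with localization at one element. -/
lemma isLocalization_symMap (φ : R →+* R') (g : M →ₛₗ[φ] M') (f : R)
    (hφ : letI := φ.toAlgebra; IsLocalization.Away f R')
    (hg₁ : ∀ m' : M', ∃ (n : ℕ) (m : M), φ f ^ n • m' = g m)
    (hg₂ : ∀ m : M, g m = 0 → ∃ n : ℕ, f ^ n • m = 0) :
    letI := (symMap φ g).toAlgebra
    IsLocalization.Away (algebraMap R (SymmetricAlgebra R M) f) (SymmetricAlgebra R' M') := by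
  let : Algebra R R' := φ.toAlgebra
  have : IsLocalization.Away f R' := hφ
  let : Module R M' := Module.compHom M' φ
  have : IsScalarTower R R' M' := ⟨fun r r' m => by
    rw [Algebra.smul_def, mul_smul]; rfl⟩
  let gl : M →ₗ[R] M' := { toFun := g, map_add' := map_add g, map_smul' := fun r m => g.map_smulₛₗ r m }
  have hf : IsUnit (φ f) := IsLocalization.Away.algebraMap_isUnit (S := R') f
  have hsm : ∀ (n : ℕ) (m : M'), f ^ n • m = φ f ^ n • m := fun n m => by
    rw [← map_pow]; rfl
  have : IsLocalizedModule (.powers f) gl := by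
    refine ⟨?_, ?_, ?_⟩
    · rintro ⟨_, n, rfl⟩
      rw [Module.End.isUnit_iff]
      have hu : IsUnit (φ f ^ n) := hf.pow n
      have : ⇑((algebraMap R (Module.End R M')) (f ^ n)) = fun m : M' => φ f ^ n • m := by
        ext m; exact hsm n m
      dsimp only
      rw [this]
      exact ⟨fun a b h => hu.smul_left_cancel.mp h, fun m => ⟨((hu.unit⁻¹ : R'ˣ) : R') • m, by
        simp only [smul_smul]
        rw [IsUnit.mul_val_inv hu, one_smul]⟩⟩
    · intro m'
      obtain ⟨n, m, h⟩ := hg₁ m'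
      exact ⟨(m, ⟨f ^ n, n, rfl⟩), (hsm n m').trans h⟩
    · intro a b h
      have h' : g (a - b) = 0 := by rw [map_sub, sub_eq_zero]; exact h
      obtain ⟨n, hn⟩ := hg₂ _ h'
      refine ⟨⟨f ^ n, n, rfl⟩, ?_⟩
      rw [smul_sub, sub_eq_zero] at hn
      exact hn
  let S := SymmetricAlgebra R M
  let S' := SymmetricAlgebra R' M'
  let F : S := algebraMap R S f
  let : Algebra S S' := (symMap φ g).toAlgebra
  let T := Localization.Away F
  have hunit : IsUnit (algebraMap S T F) := IsLocalization.Away.algebraMap_isUnit F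
  let ρ : R' →+* T := IsLocalization.Away.lift (S := R') f (g := (algebraMap S T).comp (algebraMap R S)) hunit
  have hρ : ∀ r, ρ (φ r) = algebraMap S T (algebraMap R S r) := fun r =>
    IsLocalization.Away.lift_eq (S := R') f (g := (algebraMap S T).comp (algebraMap R S)) hunit r
  let : Algebra R' T := ρ.toAlgebra
  have hRT : ∀ r, algebraMap R T r = algebraMap S T (algebraMap R S r) :=
    IsScalarTower.algebraMap_apply R S T
  have : IsScalarTower R R' T := .of_algebraMap_eq fun r => (hRT r).trans (hρ r).symm
  let τ : M →ₗ[R] T :=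
    { toFun := fun m => algebraMap S T (SymmetricAlgebra.ι R M m)
      map_add' := by simp
      map_smul' := fun r m => by
        rw [map_smul, Algebra.smul_def, map_mul, ← hRT]; exact (Algebra.smul_def (A := T) r _).symm }
  have hTu : ∀ x : Submonoid.powers f, IsUnit ((algebraMap R (Module.End R T)) x) := by
    rintro ⟨_, n, rfl⟩
    rw [Module.End.isUnit_iff]
    have hu : IsUnit (algebraMap R T (f ^ n)) := by
      rw [map_pow, hRT]; exact hunit.pow n
    have : ⇑((algebraMap R (Module.End R T)) (f ^ n)) = fun m : T => algebraMap R T (f ^ n) * m := by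
      ext m; exact Algebra.smul_def (R := R) (A := T) (f ^ n) m
    dsimp only
    rw [this]
    exact ⟨fun a b h => hu.mul_left_cancel h, fun m => ⟨((hu.unit⁻¹ : Tˣ) : T) * m, by
      simp only [← mul_assoc]
      rw [IsUnit.mul_val_inv hu, one_mul]⟩⟩
  let τ' : M' →ₗ[R] T := IsLocalizedModule.lift (.powers f) gl τ hTu
  have hτ' : ∀ m, τ' (g m) = algebraMap S T (SymmetricAlgebra.ι R M m) := fun m =>
    LinearMap.congr_fun (IsLocalizedModule.lift_comp (.powers f) gl τ hTu) m
  let ψ : S' →+* T := (SymmetricAlgebra.lift (τ'.extendScalarsOfIsLocalization (.powers f) R')).toRingHom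
  have hψ₁ : ∀ r', ψ (algebraMap R' S' r') = ρ r' := fun r' => AlgHom.commutes _ r'
  have hψ₂ : ∀ m', ψ (SymmetricAlgebra.ι R' M' m') = τ' m' := fun m' =>
    SymmetricAlgebra.lift_ι_apply _ _
  have hψ : ψ.comp (symMap φ g) = algebraMap S T := by
    apply sym_ringHom_ext
    · intro r
      rw [RingHom.comp_apply, symMap_algebraMap, hψ₁, hρ]
    · intro m
      rw [RingHom.comp_apply, symMap_ι, hψ₂, hτ']
  have hFS : symMap φ g F = algebraMap R' S' (φ f) := symMap_algebraMap _ _ _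
  have hsurj : ∀ z : S', ∃ (n : ℕ) (a : S), z * symMap φ g F ^ n = symMap φ g a := by
    intro z
    induction z using SymmetricAlgebra.induction with
    | algebraMap r' =>
      obtain ⟨⟨a, _, n, rfl⟩, h⟩ := IsLocalization.surj (.powers f) r'
      refine ⟨n, algebraMap R S a, ?_⟩
      rw [hFS, symMap_algebraMap, ← map_pow, ← map_mul, ← map_pow]
      exact congrArg _ h
    | ι m' =>
      obtain ⟨n, m, h⟩ := hg₁ m'
      refine ⟨n, SymmetricAlgebra.ι R M m, ?_⟩
      rw [hFS, symMap_ι, ← h, map_smul, Algebra.smul_def, map_pow, mul_comm]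
    | mul a b ha hb =>
      obtain ⟨n, x, hx⟩ := ha
      obtain ⟨k, y, hy⟩ := hb
      refine ⟨n + k, x * y, ?_⟩
      rw [map_mul, ← hx, ← hy, pow_add]; ring
    | add a b ha hb =>
      obtain ⟨n, x, hx⟩ := ha
      obtain ⟨k, y, hy⟩ := hb
      refine ⟨n + k, x * F ^ k + y * F ^ n, ?_⟩
      rw [map_add, map_mul, map_mul, map_pow, map_pow, ← hx, ← hy, pow_add]; ring
  refine ⟨?_, ?_, ?_⟩
  · rintro ⟨_, n, rfl⟩
    change IsUnit (symMap φ g (F ^ n))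
    rw [map_pow, hFS]
    exact (hf.map _).pow n
  · intro z
    obtain ⟨n, a, h⟩ := hsurj z
    refine ⟨(a, ⟨F ^ n, n, rfl⟩), ?_⟩
    change z * symMap φ g (F ^ n) = symMap φ g a
    rw [map_pow, h]
  · intro a b h
    have h' : algebraMap S T a = algebraMap S T b := by
      rw [← hψ, RingHom.comp_apply, RingHom.comp_apply]; exact congrArg ψ h
    exact IsLocalization.exists_of_eq (M := .powers F) h'

end SymmetricAlgebra

section ProjLocalization

variable {A B : Type u} [CommRing A] [CommRing B] {σ τ : Type u}
  [SetLike σ A] [AddSubgroupClass σ A] [SetLike τ B] [AddSubgroupClass τ B]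
  {𝒜 : ℕ → σ} {ℬ : ℕ → τ} [GradedRing 𝒜] [GradedRing ℬ]

lemma exists_homogeneous_lift (φ : 𝒜 →+*ᵍ ℬ) (r : A)
    (H : letI := φ.toRingHom.toAlgebra; IsLocalization.Away r B)
    {n : ℕ} {b : B} (hb : b ∈ ℬ n) (hr : r ∈ 𝒜 0) :
    ∃ (k : ℕ) (a : A), a ∈ 𝒜 n ∧ b * φ r ^ k = φ a := by
  let := φ.toRingHom.toAlgebra
  obtain ⟨⟨a, _, k, rfl⟩, h⟩ := IsLocalization.surj (.powers r) b
  have h' : b * φ r ^ k = φ a := by rw [← map_pow]; exact h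
  refine ⟨k, DirectSum.decompose 𝒜 a n, SetLike.coe_mem _, ?_⟩
  rw [GradedRingHom.map_directSumDecompose, ← h']
  have hm : b * φ r ^ k ∈ ℬ n := by
    have := SetLike.mul_mem_graded hb (SetLike.pow_mem_graded k (φ.map_mem hr))
    simpa using this
  rw [DirectSum.decompose_of_mem_same _ hm]

lemma isUnit_map_of_localization (φ : 𝒜 →+*ᵍ ℬ) (r : A)
    (H : letI := φ.toRingHom.toAlgebra; IsLocalization.Away r B) :
    IsUnit (φ r) :=
  let := φ.toRingHom.toAlgebra
  IsLocalization.Away.algebraMap_isUnit (S := B) r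

lemma irrelevant_le_map_of_localization (φ : 𝒜 →+*ᵍ ℬ) (r : A) (hr : r ∈ 𝒜 0)
    (H : letI := φ.toRingHom.toAlgebra; IsLocalization.Away r B) :
    ℬ₊ ≤ 𝒜₊.map φ := by
  rw [HomogeneousIdeal.irrelevant_le]
  intro i hi b hb
  obtain ⟨k, a, ha, h⟩ := exists_homogeneous_lift φ r H hb hr
  have hu := (isUnit_map_of_localization φ r H).pow k
  have hm : φ a ∈ (𝒜₊.map φ).toIdeal :=
    Ideal.mem_map_of_mem _ (HomogeneousIdeal.mem_irrelevant_of_mem _ hi ha)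
  rw [← h] at hm
  exact (Ideal.mul_unit_mem_iff_mem _ hu).mp hm

lemma isLocalization_awayMap (φ : 𝒜 →+*ᵍ ℬ) (r : A) (hr : r ∈ 𝒜 0)
    (H : letI := φ.toRingHom.toAlgebra; IsLocalization.Away r B)
    {d : ℕ} {t : A} (ht : t ∈ 𝒜 d) :
    letI := (Away.map φ t).toAlgebra
    IsLocalization.Away (fromZeroRingHom 𝒜 (.powers t) ⟨r, hr⟩) (Away ℬ (φ t)) := by
  let := φ.toRingHom.toAlgebra
  let := (Away.map φ t).toAlgebra
  have hφr : φ r ∈ ℬ 0 := φ.map_mem hr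
  have hφt : φ t ∈ ℬ d := φ.map_mem ht
  have hz : ∀ k : ℕ, (fromZeroRingHom 𝒜 (.powers t) ⟨r, hr⟩) ^ k =
      Away.mk 𝒜 ht 0 (r ^ k) (by simpa using SetLike.pow_mem_graded k hr) := by
    intro k
    ext
    rw [val_pow, Away.val_mk]
    change (Localization.mk r 1) ^ k = _
    rw [Localization.mk_pow]
    congr 1
    ext
    simp
  have hmul : ∀ (k n : ℕ) (a : A) (ha : a ∈ 𝒜 (n • d)),
      (fromZeroRingHom 𝒜 (.powers t) ⟨r, hr⟩) ^ k * Away.mk 𝒜 ht n a ha =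
      Away.mk 𝒜 ht n (r ^ k * a) (by
        simpa using SetLike.mul_mem_graded (SetLike.pow_mem_graded k hr) ha) := by
    intro k n a ha
    rw [hz]
    ext
    rw [val_mul, Away.val_mk, Away.val_mk, Away.val_mk, Localization.mk_mul]
    congr 1
    ext
    simp
  have hu := isUnit_map_of_localization φ r H
  have hφmul : ∀ (k n : ℕ) (a : B) (ha : a ∈ ℬ (n • d)),
      (Away.map φ t (fromZeroRingHom 𝒜 (.powers t) ⟨r, hr⟩)) ^ k * Away.mk ℬ hφt n a ha =
      Away.mk ℬ hφt n (φ r ^ k * a) (by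
        simpa using SetLike.mul_mem_graded (SetLike.pow_mem_graded k hφr) ha) := by
    intro k n a ha
    rw [← map_pow, hz, Away.map_mk]
    ext
    rw [val_mul, Away.val_mk, Away.val_mk, Away.val_mk, Localization.mk_mul, map_pow]
    congr 1
    ext
    simp
  refine ⟨?_, ?_, ?_⟩
  · rintro ⟨_, n, rfl⟩
    rw [map_pow]
    refine IsUnit.pow n ?_
    obtain ⟨u, hu'⟩ := hu.exists_right_inv
    have h1 : φ r * DirectSum.decompose ℬ u 0 = 1 := by
      rw [← DirectSum.coe_decompose_mul_of_left_mem_zero ℬ hφr]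
      erw [hu']
      exact DirectSum.decompose_of_mem_same _ SetLike.GradedOne.one_mem
    have h2 : (Away.map φ t (fromZeroRingHom 𝒜 (.powers t) ⟨r, hr⟩)) ^ 1 *
      Away.mk ℬ hφt 0 (DirectSum.decompose ℬ u 0) (by simp) = 1 := by
      rw [hφmul]
      ext
      rw [Away.val_mk, pow_one, h1]
      simp
    rw [pow_one] at h2
    exact IsUnit.of_mul_eq_one _ h2
  · intro z
    obtain ⟨n, b, hb, rfl⟩ := Away.mk_surjective ℬ hφt z
    obtain ⟨k, a, ha, h⟩ := exists_homogeneous_lift φ r H hb hr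
    refine ⟨(Away.mk 𝒜 ht n a ha, ⟨_, k, rfl⟩), ?_⟩
    change _ * Away.map φ t _ = Away.map φ t _
    rw [map_pow, mul_comm, hφmul, Away.map_mk]
    congr 1
    rw [← h, mul_comm]
  · intro x y h
    have h0 : Away.map φ t (x - y) = 0 := by rw [map_sub, sub_eq_zero]; exact h
    obtain ⟨n, a, ha, hxy⟩ := Away.mk_surjective 𝒜 ht (x - y)
    rw [← hxy, Away.map_mk] at h0
    have hφa : φ a ∈ ℬ (n • d) := φ.map_mem ha
    have h1 : (Away.mk ℬ hφt n (φ a) hφa).val = 0 := (congrArg _ h0).trans val_zero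
    rw [Away.val_mk] at h1
    rw [Localization.mk_eq_mk', IsLocalization.mk'_eq_zero_iff] at h1
    obtain ⟨⟨_, m, rfl⟩, hm⟩ := h1
    have h2 : φ (t ^ m * a) = φ 0 := by rw [map_mul, map_pow, map_zero]; exact hm
    obtain ⟨⟨_, k, rfl⟩, hk⟩ := IsLocalization.exists_of_eq (M := .powers r) (S := B) h2
    refine ⟨⟨_, k, rfl⟩, ?_⟩
    rw [← sub_eq_zero, ← mul_sub, ← hxy]
    simp only
    rw [hmul]
    ext
    rw [Away.val_mk, val_zero, Localization.mk_eq_mk', IsLocalization.mk'_eq_zero_iff]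
    refine ⟨⟨t ^ m, m, rfl⟩, ?_⟩
    simp only [mul_zero] at hk ⊢
    rw [← hk]; ring

lemma isPullback_awayMap (φ : 𝒜 →+*ᵍ ℬ) {d : ℕ} (hd : 0 < d) {t : A} (ht : t ∈ 𝒜 d) (hφ : ℬ₊ ≤ 𝒜₊.map φ) :
    IsPullback (Spec.map (CommRingCat.ofHom (Away.map φ t))) (Proj.awayι ℬ (φ t) (φ.map_mem ht) hd)
      (Proj.awayι 𝒜 t ht hd) (Proj.map φ hφ) := by
  refine IsOpenImmersion.isPullback _ _ _ _ (Proj.awayι_comp_map φ hφ hd t ht) ?_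
  rw [Proj.opensRange_awayι, Proj.opensRange_awayι, Proj.map_preimage_basicOpen]

lemma isOpenImmersion_projMap (φ : 𝒜 →+*ᵍ ℬ) (r : A) (hr : r ∈ 𝒜 0)
    (H : letI := φ.toRingHom.toAlgebra; IsLocalization.Away r B)
    (hφ : ℬ₊ ≤ 𝒜₊.map φ) : IsOpenImmersion (Proj.map φ hφ) := by
  rw [IsZariskiLocalAtTarget.iff_of_openCover (P := @IsOpenImmersion) (Proj.affineOpenCover 𝒜).openCover]
  intro i
  have h := isPullback_awayMap φ i.1.2 i.2.2 hφ
  let := (Away.map φ (i.2 : A)).toAlgebra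
  have hloc := isLocalization_awayMap φ r hr H i.2.2
  have : IsOpenImmersion (Spec.map (CommRingCat.ofHom (Away.map φ (i.2 : A)))) :=
    IsOpenImmersion.of_isLocalization
      (fromZeroRingHom 𝒜 (.powers (i.2 : A)) ⟨r, hr⟩)
  have e : (Proj.affineOpenCover 𝒜).openCover.pullbackHom (Proj.map φ hφ) i =
    h.flip.isoPullback.inv ≫ Spec.map (CommRingCat.ofHom (Away.map φ (i.2 : A))) :=
      (h.flip.isoPullback_inv_snd).symm
  rw [e]
  exact MorphismProperty.comp_mem _ _ _ inferInstance this

lemma opensRange_projMap (φ : 𝒜 →+*ᵍ ℬ) (r : A) (hr : r ∈ 𝒜 0)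
    (H : letI := φ.toRingHom.toAlgebra; IsLocalization.Away r B)
    (hφ : ℬ₊ ≤ 𝒜₊.map φ) [IsOpenImmersion (Proj.map φ hφ)] :
    (Proj.map φ hφ).opensRange =
      Proj.toSpecZero 𝒜 ⁻¹ᵁ (PrimeSpectrum.basicOpen (⟨r, hr⟩ : 𝒜 0)) := by
  ext x
  obtain ⟨i, y, rfl⟩ := (Proj.affineOpenCover 𝒜).openCover.exists_eq x
  have h := isPullback_awayMap φ i.1.2 i.2.2 hφ
  let := (Away.map φ (i.2 : A)).toAlgebra
  have hloc := isLocalization_awayMap φ r hr H i.2.2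
  have hrange : Set.range (Spec.map (CommRingCat.ofHom (Away.map φ (i.2 : A)))) =
      (PrimeSpectrum.basicOpen (fromZeroRingHom 𝒜 (.powers (i.2 : A)) ⟨r, hr⟩) :
        Set (PrimeSpectrum (Away 𝒜 (i.2 : A)))) :=
    PrimeSpectrum.localization_away_comap_range (Away ℬ (φ (i.2 : A)))
      (fromZeroRingHom 𝒜 (.powers (i.2 : A)) ⟨r, hr⟩)
  have h1 : (Proj.affineOpenCover 𝒜).openCover.f i y ∈ Set.range (Proj.map φ hφ) ↔
      y ∈ Set.range (Spec.map (CommRingCat.ofHom (Away.map φ (i.2 : A)))) := by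
    constructor
    · rintro ⟨z, hz⟩
      obtain ⟨w, hw, -⟩ := Scheme.exists_preimage_of_isPullback h y z hz.symm
      exact ⟨w, hw⟩
    · rintro ⟨w, rfl⟩
      refine ⟨Proj.awayι ℬ (φ (i.2 : A)) (φ.map_mem i.2.2) i.1.2 w, ?_⟩
      exact congrArg (fun f => f w) (Proj.awayι_comp_map φ hφ i.1.2 (i.2 : A) i.2.2)
  have h2 : (Proj.affineOpenCover 𝒜).openCover.f i y ∈
      Proj.toSpecZero 𝒜 ⁻¹ᵁ (PrimeSpectrum.basicOpen (⟨r, hr⟩ : 𝒜 0)) ↔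
      y ∈ PrimeSpectrum.basicOpen (fromZeroRingHom 𝒜 (.powers (i.2 : A)) ⟨r, hr⟩) := by
    have h3 := congrArg (fun f => f y) (Proj.awayι_toSpecZero 𝒜 (i.2 : A) i.2.2 i.1.2)
    have h4 : Proj.toSpecZero 𝒜 ((Proj.affineOpenCover 𝒜).openCover.f i y) =
      Spec.map (CommRingCat.ofHom (fromZeroRingHom 𝒜 (.powers (i.2 : A)))) y := h3
    have h5 : ∀ z : Spec (.of (𝒜 0)),
        z = Spec.map (CommRingCat.ofHom (fromZeroRingHom 𝒜 (.powers (i.2 : A)))) y →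
        ((⟨r, hr⟩ : 𝒜 0) ∉ z.asIdeal ↔
          fromZeroRingHom 𝒜 (.powers (i.2 : A)) ⟨r, hr⟩ ∉ y.asIdeal) := by
      rintro _ rfl
      exact Iff.rfl
    exact h5 _ h4
  refine h1.trans (Iff.trans ?_ h2.symm)
  rw [hrange]
  rfl

end ProjLocalization

section QuasiCoherent

lemma spec_existence {R : CommRingCat.{u}} (N : (Spec R).Modules) [N.IsQuasicoherent] (f : R)
    (D : (Spec R).Opens) (hD : D = PrimeSpectrum.basicOpen f) (s : Γ(N, D)) :
    ∃ (n : ℕ) (t : Γ(N, ⊤)), f ^ n • s = N.presheaf.map D.leTop.op t := by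
  subst hD
  have h := (isIso_fromTildeΓ_iff_isLocalizing N).mp inferInstance f
  obtain ⟨⟨t, ⟨_, n, rfl⟩⟩, ht⟩ := h.surj s
  exact ⟨n, t, ht⟩

lemma spec_uniqueness {R : CommRingCat.{u}} (N : (Spec R).Modules) [N.IsQuasicoherent] (f : R)
    (D : (Spec R).Opens) (hD : D = PrimeSpectrum.basicOpen f)
    (t : Γ(N, ⊤)) (ht : N.presheaf.map D.leTop.op t = 0) :
    ∃ n : ℕ, f ^ n • t = 0 := by
  subst hD
  have h := (isIso_fromTildeΓ_iff_isLocalizing N).mp inferInstance f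
  obtain ⟨⟨_, n, rfl⟩, hc⟩ := h.exists_of_eq (x₁ := t) (x₂ := 0) (by rw [map_zero]; exact ht)
  refine ⟨n, ?_⟩
  rw [smul_zero] at hc
  exact hc

variable {X : Scheme.{u}} (M : X.Modules)

lemma restrict_smul_aux {R : CommRingCat.{u}} (j : Spec R ⟶ X) [IsOpenImmersion j]
    (D : (Spec R).Opens)
    (r : R) (t : Γ(M, j ''ᵁ D)) :
      (M.restrictAppIso j D).hom (r • (M.restrictAppIso j D).inv t) =
        X.presheaf.map (homOfLE (j.image_mono (le_top : D ≤ ⊤))).op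
          ((j.appIso ⊤).inv ((Scheme.ΓSpecIso R).inv r)) • t := by
  rw [Scheme.Modules.smul_Spec_def]
  have := M.smul_restrictAppIso_hom_apply j D
      (((Spec R).presheaf.map D.leTop.op) ((Scheme.ΓSpecIso R).inv r))
      ((M.restrictAppIso j D).inv t)
  refine this.trans ?_
  have e : (Spec R).presheaf.map D.leTop.op ≫ (j.appIso D).inv =
    (j.appIso ⊤).inv ≫ X.presheaf.map (homOfLE (j.image_mono le_top)).op := by
    rw [Iso.comp_inv_eq, Category.assoc, Iso.eq_inv_comp]
    simp [Scheme.Hom.appIso_hom']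
  have e2 := congr($e ((Scheme.ΓSpecIso R).inv r))
  simp only [CommRingCat.comp_apply] at e2
  rw [← e2]
  rfl

lemma qc_aux {R : CommRingCat.{u}} (j : Spec R ⟶ X) [IsOpenImmersion j] [M.IsQuasicoherent] (f : R)
    (U D : X.Opens) (D' : (Spec R).Opens) (hD' : D' = PrimeSpectrum.basicOpen f)
    (hU : j ''ᵁ ⊤ = U) (hD : j ''ᵁ D' = D) (hDU : D ≤ U)
    (a : Γ(X, U)) (ha : X.presheaf.map (eqToHom hU).op a =
      (j.appIso ⊤).inv ((Scheme.ΓSpecIso R).inv f)) :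
    (∀ s : Γ(M, D), ∃ (n : ℕ) (t : Γ(M, U)),
      (X.presheaf.map (homOfLE hDU).op a) ^ n • s = M.presheaf.map (homOfLE hDU).op t) ∧
    (∀ t : Γ(M, U), M.presheaf.map (homOfLE hDU).op t = 0 → ∃ n : ℕ, a ^ n • t = 0) := by
  subst hU hD
  simp only [eqToHom_refl, op_id, CategoryTheory.Functor.map_id, CommRingCat.id_apply] at ha
  subst ha
  constructor
  · intro s
    obtain ⟨n, t, ht⟩ := spec_existence (M.restrict j) f D' hD' ((M.restrictAppIso j D').inv s)
    refine ⟨n, (M.restrictAppIso j ⊤).hom t, ?_⟩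
    rw [← map_pow, ← map_pow, ← map_pow, ← restrict_smul_aux, ht]
    rfl
  · intro t ht
    obtain ⟨n, hn⟩ := spec_uniqueness (M.restrict j) f D' hD' ((M.restrictAppIso j ⊤).inv t) ht
    refine ⟨n, ?_⟩
    rw [← map_pow, ← map_pow]
    have := restrict_smul_aux M j ⊤ (f ^ n) t
    rw [hn] at this
    simpa using this.symm

lemma qc_basicOpen [M.IsQuasicoherent] {U : X.Opens} (hU : IsAffineOpen U) (f : Γ(X, U))
    (D : X.Opens) (hD : D = X.basicOpen f) (hDU : D ≤ U) :
    (∀ s : Γ(M, D), ∃ (n : ℕ) (t : Γ(M, U)),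
      (X.presheaf.map (homOfLE hDU).op f) ^ n • s = M.presheaf.map (homOfLE hDU).op t) ∧
    (∀ t : Γ(M, U), M.presheaf.map (homOfLE hDU).op t = 0 → ∃ n : ℕ, f ^ n • t = 0) := by
  refine qc_aux M hU.fromSpec f U D (PrimeSpectrum.basicOpen f) rfl ?_ ?_ hDU f ?_
  · simp
  · rw [hD, hU.fromSpec_image_basicOpen]
  · have h : X.presheaf.map (eqToHom (show hU.fromSpec ''ᵁ ⊤ = U by simp)).op ≫
      (hU.fromSpec.appIso ⊤).hom = (Scheme.ΓSpecIso Γ(X, U)).inv := by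
      rw [Scheme.Hom.appIso_hom']
      simp
      rw [Scheme.Hom.appLE, IsAffineOpen.fromSpec_app_self, Category.assoc, ← Functor.map_comp]
      exact (congr_arg _ ((Spec Γ(X, U)).presheaf.map_id _)).trans (Category.comp_id _)
    rw [← Iso.eq_comp_inv] at h
    exact congr($h f)

end QuasiCoherent

section Gluing

variable {S : Scheme.{u}} {𝒰 : S.OpenCover} [Category 𝒰.I₀] [𝒰.LocallyDirected]
  [Small.{u} 𝒰.I₀] [Quiver.IsThin 𝒰.I₀] (d : 𝒰.RelativeGluingData)

lemma isOpenImmersion_gluingCover (i : 𝒰.I₀) : IsOpenImmersion (d.cover.f i) :=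
  d.cover.map_prop i

lemma map_gluingCover {i j : 𝒰.I₀} (h : i ⟶ j) :
    d.functor.map h ≫ d.cover.f j = d.cover.f i :=
  colimit.w d.functor h

end Gluing

section Charts

variable {X : Scheme.{u}} (E : X.Modules)

/-- The restriction map of a sheaf of modules as a semilinear map. -/
def resMod {U V : X.Opens} (h : V ≤ U) :
    Γ(E, U) →ₛₗ[(X.presheaf.map (homOfLE h).op).hom] Γ(E, V) where
  toFun := E.presheaf.map (homOfLE h).op
  map_add' := map_add _
  map_smul' r m := E.map_smul (homOfLE h) r m

lemma resMod_self {U : X.Opens} (h : U ≤ U) (t : Γ(E, U)) : resMod E h t = t :=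
  congr($(E.presheaf.map_id (.op U)) t)

lemma resMod_resMod {U V W : X.Opens} (h : V ≤ U) (h' : W ≤ V) (t : Γ(E, U)) :
    resMod E h' (resMod E h t) = resMod E (h'.trans h) t :=
  (congr($(E.presheaf.map_comp (homOfLE h).op (homOfLE h').op) t)).symm

/-- The homogeneous pieces of the symmetric algebra of the module of sections over `U`. -/
abbrev symSec (U : X.Opens) : ℕ → Submodule Γ(X, U) (SymmetricAlgebra Γ(X, U) Γ(E, U)) :=
  symPow Γ(X, U) Γ(E, U)

/-- Restriction on symmetric algebras of modules of sections. -/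
def symRes {U V : X.Opens} (h : V ≤ U) : symSec E U →+*ᵍ symSec E V :=
  symGradedMap (X.presheaf.map (homOfLE h).op).hom (resMod E h)

lemma symRes_algebraMap {U V : X.Opens} (h : V ≤ U) (r : Γ(X, U)) :
    symRes E h (algebraMap _ _ r) = algebraMap _ _ (X.presheaf.map (homOfLE h).op r) :=
  symMap_algebraMap _ _ _

lemma symRes_ι {U V : X.Opens} (h : V ≤ U) (t : Γ(E, U)) :
    symRes E h (SymmetricAlgebra.ι _ _ t) =
      SymmetricAlgebra.ι _ _ (E.presheaf.map (homOfLE h).op t) :=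
  symMap_ι _ _ _

lemma symRes_refl (U : X.Opens) : symRes E (le_refl U) = GradedRingHom.id _ := by
  apply GradedRingHom.ext
  intro x
  refine RingHom.congr_fun (f := (symRes E (le_refl U)).toRingHom) (g := RingHom.id _)
    (sym_ringHom_ext (fun r => ?_) fun m => ?_) x
  · refine (symRes_algebraMap E _ r).trans ?_
    exact congrArg _ (congr($(X.presheaf.map_id (.op U)) r))
  · refine (symRes_ι E _ m).trans ?_
    exact congrArg _ (congr($(E.presheaf.map_id (.op U)) m))

lemma symRes_comp {U V W : X.Opens} (h : V ≤ U) (h' : W ≤ V) :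
    (symRes E h').comp (symRes E h) = symRes E (h'.trans h) := by
  apply GradedRingHom.ext
  intro x
  refine RingHom.congr_fun (f := (symRes E h').toRingHom.comp (symRes E h).toRingHom)
    (g := (symRes E (h'.trans h)).toRingHom)
    (sym_ringHom_ext (fun r => ?_) fun m => ?_) x
  · refine Eq.trans ?_ (symRes_algebraMap E _ r).symm
    refine (congrArg (symRes E h') (symRes_algebraMap E h r)).trans ?_
    refine (symRes_algebraMap E _ _).trans ?_
    exact congrArg _ (congr($(X.presheaf.map_comp (homOfLE h).op (homOfLE h').op) r)).symm
  · refine Eq.trans ?_ (symRes_ι E _ m).symm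
    refine (congrArg (symRes E h') (symRes_ι E h m)).trans ?_
    refine (symRes_ι E _ _).trans ?_
    exact congrArg _ (congr($(E.presheaf.map_comp (homOfLE h).op (homOfLE h').op) m)).symm

lemma isLocalization_symRes [E.IsQuasicoherent] {U : X.Opens} (hU : IsAffineOpen U) (f : Γ(X, U)) {V : X.Opens}
    (hV : V = X.basicOpen f) (h : V ≤ U) :
    letI := (symRes E h).toRingHom.toAlgebra
    IsLocalization.Away (algebraMap Γ(X, U) (SymmetricAlgebra Γ(X, U) Γ(E, U)) f)
      (SymmetricAlgebra Γ(X, V) Γ(E, V)) := by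
  refine isLocalization_symMap _ (resMod E h) f ?_ (qc_basicOpen E hU f V hV h).1
    (qc_basicOpen E hU f V hV h).2
  subst hV
  exact hU.isLocalization_basicOpen f

lemma algebraMap_mem_symSec (U : X.Opens) (f : Γ(X, U)) :
    algebraMap Γ(X, U) (SymmetricAlgebra Γ(X, U) Γ(E, U)) f ∈ symSec E U 0 :=
  SetLike.algebraMap_mem_graded _ _

lemma irrelevant_symRes [E.IsQuasicoherent] {U V : X.AffineZariskiSite} (h : V ≤ U) :
    (symSec E V.toOpens)₊ ≤ (symSec E U.toOpens)₊.map (symRes E (Scheme.AffineZariskiSite.toOpens_mono h)) := by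
  obtain ⟨f, hf⟩ := h
  exact irrelevant_le_map_of_localization _ _ (algebraMap_mem_symSec E _ f)
    (isLocalization_symRes E U.2 f hf.symm _)

/-- The map `Proj (Sym Γ(E, V)) ⟶ Proj (Sym Γ(E, U))` for a basic open `V` of `U`. -/
def projRes [E.IsQuasicoherent] {U V : X.AffineZariskiSite} (h : V ≤ U) :
    Proj (symSec E V.toOpens) ⟶ Proj (symSec E U.toOpens) :=
  Proj.map (symRes E (Scheme.AffineZariskiSite.toOpens_mono h)) (irrelevant_symRes E h)

/-- The functor sending an affine open `U` to `Proj (Sym Γ(E, U))`. -/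
def projFunctor [E.IsQuasicoherent] : X.AffineZariskiSite ⥤ Scheme.{u} where
  obj U := Proj (symSec E U.toOpens)
  map {V U} h := projRes E h.le
  map_id U := by
    rw [← Proj.map_id, projRes]
    congr 1
    exact symRes_refl E _
  map_comp {W V U} h h' := by
    rw [projRes, projRes, projRes, ← Proj.map_comp]
    congr 1
    exact (symRes_comp E _ _).symm

/-- The structure map `Proj (Sym Γ(E, U)) ⟶ Spec Γ(X, U)`. -/
def projToSpec (U : X.Opens) : Proj (symSec E U) ⟶ Spec Γ(X, U) :=
  Proj.toSpecZero (symSec E U) ≫ Spec.map (CommRingCat.ofHom (algebraMap Γ(X, U) (symSec E U 0)))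

lemma awayι_projToSpec (U : X.Opens) {d : ℕ} (hd : 0 < d) (t) (ht : t ∈ symSec E U d) :
    Proj.awayι (symSec E U) t ht hd ≫ projToSpec E U =
      Spec.map (CommRingCat.ofHom ((fromZeroRingHom (symSec E U) (.powers t)).comp
        (algebraMap Γ(X, U) (symSec E U 0)))) := by
  rw [projToSpec, Proj.awayι_toSpecZero_assoc, ← Spec.map_comp]
  rfl

lemma awayMap_aux {U V : X.Opens} (h : V ≤ U) (r : Γ(X, U))
    (t : SymmetricAlgebra Γ(X, U) Γ(E, U)) :
    Away.map (symRes E h) t (fromZeroRingHom (symSec E U) (.powers t)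
        (algebraMap Γ(X, U) (symSec E U 0) r)) =
      fromZeroRingHom (symSec E V) (.powers (symRes E h t))
        (algebraMap Γ(X, V) (symSec E V 0) (X.presheaf.map (homOfLE h).op r)) := by
  change HomogeneousLocalization.mk _ = HomogeneousLocalization.mk _
  ext
  rw [val_mk, val_mk]
  dsimp only [NumDenSameDeg.embedding]
  congr 1
  · exact symRes_algebraMap E h r
  · exact Subtype.ext (map_one (symRes E h))

lemma projMap_projToSpec {U V : X.Opens} (h : V ≤ U)
    (H : (symSec E V)₊ ≤ (symSec E U)₊.map (symRes E h)) :
    Proj.map (symRes E h) H ≫ projToSpec E U =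
      projToSpec E V ≫ Spec.map (X.presheaf.map (homOfLE h).op) := by
  refine (Proj.mapAffineOpenCover (symRes E h) H).openCover.hom_ext _ _ fun s => ?_
  have e₁ := Proj.awayι_comp_map_assoc (symRes E h) H s.1.2 _ s.2.2 (projToSpec E U)
  have e₂ := awayι_projToSpec E U s.1.2 _ s.2.2
  have e₃ := awayι_projToSpec E V s.1.2 _ ((symRes E h).map_mem s.2.2)
  refine e₁.trans ?_
  rw [e₂, ← Spec.map_comp]
  refine Eq.trans ?_ (congrArg (· ≫ Spec.map (X.presheaf.map (homOfLE h).op)) e₃.symm)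
  rw [← Spec.map_comp]
  congr 1
  ext r
  exact congrArg HomogeneousLocalization.val (awayMap_aux E h r _)

variable [E.IsQuasicoherent]

lemma projFunctor_map_projToSpec {U V : X.AffineZariskiSite} (h : V ⟶ U) :
    (projFunctor E).map h ≫ projToSpec E U.toOpens =
      projToSpec E V.toOpens ≫ Spec.map (X.presheaf.map
        ((Scheme.AffineZariskiSite.toOpensFunctor X).map h).op) :=
  projMap_projToSpec E _ _

/-- The structure maps `Proj (Sym Γ(E, U)) ⟶ Spec Γ(X, U)`, as a natural transformation. -/
def projNatTrans : projFunctor E ⟶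
    Scheme.AffineZariskiSite.toOpensFunctor X ⋙ X.presheaf.rightOp ⋙ Scheme.Spec where
  app U := projToSpec E U.toOpens
  naturality _ _ h := projFunctor_map_projToSpec E h

lemma projToSpec_preimage_basicOpen (U : X.Opens) (f : Γ(X, U)) :
    projToSpec E U ⁻¹ᵁ (PrimeSpectrum.basicOpen f) = Proj.toSpecZero (symSec E U) ⁻¹ᵁ
      (PrimeSpectrum.basicOpen ⟨algebraMap Γ(X, U) _ f, algebraMap_mem_symSec E U f⟩) := by
  have h : Spec.map (CommRingCat.ofHom (algebraMap Γ(X, U) (symSec E U 0))) ⁻¹ᵁ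
      (PrimeSpectrum.basicOpen f) =
      PrimeSpectrum.basicOpen (algebraMap Γ(X, U) (symSec E U 0) f) := rfl
  refine (Scheme.Hom.comp_preimage _ _ _).trans ?_
  exact congrArg (fun W => Proj.toSpecZero (symSec E U) ⁻¹ᵁ W) h

lemma isPullback_projMap {U V : X.Opens} (hU : IsAffineOpen U) (f : Γ(X, U))
    (hV : V = X.basicOpen f) (h : V ≤ U) (H : (symSec E V)₊ ≤ (symSec E U)₊.map (symRes E h)) :
    IsPullback (projToSpec E V) (Proj.map (symRes E h) H)
      (Spec.map (X.presheaf.map (homOfLE h).op)) (projToSpec E U) := by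
  have hloc := isLocalization_symRes E hU f hV h
  have hoi := isOpenImmersion_projMap _ _ (algebraMap_mem_symSec E U f) hloc H
  have hra := opensRange_projMap _ _ (algebraMap_mem_symSec E U f) hloc H
  let : Algebra Γ(X, U) Γ(X, V) := (X.presheaf.map (homOfLE h).op).hom.toAlgebra
  have hl : IsLocalization.Away f Γ(X, V) := hU.isLocalization_of_eq_basicOpen f _ hV
  have : IsOpenImmersion (Spec.map (X.presheaf.map (homOfLE h).op)) :=
    IsOpenImmersion.of_isLocalization f
  refine IsOpenImmersion.isPullback _ _ _ _ (projMap_projToSpec E h H) ?_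
  have hρ : (Spec.map (X.presheaf.map (homOfLE h).op)).opensRange = PrimeSpectrum.basicOpen f :=
    Opens.ext (PrimeSpectrum.localization_away_comap_range Γ(X, V) f)
  exact (congrArg (fun W => projToSpec E U ⁻¹ᵁ W) hρ).trans
    ((projToSpec_preimage_basicOpen E U f).trans hra.symm)

lemma projNatTrans_equifibered : (projNatTrans E).Equifibered := by
  rintro V U h
  obtain ⟨f, hf⟩ := h.le
  exact (isPullback_projMap E U.2 f hf.symm _ _).flip

/-- The relative gluing data defining the projective bundle. -/
def projGluing : (Scheme.AffineZariskiSite.directedCover X).RelativeGluingData where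
  functor := projFunctor E
  natTrans := projNatTrans E ≫ (Scheme.AffineZariskiSite.restrictIsoSpec X).inv
  equifibered := (projNatTrans_equifibered E).comp
    (@NatTrans.Equifibered.of_isIso _ _ _ _ _ _ _ (Iso.isIso_inv (Scheme.AffineZariskiSite.restrictIsoSpec X)))

/-- The projective bundle `Proj (Sym E)`, classifying invertible quotients of `E`. -/
def projBundle : Scheme.{u} := (projGluing E).glued

/-- The projection of the projective bundle onto the base. -/
def projBundleπ : projBundle E ⟶ X := (projGluing E).toBase

/-- The chart `Proj (Sym Γ(E, U))` of the projective bundle over an affine open `U`. -/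
def projChart (U : X.AffineZariskiSite) : Proj (symSec E U.toOpens) ⟶ projBundle E :=
  (projGluing E).cover.f U

instance (U : X.AffineZariskiSite) : IsOpenImmersion (projChart E U) :=
  isOpenImmersion_gluingCover (projGluing E) U

lemma projRes_projChart {U V : X.AffineZariskiSite} (h : V ≤ U) :
    projRes E h ≫ projChart E U = projChart E V :=
  map_gluingCover (projGluing E) (homOfLE h)

end Charts

section Twisting

/-- Restriction of functions to a smaller open set. -/
def res (P : Scheme.{u}) {U V : P.Opens} (h : V ≤ U) : Γ(P, U) →+* Γ(P, V) :=
  (P.presheaf.map (homOfLE h).op).hom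

variable {P : Scheme.{u}}

@[simp]
lemma res_self {U : P.Opens} (h : U ≤ U) (x : Γ(P, U)) : res P h x = x :=
  congr($(P.presheaf.map_id (.op U)) x)

@[simp]
lemma res_res {U V W : P.Opens} (h : V ≤ U) (h' : W ≤ V) (x : Γ(P, U)) :
    res P h' (res P h x) = res P (h'.trans h) x :=
  (congr($(P.presheaf.map_comp (homOfLE h).op (homOfLE h').op) x)).symm

lemma res_ext {ι : Type*} {W : P.Opens} (U : ι → P.Opens) (hU : ∀ i, U i ≤ W) (hW : W ≤ iSup U)
    (x y : Γ(P, W)) (h : ∀ i, res P (hU i) x = res P (hU i) y) : x = y :=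
  P.sheaf.eq_of_locally_eq' U W (fun i => homOfLE (hU i)) hW x y h

lemma res_glue {ι : Type*} {W : P.Opens} (U : ι → P.Opens) (hU : ∀ i, U i ≤ W) (hW : W ≤ iSup U)
    (x : ∀ i, Γ(P, U i))
    (h : ∀ i j, res P (inf_le_left : U i ⊓ U j ≤ _) (x i) =
      res P (inf_le_right : U i ⊓ U j ≤ _) (x j)) :
    ∃ y : Γ(P, W), ∀ i, res P (hU i) y = x i :=
  (P.sheaf.existsUnique_gluing' U W (fun i => homOfLE (hU i)) hW x h).exists

variable (P) in
/-- Transition data on a scheme: open sets `D i`, and for every relation `k` between the indices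
`src k` and `tgt k` a transition function on the overlap. -/
structure TransitionData where
  /-- the indices of the open sets -/
  ι : Type u
  /-- the open sets -/
  D : ι → P.Opens
  /-- the relations -/
  κ : Type u
  /-- the first index of a relation -/
  src : κ → ι
  /-- the second index of a relation -/
  tgt : κ → ι
  /-- the transition functions -/
  g : ∀ k, Γ(P, D (src k) ⊓ D (tgt k))

namespace TransitionData

variable (c : TransitionData P)

/-- The sections over `W` of the sheaf with transition data `c`: families of functions
`σ i` on `W ⊓ D i` such that `σ (src k) = g k * σ (tgt k)` on overlaps. -/
def sections (W : P.Opens) : AddSubgroup (∀ i, Γ(P, W ⊓ c.D i)) where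
  carrier := {σ | ∀ k, res P (inf_le_inf le_rfl inf_le_left) (σ (c.src k)) =
    res P (inf_le_right : W ⊓ (c.D (c.src k) ⊓ c.D (c.tgt k)) ≤ _) (c.g k) *
      res P (inf_le_inf le_rfl inf_le_right) (σ (c.tgt k))}
  zero_mem' k := by simp
  add_mem' {σ τ} hσ hτ k := by
    simp only [Pi.add_apply, map_add, hσ k, hτ k, mul_add]
  neg_mem' {σ} hσ k := by
    simp only [Pi.neg_apply, map_neg, hσ k, mul_neg]

lemma sections_compat {W : P.Opens} (σ : c.sections W) (k : c.κ) {V : P.Opens} (hV : V ≤ W)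
    (hs : V ≤ c.D (c.src k)) (ht : V ≤ c.D (c.tgt k)) :
    res P (le_inf hV hs) (σ.1 (c.src k)) =
      res P (le_inf hs ht) (c.g k) * res P (le_inf hV ht) (σ.1 (c.tgt k)) := by
  have := congrArg (res P (le_inf hV (le_inf hs ht))) (σ.2 k)
  simpa using this

instance (W : P.Opens) : SMul Γ(P, W) (c.sections W) where
  smul r σ := ⟨fun i => res P inf_le_left r * σ.1 i, fun k => by
    simp only [map_mul, res_res, σ.2 k]
    ring⟩

lemma smul_val {W : P.Opens} (r : Γ(P, W)) (σ : c.sections W) (i : c.ι) :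
    (r • σ).1 i = res P inf_le_left r * σ.1 i := rfl

instance (W : P.Opens) : Module Γ(P, W) (c.sections W) where
  one_smul σ := by ext i; simp [smul_val]
  mul_smul r r' σ := by ext i; simp [smul_val, mul_assoc]
  smul_zero r := by ext i; simp [smul_val]
  smul_add r σ τ := by ext i; simp [smul_val, mul_add]
  add_smul r r' σ := by ext i; simp [smul_val, add_mul]
  zero_smul σ := by ext i; simp [smul_val]

/-- Restriction of sections. -/
def restr {W W' : P.Opens} (h : W' ≤ W) : c.sections W →+ c.sections W' where
  toFun σ := ⟨fun i => res P (inf_le_inf h le_rfl) (σ.1 i), fun k => by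
    have := c.sections_compat σ k (inf_le_left.trans h : W' ⊓ (c.D (c.src k) ⊓ c.D (c.tgt k)) ≤ W)
      (inf_le_right.trans inf_le_left) (inf_le_right.trans inf_le_right)
    simpa using this⟩
  map_zero' := by ext i; simp
  map_add' σ τ := by ext i; simp

lemma restr_val {W W' : P.Opens} (h : W' ≤ W) (σ : c.sections W) (i : c.ι) :
    (c.restr h σ).1 i = res P (inf_le_inf h le_rfl) (σ.1 i) := rfl

lemma restr_smul {W W' : P.Opens} (h : W' ≤ W) (r : Γ(P, W)) (σ : c.sections W) :
    c.restr h (r • σ) = res P h r • c.restr h σ := by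
  ext i
  simp [restr_val, smul_val]

/-- The presheaf of abelian groups of sections. -/
def abPresheaf : TopCat.Presheaf Ab.{u} P where
  obj W := .of (c.sections W.unop)
  map {W W'} h := AddCommGrpCat.ofHom (c.restr h.unop.le)
  map_id W := by
    ext σ i
    exact res_self _ _
  map_comp {W W' W''} h h' := by
    ext σ i
    exact (res_res _ _ _).symm

lemma isSheaf_abPresheaf : c.abPresheaf.IsSheaf := by
  rw [TopCat.Presheaf.isSheaf_iff_isSheafUniqueGluing]
  intro ι U sf hsf
  let s : ∀ a, c.sections (U a) := sf
  have hs : ∀ a b, c.restr (inf_le_left : U a ⊓ U b ≤ _) (s a) =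
    c.restr (inf_le_right : U a ⊓ U b ≤ _) (s b) := hsf
  have hs' : ∀ a b i {V : P.Opens} (ha : V ≤ U a) (hb : V ≤ U b) (hi : V ≤ c.D i),
      res P (le_inf ha hi) ((s a).1 i) = res P (le_inf hb hi) ((s b).1 i) := by
    intro a b i V ha hb hi
    have := congrArg (fun τ => res P (le_inf (le_inf ha hb) hi) (τ.1 i)) (hs a b)
    simpa [restr_val] using this
  have hcov : ∀ V : P.Opens, iSup U ⊓ V ≤ ⨆ a, (U a ⊓ V) := fun V => by rw [iSup_inf_eq]
  have hle : ∀ a, U a ≤ iSup U := le_iSup U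
  choose y hy using fun i => res_glue (W := iSup U ⊓ c.D i) (fun a => U a ⊓ c.D i)
    (fun a => inf_le_inf (hle a) le_rfl) (hcov _) (fun a => (s a).1 i) (fun a b => by
      have := hs' a b i (V := (U a ⊓ c.D i) ⊓ (U b ⊓ c.D i)) (inf_le_left.trans inf_le_left)
        (inf_le_right.trans inf_le_left) (inf_le_left.trans inf_le_right)
      exact this)
  have hy' : ∀ a i {V : P.Opens} (ha : V ≤ U a) (hi : V ≤ c.D i),
      res P (le_inf (ha.trans (hle a)) hi) (y i) = res P (le_inf ha hi) ((s a).1 i) := by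
    intro a i V ha hi
    rw [← hy i a, res_res]
  let Y : c.sections (iSup U) := ⟨y, fun k => by
    refine res_ext (fun a => U a ⊓ (c.D (c.src k) ⊓ c.D (c.tgt k)))
      (fun a => inf_le_inf (hle a) le_rfl) (hcov _) _ _ fun a => ?_
    have h1 := hy' a (c.src k) (V := U a ⊓ (c.D (c.src k) ⊓ c.D (c.tgt k))) inf_le_left
      (inf_le_right.trans inf_le_left)
    have h2 := hy' a (c.tgt k) (V := U a ⊓ (c.D (c.src k) ⊓ c.D (c.tgt k))) inf_le_left
      (inf_le_right.trans inf_le_right)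
    have h3 := c.sections_compat (s a) k (V := U a ⊓ (c.D (c.src k) ⊓ c.D (c.tgt k))) inf_le_left
      (inf_le_right.trans inf_le_left) (inf_le_right.trans inf_le_right)
    rw [map_mul, res_res, res_res, res_res, h1, h2, h3]⟩
  refine ⟨Y, fun a => Subtype.ext (funext fun i => hy i a), fun Z hZ => ?_⟩
  let Z' : c.sections (iSup U) := Z
  have hZ' : ∀ a, c.restr (hle a) Z' = s a := hZ
  change Z' = Y
  refine Subtype.ext (funext fun i => ?_)
  refine res_ext (fun a => U a ⊓ c.D i) (fun a => inf_le_inf (hle a) le_rfl) (hcov _) _ _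
    fun a => ?_
  rw [hy i a, ← hZ' a, restr_val]

/-- The sheaf of modules with given transition data. -/
def sheaf : P.Modules where
  val :=
    letI (W : P.Opensᵒᵖ) : Module (P.ringCatSheaf.obj.obj W) (c.abPresheaf.obj W) :=
      inferInstanceAs (Module Γ(P, W.unop) (c.sections W.unop))
    PresheafOfModules.ofPresheaf c.abPresheaf fun {W W'} h r σ =>
      c.restr_smul h.unop.le r σ
  isSheaf := c.isSheaf_abPresheaf

end TransitionData

end Twisting

section ProjFractions

variable {A B : Type u} [CommRing A] [CommRing B] {σ τ : Type u}
  [SetLike σ A] [AddSubgroupClass σ A] [SetLike τ B] [AddSubgroupClass τ B]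
  (𝒜 : ℕ → σ) (ℬ : ℕ → τ) [GradedRing 𝒜] [GradedRing ℬ]

/-- The function `e / t` on `D₊(t)`, for `e` and `t` of degree one. -/
def projFrac (t e : A) (ht : t ∈ 𝒜 1) (he : e ∈ 𝒜 1) : Γ(Proj 𝒜, Proj.basicOpen 𝒜 t) :=
  Proj.awayToSection 𝒜 t (Away.mk 𝒜 ht 1 e (by simpa using he))

lemma projFrac_mul (t t' e : A) (ht : t ∈ 𝒜 1) (ht' : t' ∈ 𝒜 1) (he : e ∈ 𝒜 1)
    {W : (Proj 𝒜).Opens} (h : W ≤ Proj.basicOpen 𝒜 t) (h' : W ≤ Proj.basicOpen 𝒜 t') :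
    res (Proj 𝒜) h' (projFrac 𝒜 t' e ht' he) =
      res (Proj 𝒜) h' (projFrac 𝒜 t' t ht' ht) * res (Proj 𝒜) h (projFrac 𝒜 t e ht he) := by
  refine Subtype.ext <| funext fun p ↦ ?_
  refine HomogeneousLocalization.val_injective _ ?_
  refine Eq.trans ?_ (HomogeneousLocalization.val_mul _ _).symm
  change Localization.mk _ _ = Localization.mk _ _ * Localization.mk _ _
  rw [Localization.mk_mul, Localization.mk_eq_mk_iff, Localization.r_iff_exists]
  refine ⟨1, ?_⟩
  dsimp
  ring

lemma projFrac_congr {t t' e e' : A} (h : t = t') (h' : e = e') (ht : t ∈ 𝒜 1) (he : e ∈ 𝒜 1)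
    (ht' : t' ∈ 𝒜 1) (he' : e' ∈ 𝒜 1) {W : (Proj 𝒜).Opens} (hW : W ≤ Proj.basicOpen 𝒜 t)
    (hW' : W ≤ Proj.basicOpen 𝒜 t') :
    res (Proj 𝒜) hW (projFrac 𝒜 t e ht he) = res (Proj 𝒜) hW' (projFrac 𝒜 t' e' ht' he') := by
  subst h h'
  rfl

variable {𝒜 ℬ} in
lemma projFrac_map (φ : 𝒜 →+*ᵍ ℬ) (hφ : ℬ₊ ≤ 𝒜₊.map φ) (t e : A) (ht : t ∈ 𝒜 1) (he : e ∈ 𝒜 1) :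
    (Proj.map φ hφ).appLE (Proj.basicOpen 𝒜 t) (Proj.basicOpen ℬ (φ t)) le_rfl
      (projFrac 𝒜 t e ht he) = projFrac ℬ (φ t) (φ e) (φ.map_mem ht) (φ.map_mem he) := by
  refine (congr($(Proj.awayToSection_comp_appLE φ hφ ht)
    (Away.mk 𝒜 ht 1 e (by simpa using he)))).trans ?_
  exact congrArg (Proj.awayToSection ℬ (φ t)) (Away.map_mk φ t ht 1 e (by simpa using he))

end ProjFractions

section Twist

variable {X : Scheme.{u}} (E : X.Modules) [E.IsQuasicoherent]

/-- The locus in `Proj (Sym E)` over the affine open `U` where the section `t` generates `𝒪(1)`. -/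
def twistOpen (U : X.AffineZariskiSite) (t : Γ(E, U.toOpens)) : (projBundle E).Opens :=
  projChart E U ''ᵁ Proj.basicOpen (symSec E U.toOpens) (SymmetricAlgebra.ι _ _ t)

/-- The function `e / t` on the locus where `t` generates `𝒪(1)`. -/
def twistFrac (U : X.AffineZariskiSite) (t e : Γ(E, U.toOpens)) : Γ(projBundle E, twistOpen E U t) :=
  ((projChart E U).appIso (Proj.basicOpen (symSec E U.toOpens) (SymmetricAlgebra.ι _ _ t))).inv
    (projFrac (symSec E U.toOpens) _ _ (ι_mem_symPow _ _ t) (ι_mem_symPow _ _ e))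

lemma twistOpen_le (U : X.AffineZariskiSite) (t : Γ(E, U.toOpens)) :
    twistOpen E U t ≤ (projChart E U).opensRange := by
  rw [← Scheme.Hom.image_top_eq_opensRange]
  exact Scheme.Hom.image_mono _ le_top

lemma preimage_twistOpen {U V : X.AffineZariskiSite} (h : V ≤ U) (t : Γ(E, U.toOpens)) :
    projChart E V ⁻¹ᵁ twistOpen E U t = Proj.basicOpen (symSec E V.toOpens)
      (SymmetricAlgebra.ι _ _ (resMod E (Scheme.AffineZariskiSite.toOpens_mono h) t)) := by
  rw [← projRes_projChart E h, Scheme.Hom.comp_preimage, twistOpen,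
    Scheme.Hom.preimage_image_eq]
  refine (Proj.map_preimage_basicOpen _ _ _).trans ?_
  exact congrArg _ (symRes_ι E _ t)

lemma projChart_appLE_twistFrac {U V : X.AffineZariskiSite} (h : V ≤ U) (t e : Γ(E, U.toOpens))
    {W : (Proj (symSec E V.toOpens)).Opens} (H : W ≤ projChart E V ⁻¹ᵁ twistOpen E U t)
    (H' : W ≤ Proj.basicOpen (symSec E V.toOpens)
      (SymmetricAlgebra.ι _ _ (resMod E (Scheme.AffineZariskiSite.toOpens_mono h) t))) :
    (projChart E V).appLE (twistOpen E U t) W H (twistFrac E U t e) =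
      res _ H' (projFrac (symSec E V.toOpens) _ _
        (ι_mem_symPow _ _ (resMod E (Scheme.AffineZariskiSite.toOpens_mono h) t))
        (ι_mem_symPow _ _ (resMod E (Scheme.AffineZariskiSite.toOpens_mono h) e))) := by
  have H'' : W ≤ Proj.basicOpen (symSec E V.toOpens)
      (symRes E (Scheme.AffineZariskiSite.toOpens_mono h) (SymmetricAlgebra.ι _ _ t)) :=
    H'.trans_eq (congrArg _ (symRes_ι E _ t).symm)
  have key : ∀ (j : Proj (symSec E V.toOpens) ⟶ projBundle E)
      (hj : j = projRes E h ≫ projChart E U) (H : W ≤ j ⁻¹ᵁ twistOpen E U t),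
      j.appLE (twistOpen E U t) W H (twistFrac E U t e) =
        res _ H'' (projFrac (symSec E V.toOpens) _ _
          ((symRes E (Scheme.AffineZariskiSite.toOpens_mono h)).map_mem (ι_mem_symPow _ _ t))
          ((symRes E (Scheme.AffineZariskiSite.toOpens_mono h)).map_mem (ι_mem_symPow _ _ e))) := by
    rintro _ rfl H
    have e₁ := Scheme.Hom.appLE_comp_appLE (projRes E h) (projChart E U) (twistOpen E U t)
      (Proj.basicOpen (symSec E U.toOpens) (SymmetricAlgebra.ι _ _ t)) W
      (Scheme.Hom.preimage_image_eq _ _).ge H''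
    have e₂ := (projChart E U).appIso_inv_appLE
      (U := Proj.basicOpen (symSec E U.toOpens) (SymmetricAlgebra.ι _ _ t))
      (Scheme.Hom.preimage_image_eq _ _).ge
    have e₃ := projFrac_map (symRes E (Scheme.AffineZariskiSite.toOpens_mono h))
      (irrelevant_symRes E h) _ _ (ι_mem_symPow _ _ t) (ι_mem_symPow _ _ e)
    have e₄ := Scheme.Hom.appLE_map (projRes E h)
      (U := Proj.basicOpen (symSec E U.toOpens) (SymmetricAlgebra.ι _ _ t))
      (V := Proj.basicOpen (symSec E V.toOpens)
      (symRes E (Scheme.AffineZariskiSite.toOpens_mono h) (SymmetricAlgebra.ι _ _ t)))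
      le_rfl (homOfLE H'').op
    refine (congr($(e₁.symm) (twistFrac E U t e))).trans ?_
    have e₅ := congr($e₂ (projFrac (symSec E U.toOpens) _ _ (ι_mem_symPow _ _ t)
      (ι_mem_symPow _ _ e)))
    refine (congrArg ((projRes E h).appLE (Proj.basicOpen (symSec E U.toOpens)
      (SymmetricAlgebra.ι _ _ t)) W H'') (e₅.trans (res_self le_rfl _))).trans ?_
    refine (congr($(e₄.symm) _)).trans ?_
    exact congrArg (res _ H'') e₃
  refine (key _ (projRes_projChart E h).symm H).trans ?_
  exact projFrac_congr _ (symRes_ι E _ t) (symRes_ι E _ e) _ _ _ _ _ _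

lemma appLE_injective {Y P : Scheme.{u}} (j : Y ⟶ P) [IsOpenImmersion j] {W : P.Opens}
    (hW : W ≤ j.opensRange) : Function.Injective (j.appLE W (j ⁻¹ᵁ W) le_rfl) := by
  have : IsIso (j.app W) := j.isIso_app W hW
  rw [← Scheme.Hom.app_eq_appLE]
  exact (ConcreteCategory.bijective_of_isIso (j.app W)).1

lemma appLE_res {Y P : Scheme.{u}} (j : Y ⟶ P) {U V : P.Opens} {W : Y.Opens} (h : V ≤ U)
    (hW : W ≤ j ⁻¹ᵁ V) (x : Γ(P, U)) :
    j.appLE V W hW (res P h x) = j.appLE U W (hW.trans (j.preimage_mono h)) x :=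
  congr($(Scheme.Hom.map_appLE j hW (homOfLE h).op) x)

/-- A relation between a section over an affine open `U` and a section over a basic open
`V` of `U`. -/
structure TwistRel where
  /-- the smaller affine open -/
  V : X.AffineZariskiSite
  /-- the bigger affine open -/
  U : X.AffineZariskiSite
  le : V ≤ U
  /-- a section over the smaller open -/
  t' : Γ(E, V.toOpens)
  /-- a section over the bigger open -/
  t : Γ(E, U.toOpens)

/-- The transition data of `𝒪(1)`: over the locus where `t` generates, a section of `𝒪(1)`
is `σ * t` for a unique function `σ`, and `σ * t = σ' * t'` means `σ' = (t / t') * σ`. -/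
def twistData : TransitionData (projBundle E) where
  ι := Σ U : X.AffineZariskiSite, Γ(E, U.toOpens)
  D i := twistOpen E i.1 i.2
  κ := TwistRel E
  src k := ⟨k.V, k.t'⟩
  tgt k := ⟨k.U, k.t⟩
  g k := res _ inf_le_left
    (twistFrac E k.V k.t' (resMod E (Scheme.AffineZariskiSite.toOpens_mono k.le) k.t))

/-- The tautological invertible quotient `𝒪(1)` of the pullback of `E` to `Proj (Sym E)`. -/
def twist : (projBundle E).Modules := (twistData E).sheaf

lemma twistFrac_compat (s : Γ(E, ⊤)) (k : TwistRel E) :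
    res (projBundle E) (inf_le_left : twistOpen E k.V k.t' ⊓ twistOpen E k.U k.t ≤ _)
      (twistFrac E k.V k.t' (resMod E le_top s)) =
    res (projBundle E) inf_le_left
      (twistFrac E k.V k.t' (resMod E (Scheme.AffineZariskiSite.toOpens_mono k.le) k.t)) *
    res (projBundle E) inf_le_right (twistFrac E k.U k.t (resMod E le_top s)) := by
  apply appLE_injective (projChart E k.V) (inf_le_left.trans (twistOpen_le E _ _))
  have hV := preimage_twistOpen E (le_refl k.V) k.t'
  have hU := preimage_twistOpen E k.le k.t
  have h₁ : projChart E k.V ⁻¹ᵁ (twistOpen E k.V k.t' ⊓ twistOpen E k.U k.t) ≤ _ :=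
    ((projChart E k.V).preimage_mono inf_le_left).trans hV.le
  have h₂ : projChart E k.V ⁻¹ᵁ (twistOpen E k.V k.t' ⊓ twistOpen E k.U k.t) ≤ _ :=
    ((projChart E k.V).preimage_mono inf_le_right).trans hU.le
  have hs := resMod_resMod E (le_top : k.U.toOpens ≤ ⊤)
    (Scheme.AffineZariskiSite.toOpens_mono k.le) s
  have a₁ := projChart_appLE_twistFrac E (le_refl k.V) k.t' (resMod E le_top s)
    ((projChart E k.V).preimage_mono inf_le_left) h₁
  have a₂ := projChart_appLE_twistFrac E (le_refl k.V) k.t'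
    (resMod E (Scheme.AffineZariskiSite.toOpens_mono k.le) k.t)
    ((projChart E k.V).preimage_mono inf_le_left) h₁
  have a₃ := projChart_appLE_twistFrac E k.le k.t (resMod E le_top s)
    ((projChart E k.V).preimage_mono inf_le_right) h₂
  refine (appLE_res _ _ _ _).trans (a₁.trans ?_)
  refine Eq.trans ?_ (map_mul _ _ _).symm
  refine Eq.trans ?_ (congrArg₂ (· * ·) ((appLE_res _ _ _ _).trans a₂)
    ((appLE_res _ _ _ _).trans a₃)).symm
  refine Eq.trans ?_ ((projFrac_mul (symSec E k.V.toOpens) _ _ _ (ι_mem_symPow _ _ _)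
    (ι_mem_symPow _ _ _) (ι_mem_symPow _ _ (resMod E
      (Scheme.AffineZariskiSite.toOpens_mono k.le) (resMod E le_top s))) h₂ h₁).trans ?_)
  rotate_left
  · refine congrArg₂ (· * ·) ?_ rfl
    refine projFrac_congr _ rfl (congrArg _ ?_) _ _ _ _ _ _
    exact (resMod_self E _ _).symm
  · refine projFrac_congr _ rfl (congrArg _ ?_) _ _ _ _ _ _
    rw [hs, resMod_resMod]

/-- The section of `𝒪(1)` corresponding to a section of `E`. -/
def twistSection (s : Γ(E, ⊤)) : Γ(twist E, ⊤) :=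
  show (twistData E).sections ⊤ from
  ⟨fun i => res _ inf_le_right (twistFrac E i.1 i.2 (resMod E le_top s)), fun k => by
    have := congrArg (res (projBundle E) (inf_le_right : ⊤ ⊓ (_ ⊓ _) ≤ _)) (twistFrac_compat E s k)
    rw [map_mul, res_res, res_res, res_res] at this
    refine (res_res _ _ _).trans (this.trans ?_)
    exact congrArg₂ (· * ·) (res_res _ _ _).symm (res_res _ _ _).symm⟩

end Twist

section PullbackQuasiCoherent

lemma final_opensMap {X Y : TopCat.{u}} (f : X ⟶ Y) : (Opens.map f).Final := by
  refine ⟨fun U => ?_⟩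
  let T : StructuredArrow U (Opens.map f) := StructuredArrow.mk (Y := ⊤) (homOfLE le_top)
  have hT : IsTerminal T := IsTerminal.ofUniqueHom
    (fun A => StructuredArrow.homMk (homOfLE le_top) (Subsingleton.elim _ _))
    (fun A m => by ext; apply Subsingleton.elim)
  exact isConnected_of_isTerminal _ hT

variable {X Y : Scheme.{u}}

/-- Presentations are transported by isomorphisms. -/
def presentationOfIso {M N : SheafOfModules.{u} X.ringCatSheaf} (e : M ≅ N)
    (p : M.Presentation) : N.Presentation :=
  SheafOfModules.Presentation.ofIsIso e.hom p

/-- The pullback functor, as a functor on sheaves of modules. -/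
abbrev pullbackFunctor (f : Y ⟶ X) :
    SheafOfModules.{u} X.ringCatSheaf ⥤ SheafOfModules.{u} Y.ringCatSheaf :=
  Scheme.Modules.pullback f

lemma isRightAdjoint_pushforward (f : Y ⟶ X) :
    (SheafOfModules.pushforward.{u} f.toRingCatSheafHom).IsRightAdjoint :=
  (Scheme.Modules.pullbackPushforwardAdjunction f).isRightAdjoint

lemma isLeftAdjoint_pullback (f : Y ⟶ X) : (pullbackFunctor f).IsLeftAdjoint :=
  (Scheme.Modules.pullbackPushforwardAdjunction f).isLeftAdjoint

/-- The pullback of the structure sheaf is the structure sheaf. -/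
def pullbackUnitIso (f : Y ⟶ X) : (pullbackFunctor f).obj
    (SheafOfModules.unit.{u} X.ringCatSheaf) ≅ SheafOfModules.unit.{u} Y.ringCatSheaf :=
  have : (Opens.map f.base).Final := final_opensMap f.base
  have := isRightAdjoint_pushforward f
  have : IsIso (SheafOfModules.pullbackObjUnitToUnit.{u} f.toRingCatSheafHom) :=
    SheafOfModules.instIsIsoPullbackObjUnitToUnitOfFinal (F := Opens.map f.base) _
  @asIso _ _ _ _ _ this

/-- The pullback of a presentation. -/
def pullbackPresentation (f : Y ⟶ X) {M : SheafOfModules.{u} X.ringCatSheaf}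
    (p : M.Presentation) :
    SheafOfModules.Presentation ((pullbackFunctor f).obj M) :=
  have := isLeftAdjoint_pullback f
  have : PreservesColimitsOfSize.{u, u} (pullbackFunctor f) := inferInstance
  p.map (pullbackFunctor f) (pullbackUnitIso f).symm

/-- Pullback commutes with restriction to open subschemes. -/
def restrictPullbackIso (f : Y ⟶ X) (M : X.Modules) (U : X.Opens) :
    (Scheme.Modules.pullback (f ∣_ U)).obj (M.restrict U.ι) ≅
    ((Scheme.Modules.pullback f).obj M).restrict (f ⁻¹ᵁ U).ι :=
  (Scheme.Modules.pullback (f ∣_ U)).mapIso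
      ((Scheme.Modules.restrictFunctorIsoPullback U.ι).app M) ≪≫
    (Scheme.Modules.pullbackComp (f ∣_ U) U.ι).app M ≪≫
    (Scheme.Modules.pullbackCongr (morphismRestrict_ι f U)).app M ≪≫
    ((Scheme.Modules.pullbackComp (f ⁻¹ᵁ U).ι f).app M).symm ≪≫
    ((Scheme.Modules.restrictFunctorIsoPullback (f ⁻¹ᵁ U).ι).app _).symm

/-- A presentation of the restriction to an open subscheme, as a presentation on the
localized site. -/
def overPresentation (M : X.Modules) (U : X.Opens)
    (p : SheafOfModules.Presentation.{u} (M.restrict U.ι)) :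
    SheafOfModules.Presentation.{u} (SheafOfModules.over.{u} M U) :=
  let F : SheafOfModules.{u} U.toScheme.ringCatSheaf ⥤ SheafOfModules.{u} (X.ringCatSheaf.over U) :=
    (Scheme.Modules.overEquiv U).inverse
  have : F.IsLeftAdjoint := (Scheme.Modules.overEquiv U).symm.toAdjunction.isLeftAdjoint
  have : PreservesColimitsOfSize.{u, u} F := inferInstance
  let p' := p.map F
    (Opens.sheafOfModulesEquivOverInverseUnit U X.ringCatSheaf).symm
  let i : F.obj (M.restrict U.ι) ≅ SheafOfModules.over.{u} M U :=
    (Scheme.Modules.overEquiv U).inverse.mapIso ((Scheme.Modules.overFunctorEquiv U).app M).symm ≪≫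
      ((Scheme.Modules.overEquiv U).unitIso.app _).symm
  SheafOfModules.Presentation.ofIsIso i.hom p'

instance isQuasicoherent_pullback (f : Y ⟶ X) (M : X.Modules) [M.IsQuasicoherent] :
    ((Scheme.Modules.pullback f).obj M).IsQuasicoherent := by
  obtain ⟨ι, U, p, hU, -⟩ := M.exists_isOpenCover_presentation
  let e (i : ι) : (pullbackFunctor (f ∣_ U i)).obj (M.restrict (U i).ι) ≅
    (((Scheme.Modules.pullback f).obj M).restrict (f ⁻¹ᵁ U i).ι :
      SheafOfModules.{u} (f ⁻¹ᵁ U i).toScheme.ringCatSheaf) := restrictPullbackIso f M (U i)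
  let N : SheafOfModules.{u} Y.ringCatSheaf := (Scheme.Modules.pullback f).obj M
  have q : N.QuasicoherentData :=
    { I := ι
      X := fun i => f ⁻¹ᵁ U i
      coversTop := by
        rw [Opens.coversTop_iff]
        exact hU.comap f.base.hom
      presentation := fun i => overPresentation N (f ⁻¹ᵁ U i)
        (presentationOfIso (e i)
          (pullbackPresentation _ (p i))) }
  exact q.isQuasicoherent

end PullbackQuasiCoherent

section Setting

/-- `E` is a vector bundle of rank two: there is an open cover of `X` on the members of which `E`
is free on two generators. -/
class IsRankTwoBundle {X : Scheme.{u}} (E : X.Modules) : Prop where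
  exists_data : ∃ q : SheafOfModules.LocalGeneratorsData.{u} E, q.IsLocallyFreeData ∧
    ∀ i, Nonempty ((q.generators i).I ≃ Fin 2)

instance isQuasicoherent_of_isRankTwoBundle {X : Scheme.{u}} (E : X.Modules)
    [h : IsRankTwoBundle E] : E.IsQuasicoherent := by
  obtain ⟨q, hq, -⟩ := h.exists_data
  exact q.quasiCoherentData.isQuasicoherent

/-- Projective `n`-space over `k`. -/
def projectiveSpace (k : Type u) [Field k] (n : ℕ) : Scheme.{u} :=
  letI := MvPolynomial.gradedAlgebra (σ := Fin (n + 1)) (R := k)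
  Proj (MvPolynomial.homogeneousSubmodule (Fin (n + 1)) k)

/-- The structure morphism of projective `n`-space. -/
def projectiveSpaceToSpec (k : Type u) [Field k] (n : ℕ) :
    projectiveSpace k n ⟶ Spec (CommRingCat.of k) :=
  letI := MvPolynomial.gradedAlgebra (σ := Fin (n + 1)) (R := k)
  Proj.toSpecZero (MvPolynomial.homogeneousSubmodule (Fin (n + 1)) k) ≫
    Spec.map (CommRingCat.ofHom
      (algebraMap k (MvPolynomial.homogeneousSubmodule (Fin (n + 1)) k 0)))

/-- A scheme over a field `k` is projective if it is a closed subscheme of some projective space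
over `k`. -/
def IsProjectiveOver (k : Type u) [Field k] {X : Scheme.{u}} (f : X ⟶ Spec (CommRingCat.of k)) :
    Prop :=
  ∃ (n : ℕ) (i : X ⟶ projectiveSpace k n),
    IsClosedImmersion i ∧ i ≫ projectiveSpaceToSpec k n = f

end Setting

section ZeroScheme

variable {X : Scheme.{u}}

/-- The ideal sheaf of the zero scheme of a global section `s` of `M`: the smallest quasi-coherent
ideal sheaf `I` with `s ∈ I M`. -/
def zeroIdeal (M : X.Modules) (s : Γ(M, ⊤)) : X.IdealSheafData :=
  sInf {I | ∀ U : X.affineOpens,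
    resMod M (le_top : U.1 ≤ ⊤) s ∈ I.ideal U • (⊤ : Submodule Γ(X, U.1) Γ(M, U.1))}

/-- The ideal sheaf of the divisorial part of the closed subscheme defined by `I`: the functions
whose germs at all points of codimension one lie in `I`. On a locally noetherian integral scheme
with `I ≠ 0` this is locally the intersection of the primary components of `I` that belong to
primes of height one. -/
def divisorialPart (I : X.IdealSheafData) : X.IdealSheafData :=
  .ofIdeals fun U ↦ ⨅ (x : X) (hx : x ∈ U.1) (_ : ringKrullDim (X.presheaf.stalk x) = 1),
    ((I.ideal U).map (X.presheaf.germ U.1 x hx).hom).comap (X.presheaf.germ U.1 x hx).hom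

/-- The ideal sheaf of the residual part of the closed subscheme defined by `I` with respect to
its divisorial part `F`: the quotient ideal `(I : F)`. -/
def residualPart (I : X.IdealSheafData) : X.IdealSheafData :=
  sSup {K | K * divisorialPart I ≤ I}

/-- The closed subscheme defined by `I` is an effective Cartier divisor. -/
def IsEffectiveCartier (I : X.IdealSheafData) : Prop :=
  ∀ x : X, ∃ U : X.affineOpens, x ∈ U.1 ∧
    ∃ a ∈ nonZeroDivisors Γ(X, U.1), I.ideal U = Ideal.span {a}

/-- `b : B ⟶ X` is the blow-up of `X` along the closed subscheme defined by `J`: it is terminal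
among the morphisms to `X` for which the inverse image of that subscheme is an effective Cartier
divisor. -/
def IsBlowup (J : X.IdealSheafData) {B : Scheme.{u}} (b : B ⟶ X) : Prop :=
  IsEffectiveCartier (J.comap b) ∧
    ∀ (T : Scheme.{u}) (f : T ⟶ X), IsEffectiveCartier (J.comap f) → ∃! g : T ⟶ B, g ≫ b = f

end ZeroScheme

end ProjBundle

end

open ProjBundle

/-! The local rings of a smooth surface over a field are regular of dimension at most two, hence
factorial (`uniqueFactorizationMonoid_stalk`). In a local frame of `E` the two coordinates of `s`
can therefore be written `d a` and `d b`, where `d ≠ 0` and `a`, `b` are coprime. Coprimality enters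
only through exactness of the Koszul complex of `(a, b)` in degree one, which spreads out from a
stalk to a neighbourhood. This local datum is a `GcdChart`, and `exists_gcdChart` covers `X` by such
charts.

On such a chart with ring `A` the ideal of `Z(s)` is `d (a, b)`. At a point of codimension one, `a`
or `b` is a unit, and divisibility by `d` can be tested at these points. So the divisorial part has
ideal `(d)`, and the residual ideal `(d (a, b) : d)` is `(a, b)`.

The projective bundle over the chart is covered by two affine lines `Spec A[X]`, exchanged by
exchanging the members of the frame. On one of them the section of `𝒪(1)` is `d (a + b X)`. Koszul
exactness makes `a + b X` a nonzerodivisor modulo `d`, so that `(d) ∩ (a + b X) = (d (a + b X))`.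
Hence the zero scheme is the union of `W₁`, the inverse image of the divisorial part, and `W₀`,
given locally by `a + b X` (`exists_component`).

`W₀` is shown to be the blow-up through the universal property. Modulo `a + b X` one has `a = -b X`,
so `(a, b)` becomes `(b)`, and `b` is a nonzerodivisor there, again by Koszul exactness. Conversely,
if `(a, b)` becomes `(t)` on `T` with `t` a nonzerodivisor, then `a = t α`, `b = t β` with `α`, `β`
generating the unit ideal. Where `β` is invertible the only lift to `W₀` sends `X` to `-α / β`;
where `α` is invertible the other line is used. Uniqueness glues these lifts (`isBlowup_subscheme`).

`W₁` is compared with the bundle of the restriction of `E` on charts, where both are the spectrum of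
`(A / d)[X]` (`exists_iso_projBundle_pullback`). -/

noncomputable section

namespace ProjBundle

/-! ### Regular local domains of dimension at most two are factorial -/

section RegularTwo

open IsLocalRing

/-- If a prime `P` misses `v`, then every `z v ∈ P` has `z ∈ P`; so `P` equals the maximal ideal
times `P`, and Nakayama's lemma gives `P = 0`. -/
lemma isPrincipalIdealRing_of_maximalIdeal_eq_span {R : Type*} [CommRing R] [IsLocalRing R]
    [IsNoetherianRing R] (v : R) (h : maximalIdeal R = Ideal.span {v}) :
    IsPrincipalIdealRing R := by
  refine IsPrincipalIdealRing.of_prime fun P hP => ?_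
  by_cases hv : v ∈ P
  · have : P = maximalIdeal R := le_antisymm (le_maximalIdeal hP.ne_top)
      (by rw [h, Ideal.span_singleton_le_iff_mem]; exact hv)
    rw [this, h]
    exact ⟨⟨v, rfl⟩⟩
  · have hle : P ≤ maximalIdeal R • P := by
      intro x hx
      have hx' := le_maximalIdeal hP.ne_top hx
      rw [h, Ideal.mem_span_singleton'] at hx'
      obtain ⟨z, rfl⟩ := hx'
      have hz : z ∈ P := (hP.mem_or_mem hx).resolve_right hv
      rw [mul_comm]
      exact Submodule.smul_mem_smul (by rw [h]; exact Ideal.mem_span_singleton_self v) hz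
    have : P ≤ ⊥ := (Submodule.eq_bot_of_le_smul_of_le_jacobson_bot (maximalIdeal R) P
      (IsNoetherian.noetherian P) hle (maximalIdeal_le_jacobson _)).le
    rw [le_bot_iff.mp this]
    infer_instance

/-- Modulo `u` all ideals are principal, so the image of `P` is generated by the class of some `g ∈
P`. If `x - r g = z u` lies in `P`, then `z ∈ P` because `u ∉ P`. Thus `P = (g) + 𝔪 P`, and
Nakayama's lemma gives `P = (g)`. -/
lemma isPrincipal_of_notMem_of_maximalIdeal_eq {R : Type*} [CommRing R] [IsLocalRing R]
    [IsNoetherianRing R] (u v : R) (h : maximalIdeal R = Ideal.span {u, v})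
    (P : Ideal R) [hP : P.IsPrime] (hu : u ∉ P) : P.IsPrincipal := by
  have hum : u ∈ maximalIdeal R := h ▸ Ideal.subset_span (by simp)
  have : Nontrivial (R ⧸ Ideal.span {u}) := Ideal.Quotient.nontrivial_iff.mpr
    (ne_top_of_le_ne_top (maximalIdeal.isMaximal R).ne_top
      ((Ideal.span_singleton_le_iff_mem _).mpr hum))
  have : IsLocalRing (R ⧸ Ideal.span {u}) := .of_surjective' _ Ideal.Quotient.mk_surjective
  have hmax : maximalIdeal (R ⧸ Ideal.span {u}) =
      Ideal.span {Ideal.Quotient.mk (Ideal.span {u}) v} := by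
    rw [← IsLocalRing.map_maximalIdeal_of_surjective (Ideal.Quotient.mk (Ideal.span {u}))
      Ideal.Quotient.mk_surjective, h, Ideal.map_span, Set.image_pair,
      Ideal.Quotient.eq_zero_iff_mem.mpr (Ideal.mem_span_singleton_self u), Ideal.span_insert]
    simp
  have := isPrincipalIdealRing_of_maximalIdeal_eq_span _ hmax
  obtain ⟨g', hg'⟩ := (IsPrincipalIdealRing.principal
    (P.map (Ideal.Quotient.mk (Ideal.span {u})))).principal
  have hg'm : g' ∈ P.map (Ideal.Quotient.mk (Ideal.span {u})) := by
    rw [hg']; exact Submodule.mem_span_singleton_self g'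
  obtain ⟨g, hg, rfl⟩ := (Ideal.mem_map_iff_of_surjective _ Ideal.Quotient.mk_surjective).mp hg'm
  have hle : P ≤ Ideal.span {g} ⊔ maximalIdeal R • P := by
    intro x hx
    have hx' := Ideal.mem_map_of_mem (Ideal.Quotient.mk (Ideal.span {u})) hx
    rw [hg'] at hx'
    obtain ⟨r', hr'⟩ := Ideal.mem_span_singleton'.mp hx'
    obtain ⟨r, rfl⟩ := Ideal.Quotient.mk_surjective r'
    rw [← map_mul, eq_comm, Ideal.Quotient.eq, Ideal.mem_span_singleton'] at hr'
    obtain ⟨z, hz⟩ := hr'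
    have hzu : z * u ∈ P := hz ▸ sub_mem hx (Ideal.mul_mem_left _ _ hg)
    have hzP : z ∈ P := (hP.mem_or_mem hzu).resolve_right hu
    have : x = r * g + u * z := by linear_combination -hz
    rw [this]
    exact Submodule.add_mem_sup (Ideal.mul_mem_left _ _ (Ideal.mem_span_singleton_self g))
      (Submodule.smul_mem_smul hum hzP)
  have := Submodule.sup_smul_eq_sup_smul_of_le_smul_of_le_jacobson (J := ⊥)
    (IsNoetherian.noetherian P) (maximalIdeal_le_jacobson _) hle
  rw [this, Submodule.bot_smul, sup_bot_eq] at hle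
  exact ⟨⟨g, le_antisymm hle ((Ideal.span_singleton_le_iff_mem _).mpr hg)⟩⟩

/-- A regular local domain of dimension at most two is factorial. -/
theorem uniqueFactorizationMonoid_of_regular {R : Type*} [CommRing R] [IsDomain R]
    [IsRegularLocalRing R] (hdim : ringKrullDim R ≤ 2) : UniqueFactorizationMonoid R := by
  have hreg := IsRegularLocalRing.spanFinrank_maximalIdeal (R := R)
  have hfg : (maximalIdeal R).FG := IsNoetherian.noetherian _
  have hcard := Submodule.FG.generators_ncard hfg
  have hfin := Submodule.FG.finite_generators hfg
  have hspan : Ideal.span (maximalIdeal R).generators = maximalIdeal R :=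
    (maximalIdeal R).span_generators
  have h2 : (maximalIdeal R).generators.ncard ≤ 2 := by
    rw [← hreg] at hdim
    rw [hcard]
    exact_mod_cast hdim
  obtain ⟨u, v, huv⟩ : ∃ u v, maximalIdeal R = Ideal.span {u, v} := by
    rw [← hspan]
    generalize (maximalIdeal R).generators = S at h2 hfin
    -- With fewer than two generators the pair is padded by `0` or by a repetition.
    interval_cases h : S.ncard
    · rw [Set.ncard_eq_zero hfin] at h
      exact ⟨0, 0, by simp [h]⟩
    · obtain ⟨a, rfl⟩ := Set.ncard_eq_one.mp h
      exact ⟨a, a, by simp⟩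
    · obtain ⟨a, b, -, rfl⟩ := Set.ncard_eq_two.mp h
      exact ⟨a, b, rfl⟩
  -- A prime other than the maximal ideal misses one of the two generators.
  have hprinc : ∀ P : Ideal R, P.IsPrime → P ≠ maximalIdeal R → P.IsPrincipal := by
    intro P hP hne
    by_cases hu : u ∈ P
    · by_cases hv : v ∈ P
      · exact absurd (le_antisymm (le_maximalIdeal hP.ne_top)
          (by rw [huv, Ideal.span_le]; rintro x (rfl | rfl) <;> assumption)) hne
      · exact isPrincipal_of_notMem_of_maximalIdeal_eq v u (by rw [huv, Set.pair_comm]) P hv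
    · exact isPrincipal_of_notMem_of_maximalIdeal_eq u v huv P hu
  have hgen : ∀ P : Ideal R, P.IsPrime → P ≠ ⊥ → P.IsPrincipal → ∃ x ∈ P, Prime x := by
    rintro P hP hne ⟨⟨x, rfl⟩⟩
    refine ⟨x, Ideal.mem_span_singleton_self x, (Ideal.span_singleton_prime ?_).mp hP⟩
    rintro rfl
    exact hne (by simp)
  -- Kaplansky's criterion: it suffices that each nonzero prime ideal contains a prime element. The
  -- maximal ideal inherits one from any smaller nonzero prime.
  refine UniqueFactorizationMonoid.iff_exists_prime_mem_of_isPrime.mpr fun P hP0 hP => ?_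
  by_cases hPm : P = maximalIdeal R
  · subst hPm
    by_cases hex : ∃ P : Ideal R, P.IsPrime ∧ P ≠ ⊥ ∧ P ≠ maximalIdeal R
    · obtain ⟨Q, hQ, hQ0, hQm⟩ := hex
      obtain ⟨x, hx, hx'⟩ := hgen Q hQ hQ0 (hprinc Q hQ hQm)
      exact ⟨x, le_maximalIdeal hQ.ne_top hx, hx'⟩
    -- If no nonzero prime lies strictly below the maximal ideal, the dimension is at most one, and
    -- regularity makes the maximal ideal itself principal.
    · push Not at hex
      have hd : Ring.DimensionLEOne R := ⟨fun {p} hp hpp => by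
        rw [hex p hpp hp]; exact maximalIdeal.isMaximal R⟩
      have hd1 : ringKrullDim R ≤ 1 := (Ring.krullDimLE_iff (n := 1)).mp
        (Ring.krullDimLE_one_iff_of_noZeroDivisors.mpr fun I hI hIp => hd.maximalOfPrime hI hIp)
      have h1 : (maximalIdeal R).generators.ncard ≤ 1 := by
        rw [← hreg] at hd1
        rw [hcard]
        exact_mod_cast hd1
      refine hgen _ hP hP0 ?_
      rw [← hspan]
      generalize (maximalIdeal R).generators = S at h1 hfin
      interval_cases h : S.ncard
      · rw [Set.ncard_eq_zero hfin] at h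
        rw [h]
        exact ⟨⟨0, by simp⟩⟩
      · obtain ⟨a, rfl⟩ := Set.ncard_eq_one.mp h
        exact ⟨⟨a, rfl⟩⟩
  · exact hgen P hP hP0 (hprinc P hP hPm)

end RegularTwo

/-! ### Factoriality of the local rings of a smooth surface -/

section SmoothSurface

open IsLocalRing

/-- The local rings of a noetherian ring étale over a regular ring are regular. -/
theorem isRegularLocalRing_of_etale {P A : Type u} [CommRing P] [CommRing A] [Algebra P A]
    [IsRegularRing P] [IsNoetherianRing A] [Algebra.Etale P A] (p : Ideal A) [p.IsPrime] :
    IsRegularLocalRing (Localization.AtPrime p) ∧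
      ringKrullDim (Localization.AtPrime p) ≤ ringKrullDim P := by
  let q := p.under P
  have hflat : Module.Flat P A := inferInstance
  -- Going down holds because étale algebras are flat.
  have hht : q.height ≤ p.height := by
    rw [Ideal.height_eq_height_add_of_liesOver_of_hasGoingDown q p]
    exact le_self_add
  let := Localization.AtPrime.algebraOfLiesOver q p
  -- Unramifiedness: the maximal ideal upstairs is generated by `q`.
  have hmax : q.map (algebraMap P (Localization.AtPrime p)) = maximalIdeal _ :=
    ((Algebra.isUnramifiedAt_iff_map_eq P q p).mp inferInstance).2
  have hqreg : IsRegularLocalRing (Localization.AtPrime q) :=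
    IsRegularRing.isRegularLocalRing_localization q
  have hq := hqreg.spanFinrank_maximalIdeal
  have hfg : (maximalIdeal (Localization.AtPrime q)).FG := IsNoetherian.noetherian _
  have hfin := Submodule.FG.finite_generators hfg
  let φ : Localization.AtPrime q →+* Localization.AtPrime p := Localization.localRingHom q p
    (algebraMap P A) rfl
  have hφ : φ.comp (algebraMap P _) = algebraMap P (Localization.AtPrime p) := by
    ext x
    rw [RingHom.comp_apply, Localization.localRingHom_to_map,
      ← IsScalarTower.algebraMap_apply]
  have hm : Ideal.span (φ '' (maximalIdeal (Localization.AtPrime q)).generators) =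
      maximalIdeal (Localization.AtPrime p) := by
    rw [← Ideal.map_span]
    have : Ideal.span (maximalIdeal (Localization.AtPrime q)).generators =
      maximalIdeal (Localization.AtPrime q) := Submodule.span_generators _
    rw [this, ← Localization.AtPrime.map_eq_maximalIdeal, Ideal.map_map, hφ, hmax]
  have h1 : (maximalIdeal (Localization.AtPrime p)).spanFinrank ≤
      (maximalIdeal (Localization.AtPrime q)).spanFinrank := by
    rw [← hm, ← Submodule.FG.generators_ncard hfg]
    exact (Submodule.spanFinrank_span_le_ncard_of_finite (hfin.image _)).trans
      (Set.ncard_image_le hfin)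
  have h2 : ringKrullDim (Localization.AtPrime q) ≤ ringKrullDim (Localization.AtPrime p) := by
    rw [IsLocalization.AtPrime.ringKrullDim_eq_height q, IsLocalization.AtPrime.ringKrullDim_eq_height p]
    exact_mod_cast hht
  -- The maximal ideal at `p` needs no more generators than the one at `q`, whose number is `dim
  -- P_q` by regularity. Since `dim P_q ≤ dim A_p`, this forces `A_p` to be regular.
  have h3 : ((maximalIdeal (Localization.AtPrime p)).spanFinrank : WithBot ℕ∞) ≤
      ringKrullDim (Localization.AtPrime q) := by
    rw [← hq]
    exact_mod_cast h1
  refine ⟨.of_spanFinrank_maximalIdeal_le _ (h3.trans h2), ?_⟩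
  refine (ringKrullDim_le_spanFinrank_maximalIdeal _).trans (h3.trans ?_)
  rw [IsLocalization.AtPrime.ringKrullDim_eq_height q]
  exact Ideal.height_le_ringKrullDim_of_ne_top Ideal.IsPrime.ne_top'

/-- A local presentation of a smooth morphism only provides some open set of the base; as `Spec k`
is a single point, a nonempty one is everything. -/
lemma isRegularRing_sections_of_field {k : Type u} [Field k] {U : (Spec (CommRingCat.of k)).Opens}
    (hU : (U : Set (Spec (CommRingCat.of k))).Nonempty) :
    IsRegularRing Γ(Spec (CommRingCat.of k), U) ∧
      ringKrullDim Γ(Spec (CommRingCat.of k), U) = 0 := by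
  have : U = ⊤ := by
    obtain ⟨x, hx⟩ := hU
    have : Subsingleton (PrimeSpectrum k) := inferInstance
    ext y
    exact ⟨fun _ => trivial, fun _ => (Subsingleton.elim (α := PrimeSpectrum k) x y) ▸ hx⟩
  subst this
  let e : k ≃+* Γ(Spec (CommRingCat.of k), ⊤) :=
    (Scheme.ΓSpecIso (CommRingCat.of k)).symm.commRingCatIsoToRingEquiv
  exact ⟨.of_ringEquiv e, by rw [← ringKrullDim_eq_of_ringEquiv e, ringKrullDim_eq_zero_of_field]⟩

variable {k : Type u} [Field k] {X : Scheme.{u}}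

lemma isLocallyNoetherian_of_smooth (f : X ⟶ Spec (CommRingCat.of k))
    [SmoothOfRelativeDimension 2 f] : IsLocallyNoetherian X := by
  have : Smooth f := SmoothOfRelativeDimension.smooth 2 f
  exact LocallyOfFiniteType.isLocallyNoetherian f

/-- The local rings of a smooth surface over a field are factorial. -/
theorem uniqueFactorizationMonoid_stalk (f : X ⟶ Spec (CommRingCat.of k)) [IsIntegral X]
    [SmoothOfRelativeDimension 2 f] (x : X) :
    UniqueFactorizationMonoid (X.presheaf.stalk x) := by
  have := isLocallyNoetherian_of_smooth f
  obtain ⟨U, hU, V, hV, hx, e, hs⟩ :=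
    SmoothOfRelativeDimension.exists_isStandardSmoothOfRelativeDimension (n := 2) (f := f) x
  -- A standard smooth algebra of relative dimension two is étale over a polynomial ring in two
  -- variables, which is regular of dimension `0 + 2`.
  obtain ⟨g, -, hg⟩ := hs.exists_etale_mvPolynomial
  obtain ⟨hreg, hdim⟩ := isRegularRing_sections_of_field (U := U) ⟨f x, e hx⟩
  have : IsNoetherianRing Γ(X, V) := IsLocallyNoetherian.component_noetherian ⟨V, hV⟩
  algebraize [g]
  let p := (hV.primeIdealOf ⟨x, hx⟩).asIdeal
  obtain ⟨h1, h2⟩ := isRegularLocalRing_of_etale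
    (P := MvPolynomial (Fin 2) Γ(Spec (CommRingCat.of k), U)) p
  rw [MvPolynomial.ringKrullDim_of_isNoetherianRing, hdim] at h2
  let := X.presheaf.algebra_section_stalk ⟨x, hx⟩
  have : IsLocalization.AtPrime (X.presheaf.stalk x) p := hV.isLocalization_stalk ⟨x, hx⟩
  let e' : Localization.AtPrime p ≃+* X.presheaf.stalk x :=
    (IsLocalization.algEquiv p.primeCompl (Localization.AtPrime p)
      (X.presheaf.stalk x)).toRingEquiv
  have : IsRegularLocalRing (X.presheaf.stalk x) := .of_ringEquiv e'
  refine uniqueFactorizationMonoid_of_regular ?_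
  rw [← ringKrullDim_eq_of_ringEquiv e']
  simpa using h2

end SmoothSurface

/-! ### Koszul exact pairs -/

section Koszul

open Polynomial

/-- The Koszul complex of the pair `(a, b)` is exact in degree one: the only relations between
`a` and `b` are the multiples of the trivial one. -/
def KoszulExact {A : Type*} [CommRing A] (a b : A) : Prop :=
  ∀ x y : A, a * x + b * y = 0 → ∃ w, x = b * w ∧ y = -(a * w)

namespace KoszulExact

variable {A : Type*} [CommRing A] {a b : A}

lemma symm (h : KoszulExact a b) : KoszulExact b a := fun x y hxy => by
  obtain ⟨w, hy, hx⟩ := h y x (by rw [add_comm]; exact hxy)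
  exact ⟨-w, by rw [hx]; ring, by rw [hy]; ring⟩

lemma ne_zero_or_ne_zero [Nontrivial A] (h : KoszulExact a b) : a ≠ 0 ∨ b ≠ 0 := by
  by_contra! hab
  obtain ⟨rfl, rfl⟩ := hab
  obtain ⟨w, h1, -⟩ := h 1 1 (by simp)
  simp at h1

lemma of_isRelPrime [IsDomain A] [DecompositionMonoid A] (h : IsRelPrime a b) (ha : a ≠ 0) :
    KoszulExact a b := fun x y hxy => by
  have h1 : a ∣ b * y := ⟨-x, by linear_combination hxy⟩
  obtain ⟨w, rfl⟩ := h.dvd_of_dvd_mul_left h1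
  refine ⟨-w, mul_left_cancel₀ ha ?_, by ring⟩
  linear_combination hxy

/-- Exactness is only required up to the factor `f`, which becomes invertible; this is the form in
which exactness spreads out from a prime. -/
lemma of_mem_of_isLocalization {S : Type*} [CommRing S] [Algebra A S] (M : Submonoid A)
    [IsLocalization M S] {f : A} (hf : f ∈ M)
    (h : ∀ x y : A, a * x + b * y = 0 → ∃ w, f * x = b * w ∧ f * y = -(a * w)) :
    KoszulExact (algebraMap A S a) (algebraMap A S b) := fun x y hxy => by
  classical
  obtain ⟨m, hm⟩ := IsLocalization.exist_integer_multiples_of_finset M ({x, y} : Finset S)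
  obtain ⟨x', hx'⟩ := hm x (by simp)
  obtain ⟨y', hy'⟩ := hm y (by simp)
  rw [Algebra.smul_def] at hx' hy'
  have h1 : algebraMap A S (a * x' + b * y') = algebraMap A S 0 := by
    rw [map_add, map_mul, map_mul, hx', hy', map_zero]
    linear_combination algebraMap A S m * hxy
  obtain ⟨c, hc⟩ := IsLocalization.exists_of_eq (M := M) h1
  obtain ⟨w, hw1, hw2⟩ := h (c * x') (c * y') (by linear_combination hc)
  have hu : IsUnit (algebraMap A S (⟨f, hf⟩ * c * m : M)) := IsLocalization.map_units S _
  obtain ⟨u, hu⟩ := hu.exists_left_inv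
  rw [Submonoid.coe_mul, Submonoid.coe_mul, map_mul, map_mul] at hu
  have hw1' := congrArg (algebraMap A S) hw1
  have hw2' := congrArg (algebraMap A S) hw2
  simp only [map_mul, map_neg, hx', hy'] at hw1' hw2'
  refine ⟨u * algebraMap A S w, ?_, ?_⟩
  · linear_combination u * hw1' - x * hu
  · linear_combination u * hw2' - y * hu

lemma of_isLocalization {S : Type*} [CommRing S] [Algebra A S] (M : Submonoid A)
    [IsLocalization M S] (h : KoszulExact a b) :
    KoszulExact (algebraMap A S a) (algebraMap A S b) :=
  of_mem_of_isLocalization M M.one_mem fun x y hxy => by simpa only [one_mul] using h x y hxy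

/-- In a noetherian domain, exactness of the Koszul complex spreads out from a prime. -/
lemma exists_of_localization [IsDomain A] [IsNoetherianRing A] (p : Ideal A) [p.IsPrime]
    {S : Type*} [CommRing S] [Algebra A S] [IsLocalization.AtPrime S p]
    (h : KoszulExact (algebraMap A S a) (algebraMap A S b)) :
    ∃ f ∉ p, ∀ x y : A, a * x + b * y = 0 → ∃ w, f * x = b * w ∧ f * y = -(a * w) := by
  let N : Submodule A (A × A) := LinearMap.ker
    ((LinearMap.mulLeft A a).coprod (LinearMap.mulLeft A b))
  have hinj : Function.Injective (algebraMap A S) :=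
    IsLocalization.injective S p.primeCompl_le_nonZeroDivisors
  -- The module of relations is finitely generated, so a product of finitely many denominators, one
  -- for each generator, does for all relations.
  suffices H : ∀ L : Submodule A (A × A), L.FG → L ≤ N →
      ∃ f ∉ p, ∀ z ∈ L, ∃ w, f * z.1 = b * w ∧ f * z.2 = -(a * w) by
    obtain ⟨f, hf, hf'⟩ := H N (IsNoetherian.noetherian N) le_rfl
    exact ⟨f, hf, fun x y hxy => hf' (x, y) hxy⟩
  intro L hL
  induction L, hL using Submodule.fg_induction with
  | singleton z =>
    intro hz
    have hz' : a * z.1 + b * z.2 = 0 := hz (Submodule.mem_span_singleton_self z)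
    obtain ⟨w, h1, h2⟩ := h (algebraMap A S z.1) (algebraMap A S z.2) (by
      rw [← map_mul, ← map_mul, ← map_add, hz', map_zero])
    obtain ⟨⟨w', t⟩, hw⟩ := IsLocalization.surj p.primeCompl w
    refine ⟨t, t.2, fun z' hz' => ?_⟩
    obtain ⟨c, rfl⟩ := Submodule.mem_span_singleton.mp hz'
    refine ⟨c * w', hinj ?_, hinj ?_⟩
    · simp only [Prod.smul_fst, smul_eq_mul, map_mul, ← hw, h1]; ring
    · simp only [Prod.smul_snd, smul_eq_mul, map_mul, map_neg, ← hw, h2]; ring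
  | sup L₁ L₂ hL₁ hL₂ ih₁ ih₂ =>
    intro hz
    obtain ⟨f, hf, hf'⟩ := ih₁ (le_sup_left.trans hz)
    obtain ⟨g, hg, hg'⟩ := ih₂ (le_sup_right.trans hz)
    refine ⟨f * g, fun hfg => (Ideal.IsPrime.mem_or_mem ‹_› hfg).elim hf hg, fun z hz => ?_⟩
    obtain ⟨z₁, h₁, z₂, h₂, rfl⟩ := Submodule.mem_sup.mp hz
    obtain ⟨w₁, e₁, e₁'⟩ := hf' z₁ h₁
    obtain ⟨w₂, e₂, e₂'⟩ := hg' z₂ h₂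
    refine ⟨g * w₁ + f * w₂, ?_, ?_⟩
    · simp only [Prod.fst_add]; linear_combination g * e₁ + f * e₂
    · simp only [Prod.snd_add]; linear_combination g * e₁' + f * e₂'

/-- A relation between constants holds coefficient by coefficient; the bound `N` exceeds both
degrees, so the chosen `w n` assemble to a polynomial. -/
lemma polynomial (h : KoszulExact a b) : KoszulExact (C a) (C b) := fun x y hxy => by
  have hc : ∀ n, ∃ w, x.coeff n = b * w ∧ y.coeff n = -(a * w) := fun n => h _ _ (by
    have := congrArg (coeff · n) hxy
    simpa using this)
  choose w hw1 hw2 using hc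
  let N := max x.natDegree y.natDegree + 1
  refine ⟨∑ n ∈ Finset.range N, monomial n (w n), ?_, ?_⟩
  · ext n
    rw [coeff_C_mul, finsetSum_coeff]
    simp only [coeff_monomial, Finset.sum_ite_eq', Finset.mem_range]
    split_ifs with hn
    · exact hw1 n
    · rw [mul_zero]; exact coeff_eq_zero_of_natDegree_lt (by omega)
  · ext n
    rw [coeff_neg, coeff_C_mul, finsetSum_coeff]
    simp only [coeff_monomial, Finset.sum_ite_eq', Finset.mem_range]
    split_ifs with hn
    · exact hw2 n
    · rw [mul_zero, neg_zero]; exact coeff_eq_zero_of_natDegree_lt (by omega)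

/-- The constant `b` is a nonzerodivisor modulo `a + b X`. -/
lemma dvd_of_dvd_C_mul (h : KoszulExact a b) {g : A[X]} (hg : C a + C b * X ∣ C b * g) :
    C a + C b * X ∣ g := by
  obtain ⟨r, hr⟩ := hg
  -- From `b g = (a + b X) r` comes the relation `a r + b (X r - g) = 0`, whose solution gives `g =
  -- (a + b X) w`.
  obtain ⟨w, h1, h2⟩ := h.polynomial r (X * r - g) (by linear_combination -hr)
  exact ⟨w, by linear_combination X * h1 - h2⟩

/-- The polynomial `a + b X` is a nonzerodivisor modulo any nonzero constant. -/
lemma C_dvd_of_dvd_mul [IsDomain A] (h : KoszulExact a b) {d : A} (hd : d ≠ 0) {g : A[X]}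
    (hg : C d ∣ (C a + C b * X) * g) : C d ∣ g := by
  let φ := Ideal.Quotient.mk (Ideal.span {d})
  have hφ : ∀ r, φ r = 0 ↔ d ∣ r := fun r => by
    rw [Ideal.Quotient.eq_zero_iff_mem, Ideal.mem_span_singleton]
  -- By McCoy's theorem a zero divisor in a polynomial ring is killed by a nonzero constant. If `r a
  -- = d p` and `r b = d q`, then `a q = b p`, whence `p = a w` and `q = b w`. Cancelling `a` or
  -- `b`, whichever is nonzero, yields `r = d w`.
  have key : (C (φ a) + C (φ b) * X : (A ⧸ Ideal.span {d})[X]) ∈ nonZeroDivisors _ := by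
    rw [Polynomial.mem_nonZeroDivisors_iff]
    intro r hr
    obtain ⟨r, rfl⟩ := Ideal.Quotient.mk_surjective r
    have h0 := congrArg (coeff · 0) hr
    have h1 := congrArg (coeff · 1) hr
    simp [coeff_C] at h0 h1
    rw [← map_mul, hφ] at h0 h1
    obtain ⟨p, hp⟩ := h0
    obtain ⟨q, hq⟩ := h1
    obtain ⟨w, e1, e2⟩ := h q (-p) (mul_left_cancel₀ hd (by linear_combination b * hp - a * hq))
    rw [hφ]
    refine ⟨w, ?_⟩
    rcases h.ne_zero_or_ne_zero with ha | hb
    · exact mul_left_cancel₀ ha (by linear_combination hp - d * e2)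
    · exact mul_left_cancel₀ hb (by linear_combination hq + d * e1)
  have hmap : g.map φ = 0 := by
    obtain ⟨r, hr⟩ := hg
    have := congrArg (Polynomial.map φ) hr
    simp only [Polynomial.map_mul, Polynomial.map_add, map_C, map_X, (hφ d).mpr dvd_rfl,
      map_zero, zero_mul] at this
    exact (mem_nonZeroDivisors_iff_left.mp key) _ this
  rw [C_dvd_iff_dvd_coeff]
  intro n
  rw [← hφ]
  simpa using congrArg (coeff · n) hmap

lemma span_inf_span [IsDomain A] (h : KoszulExact a b) {d : A} (hd : d ≠ 0) :
    Ideal.span {C d} ⊓ Ideal.span {C a + C b * X} = Ideal.span {C d * (C a + C b * X)} := by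
  refine le_antisymm ?_ ?_
  · rintro g ⟨h1, h2⟩
    obtain ⟨r, rfl⟩ := Ideal.mem_span_singleton.mp h2
    obtain ⟨r', rfl⟩ := h.C_dvd_of_dvd_mul hd (Ideal.mem_span_singleton.mp h1)
    exact Ideal.mem_span_singleton.mpr ⟨r', by ring⟩
  · rw [Ideal.span_singleton_le_iff_mem]
    exact ⟨Ideal.mul_mem_right _ _ (Ideal.mem_span_singleton_self _),
      Ideal.mul_mem_left _ _ (Ideal.mem_span_singleton_self _)⟩

/-- In a one-dimensional local domain a Koszul exact pair generates the unit ideal. -/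
lemma isUnit_or_isUnit [IsDomain A] [IsLocalRing A] [Ring.KrullDimLE 1 A]
    (h : KoszulExact a b) : IsUnit a ∨ IsUnit b := by
  suffices H : ∀ {a b : A}, KoszulExact a b → a ≠ 0 → IsUnit a ∨ IsUnit b by
    rcases h.ne_zero_or_ne_zero with ha | hb
    · exact H h ha
    · exact (H h.symm hb).symm
  intro a b h ha
  by_contra! hab
  -- In dimension one every nonzero prime is maximal, so each prime containing `a` contains the
  -- nonunit `b`.
  have hb : b ∈ (Ideal.span {a}).radical := by
    rw [Ideal.radical_eq_sInf, Ideal.mem_sInf]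
    rintro P ⟨hP, hPp⟩
    have hP0 : P ≠ ⊥ := by
      rintro rfl
      exact ha (by simpa using hP (Ideal.mem_span_singleton_self a))
    have := IsLocalRing.eq_maximalIdeal (hPp.isMaximal_of_ne_bot hP0)
    rw [this]
    exact (IsLocalRing.mem_maximalIdeal b).mpr hab.2
  obtain ⟨n, hn⟩ := hb
  -- Descent on the exponent: `b ^ (n + 1) = a c` is a relation between `a` and `b`, and exactness
  -- makes `b ^ n` a multiple of `a`; at exponent zero `a` divides `1`.
  have : ∀ n : ℕ, b ^ n ∈ Ideal.span {a} → IsUnit a := by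
    intro n
    induction n with
    | zero =>
      intro h1
      rw [pow_zero, Ideal.mem_span_singleton] at h1
      exact isUnit_of_dvd_one h1
    | succ n ih =>
      intro h1
      obtain ⟨c, hc⟩ := Ideal.mem_span_singleton.mp h1
      obtain ⟨w, -, hw⟩ := h (-c) (b ^ n) (by rw [pow_succ'] at hc; linear_combination hc)
      exact ih (Ideal.mem_span_singleton.mpr ⟨-w, by rw [hw]; ring⟩)
  exact hab.1 (this n hn)

end KoszulExact

/-- In a factorial domain, every pair is a multiple of a Koszul exact one. -/
lemma exists_koszulExact {R : Type*} [CommRing R] [IsDomain R] [UniqueFactorizationMonoid R]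
    (a b : R) (h : a ≠ 0 ∨ b ≠ 0) :
    ∃ d a' b', d ≠ 0 ∧ a = d * a' ∧ b = d * b' ∧ KoszulExact a' b' := by
  wlog ha : a ≠ 0 generalizing a b
  · obtain ⟨d, b', a', hd, hb', ha', hk⟩ := this b a h.symm (h.resolve_left ha)
    exact ⟨d, a', b', hd, ha', hb', hk.symm⟩
  obtain ⟨a', b', d, hrel, rfl, rfl⟩ := UniqueFactorizationMonoid.exists_reduced_factors a ha b
  exact ⟨d, a', b', left_ne_zero_of_mul ha, rfl, rfl, .of_isRelPrime hrel (right_ne_zero_of_mul ha)⟩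

/-- In a factorial domain, divisibility by `d ≠ 0` can be checked at the primes of height one. -/
lemma dvd_of_forall_prime {R : Type*} [CommRing R] [IsDomain R] [UniqueFactorizationMonoid R]
    (d : R) (hd : d ≠ 0) (x : R) (h : ∀ π : R, Prime π → ∃ t, ¬ π ∣ t ∧ d ∣ t * x) : d ∣ x := by
  induction d using UniqueFactorizationMonoid.induction_on_prime generalizing x with
  | h₁ => exact absurd rfl hd
  | h₂ d hu => exact hu.dvd
  | h₃ d π hd0 hπ ih =>
    -- The condition at `π` forces `π ∣ x`. After `π` is cancelled from `x` and from the divisor,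
    -- the condition persists at every prime.
    obtain ⟨t, ht, ht'⟩ := h π hπ
    obtain ⟨x', rfl⟩ := (hπ.dvd_or_dvd (dvd_of_mul_right_dvd ht')).resolve_left ht
    refine mul_dvd_mul_left π (ih hd0 x' fun ρ hρ => ?_)
    obtain ⟨t, ht, ht'⟩ := h ρ hρ
    refine ⟨t, ht, ?_⟩
    rw [mul_left_comm] at ht'
    exact (mul_dvd_mul_iff_left hπ.ne_zero).mp ht'

/-- A nonzerodivisor can be cancelled, so `(d K : d) = K`. It identifies the residual ideal on `X`
as well as the residual component on the bundle. -/
lemma colon_span_singleton {R : Type*} [CommRing R] {d : R} (hd : d ∈ nonZeroDivisors R)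
    (I K : Ideal R) (hI : I = Ideal.span {d} * K) (L : Ideal R) : L * Ideal.span {d} ≤ I ↔ L ≤ K := by
  subst hI
  constructor
  · intro h x hx
    have := h (Ideal.mul_mem_mul hx (Ideal.mem_span_singleton_self d))
    obtain ⟨z, hz, hz'⟩ := Ideal.mem_span_singleton_mul.mp this
    have h0 : d * (z - x) = 0 := by rw [mul_sub, hz']; ring
    rw [← sub_eq_zero.mp ((mem_nonZeroDivisors_iff_left.mp hd) _ h0)]
    exact hz
  · intro h
    rw [mul_comm]
    exact Ideal.mul_mono_right h

end Koszul

/-! ### Gluing ideals to an ideal sheaf -/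

section IdealSheafGluing

variable {X : Scheme.{u}}

lemma isLocalization_res {U : X.Opens} (hU : IsAffineOpen U) (f : Γ(X, U)) :
    letI := (res X (X.basicOpen_le f)).toAlgebra
    IsLocalization.Away f Γ(X, X.basicOpen f) :=
  hU.isLocalization_basicOpen f

lemma mem_map_res_iff {U : X.Opens} (hU : IsAffineOpen U) (f : Γ(X, U)) (I : Ideal Γ(X, U))
    (z : Γ(X, X.basicOpen f)) :
    z ∈ I.map (res X (X.basicOpen_le f)) ↔
      ∃ (n : ℕ) (a : Γ(X, U)), a ∈ I ∧ res X (X.basicOpen_le f) (f ^ n) * z =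
        res X (X.basicOpen_le f) a := by
  let := (res X (X.basicOpen_le f)).toAlgebra
  have := isLocalization_res hU f
  refine (IsLocalization.mem_map_algebraMap_iff (.powers f) _).trans ⟨?_, ?_⟩
  · rintro ⟨⟨⟨a, ha⟩, ⟨_, n, rfl⟩⟩, h⟩
    exact ⟨n, a, ha, by rw [mul_comm]; exact h⟩
  · rintro ⟨n, a, ha, h⟩
    exact ⟨⟨⟨a, ha⟩, ⟨_, n, rfl⟩⟩, by rw [mul_comm] at h; exact h⟩

lemma exists_res_eq {U : X.Opens} (hU : IsAffineOpen U) (f : Γ(X, U))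
    (z : Γ(X, X.basicOpen f)) :
    ∃ (n : ℕ) (a : Γ(X, U)), res X (X.basicOpen_le f) (f ^ n) * z =
        res X (X.basicOpen_le f) a := by
  obtain ⟨n, a, -, h⟩ := (mem_map_res_iff hU f ⊤ z).mp (by rw [Ideal.map_top]; trivial)
  exact ⟨n, a, h⟩

lemma exists_pow_mul_eq_of_res_eq {U : X.Opens} (hU : IsAffineOpen U) (f : Γ(X, U))
    (a b : Γ(X, U)) (h : res X (X.basicOpen_le f) a = res X (X.basicOpen_le f) b) :
    ∃ n : ℕ, f ^ n * a = f ^ n * b := by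
  let := (res X (X.basicOpen_le f)).toAlgebra
  have := isLocalization_res hU f
  obtain ⟨⟨_, n, rfl⟩, h⟩ := IsLocalization.exists_of_eq (M := .powers f) h
  exact ⟨n, h⟩

lemma germ_res_apply' {U V : X.Opens} (h : V ≤ U) (x : X) (hx : x ∈ V) (a : Γ(X, U)) :
    X.presheaf.germ V x hx (res X h a) = X.presheaf.germ U x (h hx) a :=
  X.presheaf.germ_res_apply (homOfLE h) x hx a

lemma map_germ_map_res {U V : X.Opens} (h : V ≤ U) (x : X) (hx : x ∈ V) (I : Ideal Γ(X, U)) :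
    (I.map (res X h)).map (X.presheaf.germ V x hx).hom =
      I.map (X.presheaf.germ U x (h hx)).hom := by
  rw [Ideal.map_map]
  congr 1
  ext a
  exact germ_res_apply' h x hx a

/-- Ideals on the members of a family of affine opens that covers `X` and is stable under basic
opens come from an ideal sheaf as soon as they are compatible with restriction to basic opens. -/
theorem exists_idealSheafData (N : Set X.affineOpens) (K : ∀ U : X.affineOpens, Ideal Γ(X, U))
    (hcov : ∀ x, ∃ U ∈ N, x ∈ U.1)
    (hN : ∀ U ∈ N, ∀ f : Γ(X, U.1), X.affineBasicOpen f ∈ N)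
    (hK : ∀ U ∈ N, ∀ f : Γ(X, U.1),
      (K U).map (res X (X.basicOpen_le f)) = K (X.affineBasicOpen f)) :
    ∃ Z : X.IdealSheafData, ∀ U ∈ N, Z.ideal U = K U := by
  choose c hc hxc using hcov
  -- The candidate stalks. They do not depend on the chosen affine open, because two members of the
  -- family share a basic open neighbourhood of each common point.
  let S (x : X) : Ideal (X.presheaf.stalk x) :=
    (K (c x)).map (X.presheaf.germ (c x).1 x (hxc x)).hom
  have hS : ∀ U ∈ N, ∀ x (hx : x ∈ U.1), (K U).map (X.presheaf.germ U.1 x hx).hom = S x := by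
    intro U hU x hx
    obtain ⟨f, g, e, hf⟩ := exists_basicOpen_le_affine_inter U.2 (c x).2 x ⟨hx, hxc x⟩
    have h1 := hK U hU f
    have h2 := hK (c x) (hc x) g
    have e' : X.affineBasicOpen f = X.affineBasicOpen g := Subtype.ext e
    rw [← map_germ_map_res (X.basicOpen_le f) x hf, h1]
    dsimp only [S]
    rw [← map_germ_map_res (X.basicOpen_le g) x (e ▸ hf), h2]
    have : ∀ (V W : X.affineOpens) (h : V = W) (hV : x ∈ V.1) (hW : x ∈ W.1),
        (K V).map (X.presheaf.germ V.1 x hV).hom = (K W).map (X.presheaf.germ W.1 x hW).hom := by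
      rintro V _ rfl _ _; rfl
    exact this _ _ e' _ _
  have hmem : ∀ U ∈ N, ∀ a : Γ(X, U.1), a ∈ K U ↔
      ∀ x (hx : x ∈ U.1), X.presheaf.germ U.1 x hx a ∈ S x := by
    intro U hU a
    rw [U.2.mem_ideal_iff]
    exact forall₂_congr fun x hx => by rw [hS U hU x hx]
  -- On an arbitrary affine open, the functions whose germs all lie in the candidate stalks. The
  -- real issue is quasi-coherence: `J U` must be large enough to generate these stalks.
  let J (U : X.affineOpens) : Ideal Γ(X, U.1) :=
    ⨅ (x : X) (hx : x ∈ U.1), (S x).comap (X.presheaf.germ U.1 x hx).hom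
  have hJ : ∀ (U : X.affineOpens) (a : Γ(X, U.1)), a ∈ J U ↔
      ∀ x (hx : x ∈ U.1), X.presheaf.germ U.1 x hx a ∈ S x := by
    intro U a
    simp only [J, Ideal.mem_iInf]
    rfl
  have hJS : ∀ (U : X.affineOpens) x (hx : x ∈ U.1),
      (J U).map (X.presheaf.germ U.1 x hx).hom = S x := by
    intro U x hx
    refine le_antisymm ?_ ?_
    · rw [Ideal.map_le_iff_le_comap]
      exact fun a ha => (hJ U a).mp ha x hx
    obtain ⟨g, h, e, hg⟩ := exists_basicOpen_le_affine_inter U.2 (c x).2 x ⟨hx, hxc x⟩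
    have hW : X.affineBasicOpen g ∈ N := by
      have e' : X.affineBasicOpen g = X.affineBasicOpen h := Subtype.ext e
      rw [e']
      exact hN _ (hc x) h
    rw [← hS _ hW x hg, Ideal.map_le_iff_le_comap]
    intro k hk
    -- A section `k` of the ideal near `x` becomes the restriction of a function `u` on `U` after
    -- multiplication by a power of `g`. A further power of `g` has to bring `u` into `J U`.
    obtain ⟨n, u, hu⟩ := exists_res_eq U.2 g k
    have hcovU : ∀ y : U.1, ∃ r : Γ(X, U.1), X.affineBasicOpen r ∈ N ∧ y.1 ∈ X.basicOpen r := by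
      intro y
      obtain ⟨r, r', e, hr⟩ := exists_basicOpen_le_affine_inter U.2 (c y.1).2 y ⟨y.2, hxc y⟩
      refine ⟨r, ?_, hr⟩
      have e' : X.affineBasicOpen r = X.affineBasicOpen r' := Subtype.ext e
      rw [e']
      exact hN _ (hc y.1) r'
    choose r hrN hyr using hcovU
    -- On each basic open `D(r y)` in the family, `u` belongs to the ideal where `g` is invertible,
    -- so some power of `g` suffices there.
    have hloc : ∀ y : U.1, ∃ m : ℕ, res X (X.basicOpen_le (r y)) (g ^ m * u) ∈
        K (X.affineBasicOpen (r y)) := by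
      intro y
      let g' := res X (X.basicOpen_le (r y)) g
      let u' := res X (X.basicOpen_le (r y)) u
      have hle : X.basicOpen g' ≤ X.basicOpen g := by
        rw [show X.basicOpen g' = X.basicOpen (r y) ⊓ X.basicOpen g from
          X.basicOpen_res g (homOfLE (X.basicOpen_le (r y))).op]
        exact inf_le_right
      have h1 : res X (X.basicOpen_le g') u' ∈
          (K (X.affineBasicOpen (r y))).map (res X (X.basicOpen_le g')) := by
        rw [show (K (X.affineBasicOpen (r y))).map (res X (X.basicOpen_le g')) = _ from
          hK _ (hrN y) g']
        refine (hmem _ (hN _ (hrN y) g') _).mpr fun z hz => ?_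
        have hzg : z ∈ X.basicOpen g := hle hz
        have hzk := (hmem _ hW k).mp hk z hzg
        have h3 := (map_mul (X.presheaf.germ (X.basicOpen g) z hzg).hom _ _).symm.trans
          ((congrArg (X.presheaf.germ (X.basicOpen g) z hzg) hu).trans (germ_res_apply' _ _ _ _))
        have h4 : X.presheaf.germ (X.basicOpen g') z hz (res X (X.basicOpen_le g') u') =
            X.presheaf.germ U.1 z (X.basicOpen_le g hzg) u := by
          exact (germ_res_apply' _ _ _ _).trans (germ_res_apply' _ _ _ _)
        exact h4 ▸ h3 ▸ Ideal.mul_mem_left _ _ hzk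
      obtain ⟨m, a, ha, h2⟩ := (mem_map_res_iff (X.affineBasicOpen (r y)).2 g' _ _).mp h1
      obtain ⟨l, hl⟩ := exists_pow_mul_eq_of_res_eq (X.affineBasicOpen (r y)).2 g' (g' ^ m * u') a
        ((map_mul _ _ _).trans h2)
      refine ⟨l + m, ?_⟩
      have h5 : res X (X.basicOpen_le (r y)) (g ^ (l + m) * u) = g' ^ l * (g' ^ m * u') := by
        rw [map_mul, map_pow, pow_add, mul_assoc]
      exact (h5.trans hl) ▸ Ideal.mul_mem_left _ _ ha
    choose m hm using hloc
    -- Quasi-compactness of `U` bounds the exponents uniformly.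
    obtain ⟨t, ht⟩ := U.2.isCompact.elim_nhds_subcover'
      (fun y hy => (X.basicOpen (r ⟨y, hy⟩) : Set X))
      (fun y hy => (X.basicOpen (r ⟨y, hy⟩)).isOpen.mem_nhds (hyr ⟨y, hy⟩))
    let M := t.sup m
    have hM : g ^ M * u ∈ J U := by
      rw [hJ]
      intro z hz
      obtain ⟨y, hyt, hzy⟩ := Set.mem_iUnion₂.mp (ht hz)
      have h1 := (hmem _ (hrN y) _).mp (hm y) z hzy
      have h2 : X.presheaf.germ (X.basicOpen (r y)) z hzy
          (res X (X.basicOpen_le (r y)) (g ^ m y * u)) = _ :=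
        germ_res_apply' (X.basicOpen_le (r y)) z hzy (g ^ m y * u)
      have h3 : X.presheaf.germ U.1 z hz (g ^ m y * u) ∈ S z := h2 ▸ h1
      obtain ⟨j, hj⟩ := Nat.exists_eq_add_of_le (Finset.le_sup (f := m) hyt)
      have h4 : g ^ M * u = g ^ j * (g ^ m y * u) := by
        rw [show M = m y + j from hj, pow_add]; ring
      rw [h4, map_mul]
      exact Ideal.mul_mem_left _ _ h3
    have hgu : IsUnit (X.presheaf.germ U.1 x hx g) := (X.mem_basicOpen g x hx).mp hg
    have h6 : X.presheaf.germ U.1 x hx (g ^ M * u) =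
        X.presheaf.germ U.1 x hx g ^ (M + n) * X.presheaf.germ (X.basicOpen g) x hg k := by
      have h3 : X.presheaf.germ U.1 x hx g ^ n * X.presheaf.germ (X.basicOpen g) x hg k =
          X.presheaf.germ U.1 x hx u := by
        have h4 := (map_mul (X.presheaf.germ (X.basicOpen g) x hg).hom _ _).symm.trans
          (congrArg (X.presheaf.germ (X.basicOpen g) x hg) hu)
        refine Eq.trans ?_ (h4.trans (germ_res_apply' _ _ _ _))
        refine congrArg (· * _) ?_
        rw [← map_pow]
        exact (germ_res_apply' (X.basicOpen_le g) x hg (g ^ n)).symm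
      rw [map_mul, ← h3, map_pow, pow_add, mul_assoc]
    have h7 := Ideal.mem_map_of_mem (X.presheaf.germ U.1 x hx).hom hM
    have h8 : (X.presheaf.germ U.1 x hx g ^ (M + n) * X.presheaf.germ (X.basicOpen g) x hg k) ∈
      (J U).map (X.presheaf.germ U.1 x hx).hom := h6 ▸ h7
    exact (Ideal.unit_mul_mem_iff_mem _ (hgu.pow _)).mp h8
  refine ⟨{ ideal := J, map_ideal_basicOpen := fun U f => ?_ }, fun U hU => ?_⟩
  · refine ((X.affineBasicOpen f).2.ideal_ext_iff).mpr fun x hx => ?_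
    refine Eq.trans ?_ (hJS _ x hx).symm
    exact (map_germ_map_res (X.basicOpen_le f) x hx _).trans (hJS U x _)
  · ext a
    exact (hJ U a).trans (hmem U hU a).symm

end IdealSheafGluing

/-! ### Ideal sheaves in charts -/

section PullIdeal

variable {X Y : Scheme.{u}}

/-- The ideal of `R` that defines the inverse image, under `f : Spec R ⟶ X`, of the closed subscheme
defined by `I`. -/
def pullIdeal (I : X.IdealSheafData) {R : CommRingCat.{u}} (f : Spec R ⟶ X) : Ideal R :=
  ((I.comap f).ideal ⟨⊤, isAffineOpen_top _⟩).comap (Scheme.ΓSpecIso R).inv.hom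

lemma pullIdeal_comap (I : X.IdealSheafData) (g : Y ⟶ X) {R : CommRingCat.{u}} (f : Spec R ⟶ Y) :
    pullIdeal (I.comap g) f = pullIdeal I (f ≫ g) := by
  rw [pullIdeal, pullIdeal, Scheme.IdealSheafData.comap_comp]

lemma mem_comap_ΓSpecIso_iff {R : CommRingCat.{u}} (I : (Spec R).IdealSheafData)
    (x : Γ(Spec R, ⊤)) : x ∈ I.ideal ⟨⊤, isAffineOpen_top _⟩ ↔
      (Scheme.ΓSpecIso R).hom x ∈ (I.ideal ⟨⊤, isAffineOpen_top _⟩).comap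
        (Scheme.ΓSpecIso R).inv.hom := by
  rw [Ideal.mem_comap]
  have : (Scheme.ΓSpecIso R).inv ((Scheme.ΓSpecIso R).hom x) = x := by simp
  exact iff_of_eq (congrArg _ this.symm)

lemma le_iff_pullIdeal_id_le {R : CommRingCat.{u}} {I J : (Spec R).IdealSheafData} :
    I ≤ J ↔ pullIdeal I (𝟙 _) ≤ pullIdeal J (𝟙 _) := by
  rw [pullIdeal, pullIdeal, Scheme.IdealSheafData.comap_id, Scheme.IdealSheafData.comap_id]
  refine ⟨fun h => Ideal.comap_mono (h _), fun h => Scheme.IdealSheafData.le_of_isAffine ?_⟩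
  intro x hx
  exact (mem_comap_ΓSpecIso_iff J x).mpr (h ((mem_comap_ΓSpecIso_iff I x).mp hx))

/-- The ideal sheaf on `Spec R` with a given ideal of global sections. -/
def specIdeal {R : CommRingCat.{u}} (K : Ideal R) : (Spec R).IdealSheafData :=
  .ofIdealTop (K.comap (Scheme.ΓSpecIso R).hom.hom)

lemma pullIdeal_specIdeal {R : CommRingCat.{u}} (K : Ideal R) :
    pullIdeal (specIdeal K) (𝟙 _) = K := by
  rw [pullIdeal, Scheme.IdealSheafData.comap_id]
  have : (specIdeal K).ideal ⟨⊤, isAffineOpen_top _⟩ = K.comap (Scheme.ΓSpecIso R).hom.hom := by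
    have := Scheme.IdealSheafData.equivOfIsAffine.apply_symm_apply
      (K.comap (Scheme.ΓSpecIso R).hom.hom)
    exact this
  rw [this, Ideal.comap_comap]
  ext x
  rw [Ideal.mem_comap]
  have : (Scheme.ΓSpecIso R).hom ((Scheme.ΓSpecIso R).inv x) = x := by simp
  exact iff_of_eq (congrArg _ this)

lemma pullIdeal_id_map {R S : CommRingCat.{u}} (φ : R ⟶ S) (I : (Spec S).IdealSheafData) :
    pullIdeal (I.map (Spec.map φ)) (𝟙 _) = (pullIdeal I (𝟙 _)).comap φ.hom := by
  rw [pullIdeal, pullIdeal, Scheme.IdealSheafData.comap_id, Scheme.IdealSheafData.comap_id,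
    Scheme.IdealSheafData.ideal_map_of_isAffineHom, Ideal.comap_comap, Ideal.comap_comap]
  have : (Scheme.ΓSpecIso R).inv ≫ (Spec.map φ).app ⊤ = φ ≫ (Scheme.ΓSpecIso S).inv :=
    (Scheme.ΓSpecIso_inv_naturality φ).symm
  exact congrArg (fun ψ => Ideal.comap ψ.hom (I.ideal ⟨⊤, isAffineOpen_top _⟩)) this

/-- Inverse image of ideal sheaves is left adjoint to direct image, just as extension of ideals is
to contraction. Since direct image along `Spec φ` is contraction, the two left adjoints agree. -/
lemma pullIdeal_specMap {R S : CommRingCat.{u}} (φ : R ⟶ S) (I : (Spec R).IdealSheafData) :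
    pullIdeal I (Spec.map φ) = (pullIdeal I (𝟙 _)).map φ.hom := by
  have h : ∀ K : Ideal S, pullIdeal I (Spec.map φ) ≤ K ↔ (pullIdeal I (𝟙 _)).map φ.hom ≤ K := by
    intro K
    rw [Ideal.map_le_iff_le_comap, ← pullIdeal_specIdeal K, ← pullIdeal_id_map,
      ← le_iff_pullIdeal_id_le, Scheme.IdealSheafData.le_map_iff_comap_le,
      le_iff_pullIdeal_id_le, pullIdeal_comap, Category.id_comp]
  exact le_antisymm ((h _).mpr le_rfl) ((h _).mp le_rfl)

@[simp]
lemma pullIdeal_specMap_comp (I : X.IdealSheafData) {R S : CommRingCat.{u}} (φ : R ⟶ S)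
    (f : Spec R ⟶ X) : pullIdeal I (Spec.map φ ≫ f) = (pullIdeal I f).map φ.hom := by
  rw [← pullIdeal_comap, pullIdeal_specMap, pullIdeal_comap, Category.id_comp]

lemma pullIdeal_fromSpec (I : X.IdealSheafData) {U : X.Opens} (hU : IsAffineOpen U) :
    pullIdeal I hU.fromSpec = I.ideal ⟨U, hU⟩ := by
  -- The image of the whole spectrum under `fromSpec` equals `U` only propositionally, so the
  -- statement is generalized to an affine open `V` equal to `U`.
  have key : ∀ (V : X.affineOpens) (hV : V = ⟨U, hU⟩)
      (ψ : Γ(X, V.1) ⟶ Γ(Spec Γ(X, U), ⊤)) [IsIso ψ]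
      (h : X.presheaf.map (eqToHom congr($hV.1)).op ≫ ψ = (Scheme.ΓSpecIso Γ(X, U)).inv),
      ((I.ideal V).comap (inv ψ).hom).comap (Scheme.ΓSpecIso Γ(X, U)).inv.hom = I.ideal ⟨U, hU⟩ := by
    rintro _ rfl ψ _ h
    simp only [eqToHom_refl, op_id, CategoryTheory.Functor.map_id, Category.id_comp] at h
    rw [← h, Ideal.comap_comap, ← CommRingCat.hom_comp, IsIso.hom_inv_id]
    exact Ideal.comap_id _
  rw [pullIdeal, Scheme.IdealSheafData.ideal_comap_of_isOpenImmersion]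
  have h : X.presheaf.map (eqToHom (show hU.fromSpec ''ᵁ ⊤ = U by simp)).op ≫
      (hU.fromSpec.appIso ⊤).hom = (Scheme.ΓSpecIso Γ(X, U)).inv := by
    rw [Scheme.Hom.appIso_hom']
    simp
    rw [Scheme.Hom.appLE, IsAffineOpen.fromSpec_app_self, Category.assoc, ← Functor.map_comp]
    exact (congr_arg _ ((Spec Γ(X, U)).presheaf.map_id _)).trans (Category.comp_id _)
  have := key ⟨hU.fromSpec ''ᵁ ⊤, (isAffineOpen_top _).image_of_isOpenImmersion hU.fromSpec⟩
    (Subtype.ext (by simp)) (hU.fromSpec.appIso ⊤).hom h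
  rw [← this]
  simp

/-- A morphism from an affine scheme into an affine open is given by a homomorphism of rings. -/
lemma exists_specMap_fromSpec {U : X.Opens} (hU : IsAffineOpen U) {R : CommRingCat.{u}}
    (f : Spec R ⟶ X) (hf : Set.range f ⊆ U) : ∃ φ : Γ(X, U) ⟶ R, f = Spec.map φ ≫ hU.fromSpec := by
  have h : Set.range f ⊆ Set.range hU.fromSpec := by rw [hU.range_fromSpec]; exact hf
  refine ⟨Spec.preimage (IsOpenImmersion.lift hU.fromSpec f h), ?_⟩
  rw [Spec.map_preimage, IsOpenImmersion.lift_fac]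

/-- The map from `Spec R` to the spectrum of the sections over the image is a surjective open
immersion. So arbitrary affine charts may replace affine opens, and polynomial rings may serve as
coordinate rings on the bundle. -/
lemma exists_iso_fromSpec {R : CommRingCat.{u}} (c : Spec R ⟶ X) [IsOpenImmersion c] :
    ∃ φ : Γ(X, c.opensRange) ≅ R, c = Spec.map φ.hom ≫ (isAffineOpen_opensRange c).fromSpec := by
  obtain ⟨φ, hφ⟩ := exists_specMap_fromSpec (isAffineOpen_opensRange c) c subset_rfl
  have h1 : IsOpenImmersion (Spec.map φ) := by
    have : IsOpenImmersion (Spec.map φ ≫ (isAffineOpen_opensRange c).fromSpec) := hφ ▸ inferInstance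
    exact .of_comp _ (isAffineOpen_opensRange c).fromSpec
  have h2 : Function.Surjective (Spec.map φ) := by
    intro y
    have : (isAffineOpen_opensRange c).fromSpec y ∈ Set.range c := by
      have h := (isAffineOpen_opensRange c).range_fromSpec
      exact h.le ⟨y, rfl⟩
    obtain ⟨z, hz⟩ := this
    refine ⟨z, (isAffineOpen_opensRange c).fromSpec.isOpenEmbedding.injective ?_⟩
    rw [← hz]
    exact congrArg (fun g => g z) hφ.symm
  have : Surjective (Spec.map φ) := ⟨h2⟩
  have h3 : IsIso (Spec.map φ) := (isIso_iff_isOpenImmersion_and_epi_base _).mpr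
    ⟨h1, (TopCat.epi_iff_surjective _).mpr h2⟩
  have : IsIso φ := by
    have : IsIso (Scheme.Spec.map φ.op) := h3
    have := isIso_of_reflects_iso φ.op Scheme.Spec
    exact isIso_of_op φ
  exact ⟨asIso φ, hφ⟩

lemma pullIdeal_eq_map (I : X.IdealSheafData) {R : CommRingCat.{u}} (c : Spec R ⟶ X)
    {U : X.Opens} (hU : IsAffineOpen U) (φ : Γ(X, U) ⟶ R) (h : c = Spec.map φ ≫ hU.fromSpec) :
    pullIdeal I c = (I.ideal ⟨U, hU⟩).map φ.hom := by
  rw [h, pullIdeal_specMap_comp, pullIdeal_fromSpec]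

lemma map_iso_le_iff {R S : CommRingCat.{u}} (φ : R ≅ S) (I J : Ideal R) :
    I.map φ.hom.hom ≤ J.map φ.hom.hom ↔ I ≤ J := by
  refine ⟨fun h => ?_, Ideal.map_mono⟩
  have := Ideal.map_mono (f := φ.inv.hom) h
  rw [Ideal.map_map, Ideal.map_map, ← CommRingCat.hom_comp, φ.hom_inv_id, CommRingCat.hom_id,
    Ideal.map_id, Ideal.map_id] at this
  exact this

/-- Inclusions of ideal sheaves can be checked on charts. -/
theorem le_of_pullIdeal_le {I J : X.IdealSheafData}
    (h : ∀ x : X, ∃ (R : CommRingCat.{u}) (c : Spec R ⟶ X), IsOpenImmersion c ∧ x ∈ Set.range c ∧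
      pullIdeal I c ≤ pullIdeal J c) : I ≤ J := by
  choose R c hc hx hle using h
  refine Scheme.IdealSheafData.le_of_iSup_eq_top
    (fun x : X => ⟨(c x).opensRange, isAffineOpen_opensRange (c x)⟩)
    (eq_top_iff.mpr fun x _ => Opens.mem_iSup.mpr ⟨x, hx x⟩) fun x => ?_
  obtain ⟨φ, hφ⟩ := exists_iso_fromSpec (c x)
  have := hle x
  rw [pullIdeal_eq_map I _ _ _ hφ, pullIdeal_eq_map J _ _ _ hφ, map_iso_le_iff] at this
  exact this

theorem eq_of_pullIdeal_eq {I J : X.IdealSheafData}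
    (h : ∀ x : X, ∃ (R : CommRingCat.{u}) (c : Spec R ⟶ X), IsOpenImmersion c ∧ x ∈ Set.range c ∧
      pullIdeal I c = pullIdeal J c) : I = J :=
  le_antisymm
    (le_of_pullIdeal_le fun x => let ⟨R, c, hc, hx, e⟩ := h x; ⟨R, c, hc, hx, e.le⟩)
    (le_of_pullIdeal_le fun x => let ⟨R, c, hc, hx, e⟩ := h x; ⟨R, c, hc, hx, e.ge⟩)

/-- For an open immersion the extension of ideals is contraction along the inverse isomorphism,
hence commutes with intersection. -/
lemma pullIdeal_inf (I J : X.IdealSheafData) {R : CommRingCat.{u}} (c : Spec R ⟶ X)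
    [IsOpenImmersion c] : pullIdeal (I ⊓ J) c = pullIdeal I c ⊓ pullIdeal J c := by
  obtain ⟨φ, hφ⟩ := exists_iso_fromSpec c
  rw [pullIdeal_eq_map _ _ _ _ hφ, pullIdeal_eq_map _ _ _ _ hφ, pullIdeal_eq_map _ _ _ _ hφ]
  have h : ∀ K : Ideal Γ(X, c.opensRange), K.map φ.hom.hom = K.comap φ.inv.hom := fun K =>
    Ideal.map_comap_of_equiv (φ.commRingCatIsoToRingEquiv)
  rw [h, h, h]
  rfl

/-- A morphism from an affine scheme lifts to a closed subscheme if and only if the ideal of the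
subscheme pulls back to zero. -/
lemma exists_lift_iff (I : X.IdealSheafData) {R : CommRingCat.{u}} (f : Spec R ⟶ X) :
    (∃ g : Spec R ⟶ I.subscheme, g ≫ I.subschemeι = f) ↔ pullIdeal I f = ⊥ := by
  have h0 : pullIdeal (⊥ : (Spec R).IdealSheafData) (𝟙 _) = ⊥ := by
    rw [pullIdeal, Scheme.IdealSheafData.comap_id]
    exact (RingHom.ker_eq_comap_bot _).symm.trans
      ((RingHom.injective_iff_ker_eq_bot _).mp
        (ConcreteCategory.bijective_of_isIso (Scheme.ΓSpecIso R).inv).1)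
  have h1 : pullIdeal I f = ⊥ ↔ I ≤ f.ker := by
    rw [← Scheme.IdealSheafData.map_bot, Scheme.IdealSheafData.le_map_iff_comap_le,
      le_iff_pullIdeal_id_le, pullIdeal_comap, Category.id_comp, h0, le_bot_iff]
  rw [h1]
  constructor
  · rintro ⟨g, rfl⟩
    refine le_trans ?_ (Scheme.Hom.le_ker_comp _ _)
    rw [Scheme.IdealSheafData.ker_subschemeι]
  · intro h
    exact ⟨IsClosedImmersion.lift I.subschemeι f (by
      rw [Scheme.IdealSheafData.ker_subschemeι]; exact h), IsClosedImmersion.lift_fac _ _ _⟩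

lemma ker_specMap {R S : CommRingCat.{u}} (φ : R ⟶ S) :
    (Spec.map φ).ker = specIdeal (RingHom.ker φ.hom) := by
  have h0 : pullIdeal (⊥ : (Spec S).IdealSheafData) (𝟙 _) = ⊥ := by
    rw [pullIdeal, Scheme.IdealSheafData.comap_id]
    exact (RingHom.ker_eq_comap_bot _).symm.trans
      ((RingHom.injective_iff_ker_eq_bot _).mp
        (ConcreteCategory.bijective_of_isIso (Scheme.ΓSpecIso S).inv).1)
  have : pullIdeal (Spec.map φ).ker (𝟙 _) = pullIdeal (specIdeal (RingHom.ker φ.hom)) (𝟙 _) := by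
    rw [← Scheme.IdealSheafData.map_bot, pullIdeal_id_map, pullIdeal_specIdeal, h0]
    rfl
  exact le_antisymm (le_iff_pullIdeal_id_le.mpr this.le) (le_iff_pullIdeal_id_le.mpr this.ge)

/-- The chart of a closed subscheme induced by a chart of the ambient scheme. -/
lemma exists_subscheme_chart (I : X.IdealSheafData) {R : CommRingCat.{u}} (c : Spec R ⟶ X)
    [IsOpenImmersion c] :
    ∃ c' : Spec (CommRingCat.of (R ⧸ pullIdeal I c)) ⟶ I.subscheme, IsOpenImmersion c' ∧
      c' ≫ I.subschemeι = Spec.map (CommRingCat.ofHom (Ideal.Quotient.mk _)) ≫ c ∧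
      ∀ z, I.subschemeι z ∈ Set.range c → z ∈ Set.range c' := by
  obtain ⟨c', hc'⟩ := (exists_lift_iff I (Spec.map (CommRingCat.ofHom
    (Ideal.Quotient.mk (pullIdeal I c))) ≫ c)).mpr (by
      rw [pullIdeal_specMap_comp]; exact Ideal.map_quotient_self _)
  have hci : IsClosedImmersion (Spec.map (CommRingCat.ofHom
      (Ideal.Quotient.mk (pullIdeal I c)))) :=
    IsClosedImmersion.spec_of_surjective _ Ideal.Quotient.mk_surjective
  have hker : I.subschemeι.ker.comap c =
      (Spec.map (CommRingCat.ofHom (Ideal.Quotient.mk (pullIdeal I c)))).ker := by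
    have : pullIdeal (I.comap c) (𝟙 _) = pullIdeal (specIdeal (RingHom.ker (CommRingCat.ofHom
        (Ideal.Quotient.mk (pullIdeal I c))).hom)) (𝟙 _) := by
      rw [pullIdeal_specIdeal, pullIdeal_comap, Category.id_comp]
      exact Ideal.mk_ker.symm
    rw [Scheme.IdealSheafData.ker_subschemeι, ker_specMap]
    exact le_antisymm (le_iff_pullIdeal_id_le.mpr this.le) (le_iff_pullIdeal_id_le.mpr this.ge)
  -- Closed immersions with matching ideals form a cartesian square, so `c'` is an open immersion as
  -- a base change of `c`.
  have hp := isPullback_of_isClosedImmersion _ I.subschemeι c' c hc'.symm hker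
  refine ⟨c', MorphismProperty.of_isPullback (P := @IsOpenImmersion) hp inferInstance, hc', ?_⟩
  rintro z ⟨y, hy⟩
  obtain ⟨w, -, hw⟩ := Scheme.exists_preimage_of_isPullback hp y z hy
  exact ⟨w, hw⟩

end PullIdeal

/-! ### Frames of modules and their pullback -/

section Frames

variable {X : Scheme.{u}} (M : X.Modules)

/-- The sections `e i` of `M` over `U` form a basis over every open subset of `U`. -/
def IsFrame {n : ℕ} (U : X.Opens) (e : Fin n → Γ(M, U)) : Prop :=
  ∀ (V : X.Opens) (h : V ≤ U),
    Function.Bijective fun c : Fin n → Γ(X, V) => ∑ i, c i • resMod M h (e i)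

variable {M}

lemma IsFrame.restrict {n : ℕ} {U V : X.Opens} {e : Fin n → Γ(M, U)} (he : IsFrame M U e) (h : V ≤ U) :
    IsFrame M V fun i => resMod M h (e i) := by
  intro W hW
  simp only [resMod_resMod]
  exact he W (hW.trans h)

/-- The coordinate functionals form a two-sided inverse. They need not be compatible with
restriction; the two identities over each open set suffice. -/
lemma IsFrame.of_coord {n : ℕ} {U : X.Opens} {e : Fin n → Γ(M, U)}
    (θ : ∀ V : X.Opens, V ≤ U → Fin n → Γ(M, V) →ₗ[Γ(X, V)] Γ(X, V))
    (h₁ : ∀ V h k l, θ V h k (resMod M h (e l)) = if k = l then 1 else 0)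
    (h₂ : ∀ V h m, ∑ k, θ V h k m • resMod M h (e k) = m) : IsFrame M U e := by
  intro V h
  refine ⟨fun c d hcd => ?_, fun m => ⟨fun k => θ V h k m, h₂ V h m⟩⟩
  funext k
  simpa [map_sum, h₁] using congrArg (θ V h k) hcd

variable (M) in
lemma resMod_smul {U V : X.Opens} (h : V ≤ U) (r : Γ(X, U)) (m : Γ(M, U)) :
    resMod M h (r • m) = res X h r • resMod M h m := (resMod M h).map_smulₛₗ r m

/-- The generating sections identify the restriction of `M` to `U`, as a sheaf on the slice site,
with a free sheaf. Transporting the inclusions and projections of the summands gives the sections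
and the coordinate functionals, the sections being the images of `1`. -/
lemma exists_isFrame_over {n : ℕ} {U : X.Opens}
    (σ : SheafOfModules.GeneratingSections (SheafOfModules.over.{u} M U)) (hσ : IsIso σ.π)
    (ε : σ.I ≃ Fin n) : ∃ e : Fin n → Γ(M, U), IsFrame M U e := by
  classical
  let F : SheafOfModules.{u} (X.ringCatSheaf.over U) := SheafOfModules.free σ.I
  let O : SheafOfModules.{u} (X.ringCatSheaf.over U) := SheafOfModules.unit _
  let ι (k : σ.I) : O ⟶ F := SheafOfModules.ιFree k
  let p (k : σ.I) : F ⟶ O := Cofan.IsColimit.desc (SheafOfModules.isColimitFreeCofan σ.I)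
    (fun l => if k = l then 𝟙 O else 0)
  have hp (k l : σ.I) : ι l ≫ p k = if k = l then 𝟙 O else 0 :=
    Cofan.IsColimit.fac (SheafOfModules.isColimitFreeCofan σ.I) _ l
  have : Fintype σ.I := Fintype.ofEquiv _ ε.symm
  -- Morphisms out of a coproduct are compared on the summands.
  have hsum : ∑ k, p k ≫ ι k = 𝟙 F := by
    refine Cofan.IsColimit.hom_ext (SheafOfModules.isColimitFreeCofan σ.I) _ _ fun l => ?_
    change ι l ≫ _ = ι l ≫ _
    rw [Preadditive.comp_sum]
    simp only [← Category.assoc, hp]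
    simp [ite_comp]
  let θ (k : σ.I) : SheafOfModules.over.{u} M U ⟶ O := inv σ.π ≫ p k
  let τ (k : σ.I) : O ⟶ SheafOfModules.over.{u} M U := ι k ≫ σ.π
  have h₁ (k l : σ.I) : τ l ≫ θ k = if k = l then 𝟙 O else 0 := by
    simp [τ, θ, hp]
  have h₂ : ∑ k, θ k ≫ τ k = 𝟙 _ := by
    have : ∑ k, θ k ≫ τ k = inv σ.π ≫ (∑ k, p k ≫ ι k) ≫ σ.π := by
      simp [θ, τ, Preadditive.comp_sum, Preadditive.sum_comp]
    rw [this, hsum]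
    exact (congrArg (inv σ.π ≫ ·) (Category.id_comp _)).trans (IsIso.inv_hom_id _)
  have hτ (k : σ.I) : SheafOfModules.unitHomEquiv _ (τ k) = σ.s k := by
    change SheafOfModules.freeHomEquiv _ σ.π k = _
    rw [SheafOfModules.GeneratingSections.π, Equiv.apply_symm_apply]
  let ob (V : X.Opens) (h : V ≤ U) : (Over U)ᵒᵖ := .op (Over.mk (homOfLE h))
  let e (k : σ.I) : Γ(M, U) := (σ.s k).val (ob U le_rfl)
  have he (V : X.Opens) (h : V ≤ U) (k : σ.I) :
      resMod M h (e k) = ((τ k).val.app (ob V h)).hom (1 : Γ(X, V)) := by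
    have h3 : (σ.s k).val (ob V h) = ((τ k).val.app (ob V h)).hom (1 : Γ(X, V)) := by
      rw [← hτ]; rfl
    rw [← h3]
    exact (σ.s k).2 (Quiver.Hom.op (Over.homMk (homOfLE h) : (ob V h).unop ⟶ (ob U le_rfl).unop))
  let θ' (V : X.Opens) (h : V ≤ U) (k : Fin n) : Γ(M, V) →ₗ[Γ(X, V)] Γ(X, V) :=
    ((θ (ε.symm k)).val.app (ob V h)).hom
  refine ⟨fun k => e (ε.symm k), IsFrame.of_coord θ' (fun V h k l => ?_) fun V h m => ?_⟩
  · rw [he]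
    have h4 := congrArg (fun f => (f.val.app (ob V h)).hom (1 : Γ(X, V))) (h₁ (ε.symm k) (ε.symm l))
    refine Eq.trans h4 ?_
    simp only [EmbeddingLike.apply_eq_iff_eq]
    split_ifs <;> rfl
  · have h5 := congrArg (fun f => (f.val.app (ob V h)).hom m) h₂
    rw [← Equiv.sum_comp ε.symm] at h5
    refine Eq.trans ?_ h5
    let ev : (SheafOfModules.over.{u} M U ⟶ SheafOfModules.over.{u} M U) →+ Γ(M, V) :=
      { toFun := fun f => (f.val.app (ob V h)).hom m
        map_zero' := rfl
        map_add' := fun _ _ => rfl }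
    refine Eq.trans (Finset.sum_congr rfl fun k _ => ?_) (map_sum ev _ _).symm
    rw [he]
    let z : Γ(X, V) := θ' V h k m
    have h6 := ((τ (ε.symm k)).val.app (ob V h)).hom.map_smul z (1 : Γ(X, V))
    refine h6.symm.trans (congrArg ((τ (ε.symm k)).val.app (ob V h)).hom ?_)
    exact mul_one z

theorem exists_isFrame_of_isRankTwoBundle (E : X.Modules) [h : IsRankTwoBundle E] (x : X) :
    ∃ (U : X.Opens) (_ : x ∈ U) (e : Fin 2 → Γ(E, U)), IsFrame E U e := by
  obtain ⟨q, hq, hε⟩ := h.exists_data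
  obtain ⟨i, hi⟩ : ∃ i, x ∈ q.X i := by
    have := (Opens.coversTop_iff _ _).mp q.coversTop
    exact this.exists_mem x
  obtain ⟨ε⟩ := hε i
  obtain ⟨e, he⟩ := exists_isFrame_over (q.generators i) (hq.isIso i) ε
  exact ⟨q.X i, hi, e, he⟩

/-- Morphisms of sheaves of modules from compatible linear maps on sections. -/
def modHomMk {M N : X.Modules} (φ : ∀ U : X.Opens, Γ(M, U) →ₗ[Γ(X, U)] Γ(N, U))
    (hφ : ∀ (U V : X.Opens) (h : V ≤ U) (m : Γ(M, U)),
      φ V (resMod M h m) = resMod N h (φ U m)) : M ⟶ N where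
  val := PresheafOfModules.homMk
    { app := fun U => AddCommGrpCat.ofHom (φ U.unop).toAddMonoidHom
      naturality := fun U V h => by
        ext m
        exact hφ U.unop V.unop h.unop.le m }
    fun U r m => (φ U.unop).map_smul r m

lemma modHom_res {M N : X.Modules} (φ : M ⟶ N) {U V : X.Opens} (h : V ≤ U) (m : Γ(M, U)) :
    φ.app V (resMod M h m) = resMod N h (φ.app U m) :=
  congr($(φ.mapPresheaf.naturality (homOfLE h).op) m)

lemma resMod_ext {ι : Type*} {W : X.Opens} (U : ι → X.Opens) (hU : ∀ i, U i ≤ W)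
    (hW : W ≤ iSup U) (x y : Γ(M, W)) (h : ∀ i, resMod M (hU i) x = resMod M (hU i) y) : x = y :=
  TopCat.Sheaf.eq_of_locally_eq' ⟨M.presheaf, M.isSheaf⟩ U W (fun i => homOfLE (hU i)) hW x y h

lemma resMod_glue {ι : Type*} {W : X.Opens} (U : ι → X.Opens) (hU : ∀ i, U i ≤ W)
    (hW : W ≤ iSup U) (x : ∀ i, Γ(M, U i))
    (h : ∀ i j, resMod M (inf_le_left : U i ⊓ U j ≤ _) (x i) =
      resMod M (inf_le_right : U i ⊓ U j ≤ _) (x j)) :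
    ∃ y : Γ(M, W), ∀ i, resMod M (hU i) y = x i :=
  (TopCat.Sheaf.existsUnique_gluing' ⟨M.presheaf, M.isSheaf⟩ U W
    (fun i => homOfLE (hU i)) hW x fun i j => h i j).exists

/-- The presheaf `W ↦ Γ(M, W ⊓ V)`. -/
def shiftPresheaf (M : X.Modules) (V : X.Opens) : TopCat.Presheaf Ab.{u} X where
  obj W := Γ(M, W.unop ⊓ V)
  map h := M.presheaf.map (homOfLE (inf_le_inf h.unop.le le_rfl)).op
  map_id _ := M.presheaf.map_id _
  map_comp h h' := M.presheaf.map_comp (homOfLE (inf_le_inf h.unop.le le_rfl)).op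
    (homOfLE (inf_le_inf h'.unop.le le_rfl)).op

lemma isSheaf_shiftPresheaf (M : X.Modules) (V : X.Opens) : (shiftPresheaf M V).IsSheaf := by
  rw [TopCat.Presheaf.isSheaf_iff_isSheafUniqueGluing]
  intro ι U sf hsf
  let s : ∀ a, Γ(M, U a ⊓ V) := sf
  have hs : ∀ a b, resMod M (inf_le_inf inf_le_left le_rfl : (U a ⊓ U b) ⊓ V ≤ _) (s a) =
    resMod M (inf_le_inf inf_le_right le_rfl : (U a ⊓ U b) ⊓ V ≤ _) (s b) := hsf
  have hcov : iSup U ⊓ V ≤ ⨆ a, (U a ⊓ V) := by rw [iSup_inf_eq]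
  have hle : ∀ a, U a ⊓ V ≤ iSup U ⊓ V := fun a => inf_le_inf (le_iSup U a) le_rfl
  obtain ⟨y, hy⟩ := resMod_glue (M := M) _ hle hcov s fun a b => by
    have := congrArg (resMod M (le_inf (inf_le_inf inf_le_left inf_le_left)
      (inf_le_left.trans inf_le_right) : (U a ⊓ V) ⊓ (U b ⊓ V) ≤ (U a ⊓ U b) ⊓ V)) (hs a b)
    rwa [resMod_resMod, resMod_resMod] at this
  refine ⟨y, hy, fun Z hZ => ?_⟩
  exact resMod_ext (M := M) _ hle hcov _ _ fun a => (hZ a).trans (hy a).symm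

/-- The sheaf of modules `W ↦ Γ(M, W ⊓ V)`, the direct image of the restriction of `M` to `V`. -/
def shift (M : X.Modules) (V : X.Opens) : X.Modules where
  val :=
    letI (W : X.Opensᵒᵖ) : Module (X.ringCatSheaf.obj.obj W) ((shiftPresheaf M V).obj W) :=
      Module.compHom Γ(M, W.unop ⊓ V) (res X (inf_le_left : W.unop ⊓ V ≤ W.unop))
    PresheafOfModules.ofPresheaf (shiftPresheaf M V) fun {W W'} h r m => by
      refine (resMod_smul M (inf_le_inf h.unop.le le_rfl) _ m).trans ?_
      refine congrArg (· • _) ?_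
      exact (res_res _ _ _).trans (res_res h.unop.le inf_le_left r).symm
  isSheaf := isSheaf_shiftPresheaf M V

/-- The structure sheaf as a module over itself. -/
def structureModule (X : Scheme.{u}) : X.Modules := SheafOfModules.unit X.ringCatSheaf

/-- The linear bijection from coordinate vectors to sections given by a frame. -/
def IsFrame.equiv {n : ℕ} {U V : X.Opens} {e : Fin n → Γ(M, U)} (he : IsFrame M U e) (h : V ≤ U) :
    (Fin n → Γ(X, V)) ≃ₗ[Γ(X, V)] Γ(M, V) :=
  LinearEquiv.ofBijective
    { toFun := fun c => ∑ i, c i • resMod M h (e i)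
      map_add' := fun c d => by simp [add_smul, Finset.sum_add_distrib]
      map_smul' := fun r c => by simp [mul_smul, Finset.smul_sum] } (he V h)

/-- The coordinates of a section with respect to a frame. -/
def IsFrame.coord {n : ℕ} {U V : X.Opens} {e : Fin n → Γ(M, U)} (he : IsFrame M U e) (h : V ≤ U)
    (k : Fin n) : Γ(M, V) →ₗ[Γ(X, V)] Γ(X, V) :=
  LinearMap.proj k ∘ₗ (he.equiv h).symm.toLinearMap

lemma IsFrame.sum_coord {n : ℕ} {U V : X.Opens} {e : Fin n → Γ(M, U)} (he : IsFrame M U e)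
    (h : V ≤ U) (m : Γ(M, V)) : ∑ k, he.coord h k m • resMod M h (e k) = m :=
  (he.equiv h).apply_symm_apply m

lemma IsFrame.coord_sum {n : ℕ} {U V : X.Opens} {e : Fin n → Γ(M, U)} (he : IsFrame M U e)
    (h : V ≤ U) (c : Fin n → Γ(X, V)) (k : Fin n) :
    he.coord h k (∑ i, c i • resMod M h (e i)) = c k :=
  congrFun ((he.equiv h).symm_apply_apply c) k

lemma IsFrame.coord_apply {n : ℕ} {U V : X.Opens} {e : Fin n → Γ(M, U)} (he : IsFrame M U e)
    (h : V ≤ U) (k l : Fin n) :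
    he.coord h k (resMod M h (e l)) = if k = l then 1 else 0 := by
  have := he.coord_sum h (fun i => if i = l then 1 else 0) k
  simpa using this

lemma IsFrame.coord_res {n : ℕ} {U V W : X.Opens} {e : Fin n → Γ(M, U)} (he : IsFrame M U e)
    (h : V ≤ U) (h' : W ≤ V) (m : Γ(M, V)) (k : Fin n) :
    he.coord (h'.trans h) k (resMod M h' m) = res X h' (he.coord h k m) := by
  conv_lhs => rw [← he.sum_coord h m]
  rw [map_sum]
  simp only [resMod_smul, resMod_resMod]
  exact he.coord_sum (h'.trans h) (fun i => res X h' (he.coord h i m)) k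

section Pullback

variable {Y : Scheme.{u}} (j : Y ⟶ X) (E : X.Modules)

/-- The pullback of sections. -/
def pullbackMap (U : X.Opens) :
    Γ(E, U) →ₛₗ[(j.app U).hom] Γ((Scheme.Modules.pullback j).obj E, j ⁻¹ᵁ U) where
  toFun m := ((Scheme.Modules.pullbackPushforwardAdjunction j).unit.app E).app U m
  map_add' := map_add _
  map_smul' r m := ((Scheme.Modules.pullbackPushforwardAdjunction j).unit.app E).app_smul r m

lemma pullbackMap_res {U V : X.Opens} (h : V ≤ U) (m : Γ(E, U)) :
    pullbackMap j E V (resMod E h m) = resMod _ (j.preimage_mono h) (pullbackMap j E U m) :=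
  modHom_res ((Scheme.Modules.pullbackPushforwardAdjunction j).unit.app E) h m

lemma app_res {U V : X.Opens} (h : V ≤ U) (r : Γ(X, U)) :
    j.app V (res X h r) = res Y (j.preimage_mono h) (j.app U r) :=
  congr($(j.naturality (homOfLE h).op) r)

variable {E}

lemma pullback_hom_ext {N : Y.Modules} {φ ψ : (Scheme.Modules.pullback j).obj E ⟶ N}
    (h : ∀ (U : X.Opens) (m : Γ(E, U)),
      φ.app _ (pullbackMap j E U m) = ψ.app _ (pullbackMap j E U m)) : φ = ψ := by
  apply ((Scheme.Modules.pullbackPushforwardAdjunction j).homEquiv _ _).injective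
  rw [Adjunction.homEquiv_unit, Adjunction.homEquiv_unit]
  ext U m
  exact h U m

lemma exists_pullback_hom {N : Y.Modules} (φ : E ⟶ (Scheme.Modules.pushforward j).obj N) :
    ∃ ψ : (Scheme.Modules.pullback j).obj E ⟶ N, ∀ (U : X.Opens) (m : Γ(E, U)),
      ψ.app _ (pullbackMap j E U m) = (show Γ(N, j ⁻¹ᵁ U) from φ.app U m) := by
  refine ⟨((Scheme.Modules.pullbackPushforwardAdjunction j).homEquiv _ _).symm φ, fun U m => ?_⟩
  have h := ((Scheme.Modules.pullbackPushforwardAdjunction j).homEquiv _ _).apply_symm_apply φ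
  rw [Adjunction.homEquiv_unit] at h
  exact congrArg (fun f => f.app U m) h

/-- The sections of a pullback have no explicit description, so only its adjunction is used.
Coordinates exist only over `U`; composed with pullback of functions they form morphisms from `E` to
the direct image of `shift O V`, and adjunction turns these into coordinate functionals on the
pullback. -/
theorem IsFrame.pullback {n : ℕ} {U : X.Opens} {e : Fin n → Γ(E, U)} (he : IsFrame E U e) :
    IsFrame ((Scheme.Modules.pullback j).obj E) (j ⁻¹ᵁ U) fun k => pullbackMap j E U (e k) := by
  let V := j ⁻¹ᵁ U
  let P := (Scheme.Modules.pullback j).obj E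
  let O := structureModule Y
  let ψ (k : Fin n) : E ⟶ (Scheme.Modules.pushforward j).obj (shift O V) :=
    modHomMk (fun W =>
      { toFun := fun m => show Γ(Y, j ⁻¹ᵁ W ⊓ V) from
          j.app (W ⊓ U) (he.coord inf_le_right k (resMod E inf_le_left m))
        map_add' := fun m m' => by rw [map_add, map_add, map_add]; rfl
        map_smul' := fun r m => by
          rw [resMod_smul, map_smul, smul_eq_mul, map_mul, app_res]; rfl })
      fun W W' h m => by
        change j.app (W' ⊓ U) _ = res Y (j.preimage_mono (inf_le_inf h le_rfl : W' ⊓ U ≤ W ⊓ U))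
          (j.app (W ⊓ U) _)
        refine Eq.trans ?_ (app_res j (inf_le_inf h le_rfl : W' ⊓ U ≤ W ⊓ U) _)
        rw [← he.coord_res, resMod_resMod, resMod_resMod]
  choose θ hθ using fun k => exists_pullback_hom j (ψ k)
  let ρ : P ⟶ shift P V := modHomMk (fun W =>
      { toFun := fun m => show Γ(P, W ⊓ V) from resMod P inf_le_left m
        map_add' := fun m m' => map_add _ _ _
        map_smul' := fun r m => resMod_smul _ _ _ _ })
      fun W W' h m => by
        change resMod P _ _ = resMod P _ (resMod P _ _)
        rw [resMod_resMod, resMod_resMod]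
  let t (k : Fin n) (W : Y.Opens) : Γ(P, W) → Γ(Y, W ⊓ V) := fun m => (θ k).app W m
  have t_add k W m m' : t k W (m + m') = t k W m + t k W m' := map_add ((θ k).app W).hom m m'
  have t_smul k W (r : Γ(Y, W)) m : t k W (r • m) = res Y inf_le_left r * t k W m :=
    (θ k).app_smul r m
  have t_res k W W' (h : W' ≤ W) m :
      t k W' (resMod P h m) = res Y (inf_le_inf h le_rfl) (t k W m) := modHom_res (θ k) h m
  have t_pull k (W : X.Opens) m : t k (j ⁻¹ᵁ W) (pullbackMap j E W m) =
      j.app (W ⊓ U) (he.coord inf_le_right k (resMod E inf_le_left m)) := hθ k W m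
  let e' (k : Fin n) : Γ(P, V) := pullbackMap j E U (e k)
  let ρ' : P ⟶ shift P V := modHomMk (fun W =>
      { toFun := fun m => show Γ(P, W ⊓ V) from ∑ k, t k W m •
          resMod P (inf_le_right : W ⊓ V ≤ V) (e' k)
        map_add' := fun m m' => by
          simp only [t_add, add_smul, Finset.sum_add_distrib]; rfl
        map_smul' := fun r m => by
          simp only [t_smul, mul_smul, ← Finset.smul_sum]; rfl })
      fun W W' h m => by
        change ∑ k, t k W' _ • _ = resMod P (inf_le_inf h le_rfl : W' ⊓ V ≤ W ⊓ V)
          (∑ k, t k W m • resMod P (inf_le_right : W ⊓ V ≤ V) (e' k))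
        rw [map_sum]
        refine Finset.sum_congr rfl fun k _ => ?_
        rw [t_res, resMod_smul, resMod_resMod]
  -- `ρ` is restriction to `V`, while `ρ'` rebuilds a section from its coordinates. They agree on
  -- pulled back sections, and such sections determine a morphism out of the pullback.
  have hρ : ρ = ρ' := pullback_hom_ext j fun W m => by
    change resMod P (inf_le_left : j ⁻¹ᵁ W ⊓ V ≤ _) _ = ∑ k, t k _ _ • _
    refine (pullbackMap_res j E (inf_le_left : W ⊓ U ≤ W) m).symm.trans ?_
    conv_lhs => rw [← he.sum_coord inf_le_right (resMod E (inf_le_left : W ⊓ U ≤ W) m), map_sum]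
    refine Finset.sum_congr rfl fun k _ => ?_
    rw [t_pull]
    refine ((pullbackMap j E (W ⊓ U)).map_smulₛₗ _ _).trans ?_
    refine congrArg _ ?_
    exact pullbackMap_res j E _ _
  let c (W : Y.Opens) (h : W ≤ V) (k : Fin n) : Γ(P, W) →ₗ[Γ(Y, W)] Γ(Y, W) :=
    { toFun := fun m => res Y (le_inf le_rfl h) (t k W m)
      map_add' := fun m m' => by rw [t_add, map_add]
      map_smul' := fun r m => by rw [t_smul, map_mul, res_res, res_self]; rfl }
  refine IsFrame.of_coord c (fun W h k l => ?_) fun W h m => ?_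
  · change res Y _ (t k W (resMod P h (e' l))) = _
    rw [t_res, t_pull]
    refine (congrArg _ (congrArg _ (congrArg _ (he.coord_apply _ k l)))).trans ?_
    split_ifs
    · exact (congrArg _ (congrArg _ (map_one _))).trans ((congrArg _ (map_one _)).trans (map_one _))
    · exact (congrArg _ (congrArg _ (map_zero _))).trans
        ((congrArg _ (map_zero _)).trans (map_zero _))
  · have := congrArg (fun f => resMod P (le_inf le_rfl h : W ≤ W ⊓ V) (f.app W m)) hρ
    change resMod P (le_inf le_rfl h : W ≤ W ⊓ V) (resMod P (inf_le_left : W ⊓ V ≤ W) m) =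
      resMod P (le_inf le_rfl h : W ≤ W ⊓ V)
        (∑ k, t k W m • resMod P (inf_le_right : W ⊓ V ≤ V) (e' k)) at this
    rw [resMod_resMod, resMod_self, map_sum] at this
    refine Eq.trans (Finset.sum_congr rfl fun k _ => ?_) this.symm
    rw [resMod_smul, resMod_resMod]
    rfl

end Pullback

end Frames

/-! ### The zero ideal of a section in a frame -/

section ZeroIdeal

variable {X : Scheme.{u}} {M : X.Modules}

lemma IsFrame.mem_smul_top_iff {n : ℕ} {U V : X.Opens} {e : Fin n → Γ(M, U)} (he : IsFrame M U e)
    (h : V ≤ U) (K : Ideal Γ(X, V)) (m : Γ(M, V)) :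
    m ∈ K • (⊤ : Submodule Γ(X, V) Γ(M, V)) ↔ ∀ k, he.coord h k m ∈ K := by
  constructor
  · intro hm k
    induction hm using Submodule.smul_induction_on' with
    | smul r hr m hm => rw [map_smul, smul_eq_mul]; exact K.mul_mem_right _ hr
    | add x hx y hy ihx ihy => rw [map_add]; exact add_mem ihx ihy
  · intro hm
    rw [← he.sum_coord h m]
    exact sum_mem fun k _ => Submodule.smul_mem_smul (hm k) trivial

variable (M) in
/-- The smallest ideal `K` with `m ∈ K Γ(M, U)`. -/
def contentIdeal {U : X.Opens} (m : Γ(M, U)) : Ideal Γ(X, U) :=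
  sInf {K | m ∈ K • (⊤ : Submodule Γ(X, U) Γ(M, U))}

lemma IsFrame.contentIdeal_eq {n : ℕ} {U V : X.Opens} {e : Fin n → Γ(M, U)} (he : IsFrame M U e)
    (h : V ≤ U) (m : Γ(M, V)) :
    contentIdeal M m = Ideal.span (Set.range fun k => he.coord h k m) := by
  refine le_antisymm (sInf_le ?_) (le_sInf fun K hK => ?_)
  · exact (he.mem_smul_top_iff h _ _).mpr fun k => Ideal.subset_span ⟨k, rfl⟩
  · rw [Ideal.span_le]
    rintro _ ⟨k, rfl⟩
    exact (he.mem_smul_top_iff h _ _).mp hK k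

lemma IsFrame.mem_contentIdeal_smul_top {n : ℕ} {U V : X.Opens} {e : Fin n → Γ(M, U)}
    (he : IsFrame M U e) (h : V ≤ U) (m : Γ(M, V)) :
    m ∈ contentIdeal M m • (⊤ : Submodule Γ(X, V) Γ(M, V)) := by
  rw [he.contentIdeal_eq h, he.mem_smul_top_iff h]
  exact fun k => Ideal.subset_span ⟨k, rfl⟩

/-- By quasi-coherence sections over `D(f)` extend after multiplication by a power of `f`, and
sections vanishing on `D(f)` are killed by one. Applied to an expression of `m` by elements of `K`,
this clears the denominators. -/
lemma exists_pow_smul_mem [M.IsQuasicoherent] {U : X.Opens} (hU : IsAffineOpen U) (f : Γ(X, U))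
    (K : Ideal Γ(X, U)) (m : Γ(M, U))
    (hm : resMod M (X.basicOpen_le f) m ∈
      (K.map (res X (X.basicOpen_le f))) • (⊤ : Submodule Γ(X, X.basicOpen f) Γ(M, X.basicOpen f))) :
    ∃ n : ℕ, f ^ n • m ∈ K • (⊤ : Submodule Γ(X, U) Γ(M, U)) := by
  have hqc := qc_basicOpen M hU f (X.basicOpen f) rfl (X.basicOpen_le f)
  have key : ∀ z ∈ (K.map (res X (X.basicOpen_le f))) • (⊤ : Submodule Γ(X, X.basicOpen f) Γ(M, X.basicOpen f)),
      ∃ (n : ℕ) (y : Γ(M, U)), y ∈ K • (⊤ : Submodule Γ(X, U) Γ(M, U)) ∧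
        res X (X.basicOpen_le f) f ^ n • z = resMod M (X.basicOpen_le f) y := by
    intro z hz
    induction hz using Submodule.smul_induction_on' with
    | smul r hr z _ =>
      obtain ⟨n, a, ha, h⟩ := (mem_map_res_iff hU f K r).mp hr
      obtain ⟨l, t, ht⟩ := hqc.1 z
      refine ⟨n + l, a • t, Submodule.smul_mem_smul ha trivial, ?_⟩
      rw [resMod_smul, ← h, map_pow]
      refine Eq.trans ?_ (congrArg _ ht)
      rw [pow_add, mul_smul, mul_smul, smul_comm r]
      rfl
    | add x _ y _ ihx ihy =>
      obtain ⟨n, a, ha, h⟩ := ihx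
      obtain ⟨l, b, hb, h'⟩ := ihy
      refine ⟨n + l, f ^ l • a + f ^ n • b, add_mem (Submodule.smul_mem _ _ ha)
        (Submodule.smul_mem _ _ hb), ?_⟩
      rw [map_add, resMod_smul, resMod_smul, ← h, ← h', map_pow, map_pow, smul_add, ← mul_smul,
        ← mul_smul, ← pow_add, ← pow_add, add_comm l n]
  obtain ⟨n, y, hy, h⟩ := key _ hm
  have h0 : resMod M (X.basicOpen_le f) (f ^ n • m - y) = 0 := by
    rw [map_sub, resMod_smul, map_pow, h, sub_self]
  obtain ⟨l, hl⟩ := hqc.2 _ h0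
  rw [smul_sub, sub_eq_zero] at hl
  refine ⟨l + n, ?_⟩
  rw [pow_add, mul_smul, hl]
  exact Submodule.smul_mem _ _ hy

/-- On an affine open with a frame, the zero ideal of a section is generated by its
coordinates. -/
theorem zeroIdeal_ideal [M.IsQuasicoherent]
    (hM : ∀ x : X, ∃ (n : ℕ) (U : X.Opens) (_ : x ∈ U) (e : Fin n → Γ(M, U)), IsFrame M U e)
    (s : Γ(M, ⊤)) (U : X.affineOpens) {n : ℕ} {e : Fin n → Γ(M, U.1)} (he : IsFrame M U.1 e) :
    (zeroIdeal M s).ideal U =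
      Ideal.span (Set.range fun k => he.coord le_rfl k (resMod M le_top s)) := by
  let N : Set X.affineOpens := {U | ∃ (n : ℕ) (e : Fin n → Γ(M, U.1)), IsFrame M U.1 e}
  have hcov : ∀ x, ∃ U ∈ N, x ∈ U.1 := by
    intro x
    obtain ⟨n, U, hx, e, he⟩ := hM x
    obtain ⟨V, hV, hxV, hVU⟩ := exists_isAffineOpen_mem_and_subset hx
    exact ⟨⟨V, hV⟩, ⟨n, _, he.restrict hVU⟩, hxV⟩
  have hN : ∀ U ∈ N, ∀ f : Γ(X, U.1), X.affineBasicOpen f ∈ N := by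
    rintro U ⟨n, e, he⟩ f
    exact ⟨n, _, he.restrict (X.basicOpen_le f)⟩
  -- An infimum of ideal sheaves is not visible on an affine open. Instead, an explicit ideal sheaf
  -- `Z` is glued from the ideals of coordinates and shown to be the smallest member of the defining
  -- family.
  obtain ⟨Z, hZ⟩ := exists_idealSheafData N
    (fun U => contentIdeal M (resMod M (le_top : U.1 ≤ ⊤) s)) hcov hN (by
      rintro U ⟨n, e, he⟩ f
      rw [he.contentIdeal_eq le_rfl, Ideal.map_span, ← Set.range_comp]
      refine Eq.trans ?_ (he.contentIdeal_eq (X.basicOpen_le f) _).symm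
      congr 2
      funext k
      refine (he.coord_res le_rfl (X.basicOpen_le f) _ k).symm.trans ?_
      rw [resMod_resMod]
      rfl)
  have hmem : Z ∈ {I : X.IdealSheafData | ∀ U : X.affineOpens,
      resMod M (le_top : U.1 ≤ ⊤) s ∈ I.ideal U • (⊤ : Submodule Γ(X, U.1) Γ(M, U.1))} := by
    intro U
    have hloc : ∀ x : U.1, ∃ f : Γ(X, U.1), x.1 ∈ X.basicOpen f ∧ ∃ n : ℕ,
        f ^ n • resMod M (le_top : U.1 ≤ ⊤) s ∈ Z.ideal U • (⊤ : Submodule Γ(X, U.1) Γ(M, U.1)) := by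
      intro x
      obtain ⟨V, hV, hxV⟩ := hcov x
      obtain ⟨f, g, e, hf⟩ := exists_basicOpen_le_affine_inter U.2 V.2 x ⟨x.2, hxV⟩
      have hW : X.affineBasicOpen f ∈ N := by
        have e' : X.affineBasicOpen f = X.affineBasicOpen g := Subtype.ext e
        rw [e']
        exact hN _ hV g
      refine ⟨f, hf, exists_pow_smul_mem U.2 f _ _ ?_⟩
      have h1 : (Z.ideal U).map (res X (X.basicOpen_le f)) = Z.ideal (X.affineBasicOpen f) :=
        Z.map_ideal_basicOpen U f
      rw [h1, hZ _ hW, resMod_resMod]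
      obtain ⟨n, e, he⟩ := hW
      exact he.mem_contentIdeal_smul_top le_rfl _
    choose f hxf n hn using hloc
    -- The defining condition must hold on every affine open, also without a frame. The multipliers
    -- `r` with `r s ∈ Z M` form an ideal `J` that contains powers of functions generating the unit
    -- ideal.
    let J : Ideal Γ(X, U.1) := (Z.ideal U • (⊤ : Submodule Γ(X, U.1) Γ(M, U.1))).comap
      (LinearMap.toSpanSingleton _ _ (resMod M (le_top : U.1 ≤ ⊤) s))
    have hJ : ∀ x, f x ^ n x ∈ J := hn
    suffices h : J = ⊤ by
      have : (1 : Γ(X, U.1)) ∈ J := h ▸ trivial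
      simpa [J] using this
    have h1 : Ideal.span (Set.range f) = ⊤ := by
      refine (IsAffineOpen.self_le_iSup_basicOpen_iff (U := U.1) U.2).mp fun x hx => ?_
      exact Opens.mem_iSup.mpr ⟨⟨_, ⟨x, hx⟩, rfl⟩, hxf ⟨x, hx⟩⟩
    have h2 : J.radical = ⊤ := by
      rw [eq_top_iff, ← h1, Ideal.span_le]
      rintro _ ⟨x, rfl⟩
      exact ⟨n x, hJ x⟩
    exact Ideal.radical_eq_top.mp h2
  -- Minimality of `Z` need only be checked on the affine opens with a frame, which cover `X`.
  have : zeroIdeal M s = Z := by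
    refine le_antisymm (sInf_le hmem) (le_sInf fun I hI => ?_)
    refine Scheme.IdealSheafData.le_of_iSup_eq_top (fun U : N => U.1) ?_ ?_
    · rw [eq_top_iff]
      intro x _
      obtain ⟨U, hU, hx⟩ := hcov x
      exact Opens.mem_iSup.mpr ⟨⟨U, hU⟩, hx⟩
    · rintro ⟨U, hU⟩
      change Z.ideal U ≤ _
      rw [hZ U hU]
      exact sInf_le (hI U)
  rw [this, hZ U ⟨n, e, he⟩]
  exact he.contentIdeal_eq le_rfl _

end ZeroIdeal

/-! ### The coordinate ring of a standard affine line -/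

section CoordinateRing

open Polynomial

variable {R M : Type u} [CommRing R] [AddCommGroup M] [Module R M]

/-- The structure map of the degree zero part of the localization of the symmetric algebra. -/
def scalarHom (t : SymmetricAlgebra R M) : R →+* Away (symPow R M) t :=
  (fromZeroRingHom (symPow R M) (.powers t)).comp (algebraMap R (symPow R M 0))

lemma val_scalarHom (t : SymmetricAlgebra R M) (r : R) :
    (scalarHom t r).val = algebraMap _ (Localization.Away t) (algebraMap R (SymmetricAlgebra R M) r) :=
  Localization.mk_one_eq_algebraMap _

/-- The map from the polynomial ring in one variable to the degree zero part of the localization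
at `t` that sends the variable to `f / t`. -/
def fracHom {t f : SymmetricAlgebra R M} (ht : t ∈ symPow R M 1) (hf : f ∈ symPow R M 1) :
    R[X] →+* Away (symPow R M) t :=
  eval₂RingHom (scalarHom t) (Away.mk _ ht 1 f (by simpa using hf))

lemma fracHom_C {t f : SymmetricAlgebra R M} (ht : t ∈ symPow R M 1) (hf : f ∈ symPow R M 1)
    (r : R) : fracHom ht hf (C r) = scalarHom t r := by
  simp [fracHom]

lemma fracHom_X {t f : SymmetricAlgebra R M} (ht : t ∈ symPow R M 1) (hf : f ∈ symPow R M 1) :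
    fracHom ht hf X = Away.mk _ ht 1 f (by simpa using hf) := by
  simp [fracHom]

lemma fracHom_comp_C {t f : SymmetricAlgebra R M} (ht : t ∈ symPow R M 1) (hf : f ∈ symPow R M 1) :
    (fracHom ht hf).comp C = scalarHom t :=
  RingHom.ext (fracHom_C ht hf)

/-- This is the source of the linear equation: on the locus where `e` generates, `m / e = a + b (f /
e)`. -/
lemma fracHom_C_add_C_mul_X {e f m : M} (a b : R) (h : m = a • e + b • f) :
    fracHom (ι_mem_symPow R M e) (ι_mem_symPow R M f) (C a + C b * X) =
      Away.mk _ (ι_mem_symPow R M e) 1 (SymmetricAlgebra.ι R M m)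
        (by simpa using ι_mem_symPow R M m) := by
  rw [map_add, map_mul, fracHom_C, fracHom_C, fracHom_X]
  ext
  rw [val_add, val_mul, val_scalarHom, val_scalarHom, Away.val_mk, Away.val_mk, h,
    ← Localization.mk_one_eq_algebraMap, ← Localization.mk_one_eq_algebraMap, Localization.mk_mul,
    Localization.add_mk, Localization.mk_eq_mk_iff, Localization.r_iff_exists]
  refine ⟨1, ?_⟩
  simp [Algebra.smul_def]
  ring

/-- An element of degree `n + 1` is a sum of products of an element of degree one, giving a linear
polynomial, and an element of degree `n`. -/
lemma fracHom_surjective (b : Module.Basis (Fin 2) R M) :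
    Function.Surjective (fracHom (ι_mem_symPow R M (b 0)) (ι_mem_symPow R M (b 1))) := by
  have ht := ι_mem_symPow R M (b 0)
  have key : ∀ (n : ℕ) (a : SymmetricAlgebra R M) (ha : a ∈ symPow R M n), ∃ p : R[X],
      fracHom (ι_mem_symPow R M (b 0)) (ι_mem_symPow R M (b 1)) p =
        Away.mk _ ht n a (by simpa using ha) := by
    intro n a ha
    induction ha using Submodule.pow_induction_on_left' with
    | algebraMap r =>
      refine ⟨C r, ?_⟩
      rw [fracHom_C]
      ext
      rw [val_scalarHom, Away.val_mk, ← Localization.mk_one_eq_algebraMap]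
      congr 1
      ext
      simp
    | add x y i hx hy ihx ihy =>
      obtain ⟨p, hp⟩ := ihx
      obtain ⟨q, hq⟩ := ihy
      refine ⟨p + q, ?_⟩
      rw [map_add, hp, hq]
      ext
      rw [val_add, Away.val_mk, Away.val_mk, Away.val_mk, Localization.add_mk_self]
    | mem_mul m hm i x hx ih =>
      obtain ⟨m, rfl⟩ := hm
      obtain ⟨p, hp⟩ := ih
      have h := fracHom_C_add_C_mul_X (e := b 0) (f := b 1) (m := m) (b.repr m 0) (b.repr m 1)
        (by rw [← Fin.sum_univ_two (fun i => b.repr m i • b i), b.sum_repr])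
      refine ⟨(C (b.repr m 0) + C (b.repr m 1) * X) * p, ?_⟩
      rw [map_mul, hp, h]
      ext
      rw [val_mul, Away.val_mk, Away.val_mk, Away.val_mk, Localization.mk_mul]
      congr 1
      ext
      simp [pow_succ']
  intro z
  obtain ⟨n, a, ha, rfl⟩ := Away.mk_surjective _ ht z
  exact key n a (by simpa using ha)

/-- Dehomogenization `b 0 ↦ 1`, `b 1 ↦ X` extends to the localization at `b 0` and gives a left
inverse. -/
lemma fracHom_injective (b : Module.Basis (Fin 2) R M) :
    Function.Injective (fracHom (ι_mem_symPow R M (b 0)) (ι_mem_symPow R M (b 1))) := by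
  let ψ : SymmetricAlgebra R M →ₐ[R] R[X] := SymmetricAlgebra.lift (b.constr R ![1, X])
  have h0 : ψ (SymmetricAlgebra.ι R M (b 0)) = 1 := by simp [ψ]
  have h1 : ψ (SymmetricAlgebra.ι R M (b 1)) = X := by simp [ψ]
  let L := Localization.Away (SymmetricAlgebra.ι R M (b 0))
  have hu : IsUnit (ψ.toRingHom (SymmetricAlgebra.ι R M (b 0))) := by
    change IsUnit (ψ _)
    rw [h0]; exact isUnit_one
  let lft : L →+* R[X] := IsLocalization.Away.lift (SymmetricAlgebra.ι R M (b 0)) hu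
  have hl (a) : lft (algebraMap _ L a) = ψ a := IsLocalization.Away.lift_eq _ hu a
  let d : Away (symPow R M) (SymmetricAlgebra.ι R M (b 0)) →+* R[X] :=
    lft.comp (algebraMap _ L)
  have hd : d.comp (fracHom (ι_mem_symPow R M (b 0)) (ι_mem_symPow R M (b 1))) = RingHom.id _ := by
    refine Polynomial.ringHom_ext (fun r => ?_) ?_
    · rw [RingHom.comp_apply, fracHom_C]
      change lft (scalarHom _ r).val = _
      rw [val_scalarHom, hl, AlgHom.commutes]
      rfl
    · rw [RingHom.comp_apply, fracHom_X]
      have h2 : (Away.mk (symPow R M) (ι_mem_symPow R M (b 0)) 1 (SymmetricAlgebra.ι R M (b 1))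
          (by simpa using ι_mem_symPow R M (b 1))).val *
          algebraMap _ L (SymmetricAlgebra.ι R M (b 0)) =
          algebraMap _ L (SymmetricAlgebra.ι R M (b 1)) := by
        rw [Away.val_mk, ← Localization.mk_one_eq_algebraMap, ← Localization.mk_one_eq_algebraMap,
          Localization.mk_mul, Localization.mk_eq_mk_iff, Localization.r_iff_exists]
        refine ⟨1, ?_⟩
        simp
        ring
      have h3 := congrArg lft h2
      rw [map_mul, hl, hl, h0, h1, mul_one] at h3
      exact h3
  exact Function.LeftInverse.injective (g := d) fun p => RingHom.congr_fun hd p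

lemma fracHom_bijective (b : Module.Basis (Fin 2) R M) :
    Function.Bijective (fracHom (ι_mem_symPow R M (b 0)) (ι_mem_symPow R M (b 1))) :=
  ⟨fracHom_injective b, fracHom_surjective b⟩

variable {R' M' : Type u} [CommRing R'] [AddCommGroup M'] [Module R' M']

lemma awayMap_fracHom (φ : R →+* R') (g : M →ₛₗ[φ] M') {t f : SymmetricAlgebra R M}
    (ht : t ∈ symPow R M 1) (hf : f ∈ symPow R M 1) (p : R[X]) :
    Away.map (symGradedMap φ g) t (fracHom ht hf p) =
      fracHom ((symGradedMap φ g).map_mem ht) ((symGradedMap φ g).map_mem hf) (p.map φ) := by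
  have : (Away.map (symGradedMap φ g) t).comp (fracHom ht hf) =
      (fracHom ((symGradedMap φ g).map_mem ht) ((symGradedMap φ g).map_mem hf)).comp
        (mapRingHom φ) := by
    refine Polynomial.ringHom_ext (fun r => ?_) ?_
    · simp only [RingHom.comp_apply, coe_mapRingHom, map_C]
      rw [fracHom_C, fracHom_C]
      change HomogeneousLocalization.mk _ = HomogeneousLocalization.mk _
      ext
      rw [val_mk, val_mk]
      dsimp only [NumDenSameDeg.embedding]
      congr 1
      · exact symMap_algebraMap φ g r
      · exact Subtype.ext (map_one (symMap φ g))
    · simp only [RingHom.comp_apply, coe_mapRingHom, map_X]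
      rw [fracHom_X, fracHom_X, Away.map_mk]
      rfl
  exact RingHom.congr_fun this p

end CoordinateRing

/-! ### Affine lines in the projective line -/

section LineChart

open Polynomial

variable {R M : Type u} [CommRing R] [AddCommGroup M] [Module R M]

/-- The affine line `D₊(t)` in the projective line `Proj (Sym M)`, with coordinate `f / t`. -/
def lineChart {t f : SymmetricAlgebra R M} (ht : t ∈ symPow R M 1) (hf : f ∈ symPow R M 1)
    (h : Function.Bijective (fracHom ht hf)) : Spec (.of R[X]) ⟶ Proj (symPow R M) :=
  Spec.map (CommRingCat.ofHom (RingEquiv.ofBijective (fracHom ht hf) h).symm.toRingHom) ≫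
    Proj.awayι (symPow R M) t ht one_pos

variable {t f : SymmetricAlgebra R M} (ht : t ∈ symPow R M 1) (hf : f ∈ symPow R M 1)
  (h : Function.Bijective (fracHom ht hf))

lemma isIso_fracHom (h : Function.Bijective (fracHom ht hf)) : IsIso (CommRingCat.ofHom (fracHom ht hf)) :=
  (RingEquiv.ofBijective (fracHom ht hf) h).toCommRingCatIso.isIso_hom

lemma specMap_fracHom_lineChart :
    Spec.map (CommRingCat.ofHom (fracHom ht hf)) ≫ lineChart ht hf h =
      Proj.awayι (symPow R M) t ht one_pos := by
  rw [lineChart, ← Category.assoc, ← Spec.map_comp]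
  have : CommRingCat.ofHom (RingEquiv.ofBijective (fracHom ht hf) h).symm.toRingHom ≫
      CommRingCat.ofHom (fracHom ht hf) = 𝟙 _ := by
    ext x : 2
    exact (RingEquiv.ofBijective (fracHom ht hf) h).apply_symm_apply x
  rw [this, Spec.map_id, Category.id_comp]

lemma isIso_specMap_fracHom (h : Function.Bijective (fracHom ht hf)) :
    IsIso (Spec.map (CommRingCat.ofHom (fracHom ht hf))) :=
  have := isIso_fracHom ht hf h
  inferInstance

instance : IsOpenImmersion (lineChart ht hf h) := by
  have : IsIso (CommRingCat.ofHom (RingEquiv.ofBijective (fracHom ht hf) h).symm.toRingHom) :=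
    (RingEquiv.ofBijective (fracHom ht hf) h).symm.toCommRingCatIso.isIso_hom
  unfold lineChart
  infer_instance

lemma opensRange_lineChart :
    (lineChart ht hf h).opensRange = Proj.basicOpen (symPow R M) t := by
  have := isIso_specMap_fracHom ht hf h
  rw [← Proj.opensRange_awayι _ t ht one_pos]
  simp only [← specMap_fracHom_lineChart ht hf h]
  exact (Scheme.Hom.opensRange_comp_of_isIso _ _).symm

lemma lineChart_toSpec :
    lineChart ht hf h ≫ Proj.toSpecZero (symPow R M) ≫
      Spec.map (CommRingCat.ofHom (algebraMap R (symPow R M 0))) =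
      Spec.map (CommRingCat.ofHom (C : R →+* R[X])) := by
  have := isIso_specMap_fracHom ht hf h
  rw [← cancel_epi (Spec.map (CommRingCat.ofHom (fracHom ht hf))), ← Category.assoc,
    specMap_fracHom_lineChart, Proj.awayι_toSpecZero_assoc, ← Spec.map_comp, ← Spec.map_comp]
  exact congrArg (fun φ => Spec.map (CommRingCat.ofHom φ)) (fracHom_comp_C ht hf).symm

/-- A point where the coordinate `f / t` does not vanish lies in `D₊(f)`, the other standard open
set. -/
lemma lineChart_mem_basicOpen (p : Spec (.of R[X])) (hp : X ∉ p.asIdeal) :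
    lineChart ht hf h p ∈ Proj.basicOpen (symPow R M) f := by
  have := isIso_specMap_fracHom ht hf h
  obtain ⟨q, rfl⟩ := (Spec.map (CommRingCat.ofHom (fracHom ht hf))).surjective p
  rw [← Scheme.Hom.comp_apply, specMap_fracHom_lineChart]
  change q ∈ Proj.awayι (symPow R M) t ht one_pos ⁻¹ᵁ Proj.basicOpen _ f
  rw [Proj.awayι_preimage_basicOpen _ ht one_pos hf one_pos]
  intro hq
  apply hp
  change fracHom ht hf X ∈ q.asIdeal
  rw [fracHom_X]
  convert hq
  simp

variable {R' M' : Type u} [CommRing R'] [AddCommGroup M'] [Module R' M']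

/-- In the coordinates, a semilinear map that respects the chosen elements acts on coefficients
only. The images are separate variables with equations, since they agree with the expected elements
only propositionally. -/
lemma lineChart_map (φ : R →+* R') (g : M →ₛₗ[φ] M')
    (H : (symPow R' M')₊ ≤ (symPow R M)₊.map (symGradedMap φ g))
    {t' f' : SymmetricAlgebra R' M'} (ht' : t' ∈ symPow R' M' 1) (hf' : f' ∈ symPow R' M' 1)
    (h' : Function.Bijective (fracHom ht' hf')) (htt : symMap φ g t = t') (hff : symMap φ g f = f') :
    lineChart ht' hf' h' ≫ Proj.map (symGradedMap φ g) H =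
      Spec.map (CommRingCat.ofHom (mapRingHom φ)) ≫ lineChart ht hf h := by
  subst htt hff
  have := isIso_specMap_fracHom ht' hf' h'
  rw [← cancel_epi (Spec.map (CommRingCat.ofHom (fracHom ht' hf'))), ← Category.assoc,
    specMap_fracHom_lineChart, ← Category.assoc, ← Spec.map_comp, ← CommRingCat.ofHom_comp]
  have e : (fracHom ht' hf').comp (mapRingHom φ) =
      (Away.map (symGradedMap φ g) t).comp (fracHom ht hf) :=
    RingHom.ext fun p => (awayMap_fracHom φ g ht hf p).symm
  refine (Proj.awayι_comp_map (symGradedMap φ g) H one_pos t ht).trans ?_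
  rw [← specMap_fracHom_lineChart ht hf h, e, ← Category.assoc, ← Spec.map_comp]
  rfl

lemma irrelevant_le_span (b : Module.Basis (Fin 2) R M) :
    (symPow R M)₊.toIdeal ≤ Ideal.span (Set.range fun i => SymmetricAlgebra.ι R M (b i)) := by
  rw [HomogeneousIdeal.toIdeal_irrelevant_le]
  intro i hi x hx
  obtain ⟨n, rfl⟩ := Nat.exists_eq_succ_of_ne_zero hi.ne'
  have h1 : LinearMap.range (SymmetricAlgebra.ι R M) ≤ (Ideal.span (Set.range fun i =>
      SymmetricAlgebra.ι R M (b i))).restrictScalars R := by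
    rintro _ ⟨m, rfl⟩
    rw [← b.sum_repr m, map_sum]
    refine sum_mem fun i _ => ?_
    rw [map_smul]
    exact Submodule.smul_mem _ _ (Ideal.subset_span ⟨i, rfl⟩)
  have h2 : x ∈ LinearMap.range (SymmetricAlgebra.ι R M) *
      LinearMap.range (SymmetricAlgebra.ι R M) ^ n := by rw [← pow_succ']; exact hx
  change x ∈ Ideal.span (Set.range fun i => SymmetricAlgebra.ι R M (b i))
  induction h2 using Submodule.mul_induction_on' with
  | mem_mul_mem m hm y hy => exact Ideal.mul_mem_right _ _ (h1 hm)
  | add x hx' y hy' ihx ihy =>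
    refine add_mem (ihx ?_) (ihy ?_)
    · change x ∈ symPow R M (n + 1)
      rw [symPow, pow_succ']; exact hx'
    · change y ∈ symPow R M (n + 1)
      rw [symPow, pow_succ']; exact hy'

lemma iSup_basicOpen_ι (b : Module.Basis (Fin 2) R M) :
    ⨆ i, Proj.basicOpen (symPow R M) (SymmetricAlgebra.ι R M (b i)) = ⊤ :=
  Proj.iSup_basicOpen_eq_top _ _ (irrelevant_le_span b)

end LineChart

/-! ### Affine lines in the projective bundle -/

section BundleChart

open Polynomial

variable {X : Scheme.{u}} {E : X.Modules}

/-- The basis of the module of sections given by a frame. -/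
def IsFrame.basis {n : ℕ} {U : X.Opens} {e : Fin n → Γ(E, U)} (he : IsFrame E U e) :
    Module.Basis (Fin n) Γ(X, U) Γ(E, U) :=
  .ofEquivFun (he.equiv le_rfl).symm

lemma IsFrame.basis_apply {n : ℕ} {U : X.Opens} {e : Fin n → Γ(E, U)} (he : IsFrame E U e)
    (i : Fin n) : he.basis i = e i := by
  refine (congrFun (Module.Basis.coe_ofEquivFun _) i).trans ?_
  change ∑ k, (Pi.single i 1 : Fin n → Γ(X, U)) k • resMod E le_rfl (e k) = e i
  simp only [Pi.single_apply, ite_smul, one_smul, zero_smul, Finset.sum_ite_eq',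
    Finset.mem_univ, if_true]
  exact resMod_self E _ _

lemma IsFrame.fracHom_bijective {U : X.Opens} {e : Fin 2 → Γ(E, U)} (he : IsFrame E U e) :
    Function.Bijective (fracHom (ι_mem_symPow Γ(X, U) _ (e 0)) (ι_mem_symPow Γ(X, U) _ (e 1))) := by
  have key : ∀ a b : Γ(E, U), he.basis 0 = a → he.basis 1 = b →
      Function.Bijective (fracHom (ι_mem_symPow Γ(X, U) _ a) (ι_mem_symPow Γ(X, U) _ b)) := by
    rintro _ _ rfl rfl
    exact ProjBundle.fracHom_bijective he.basis
  exact key _ _ (he.basis_apply 0) (he.basis_apply 1)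

lemma IsFrame.swap {U : X.Opens} {e : Fin 2 → Γ(E, U)} (he : IsFrame E U e) :
    IsFrame E U (e ∘ Equiv.swap 0 1) := by
  intro V h
  have e1 : (fun c : Fin 2 → Γ(X, V) => ∑ i, c i • resMod E h ((e ∘ Equiv.swap 0 1) i)) =
      (fun c : Fin 2 → Γ(X, V) => ∑ i, c i • resMod E h (e i)) ∘
        (Equiv.arrowCongr (Equiv.swap 0 1) (Equiv.refl _)) := by
    funext c
    simp [Fin.sum_univ_two, add_comm]
  rw [e1]
  exact (he V h).comp (Equiv.bijective _)

variable [E.IsQuasicoherent]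

/-- The affine line over `U` in the projective bundle given by a frame `e` over `U`: the coordinate
is `e 1 / e 0`. -/
def chart {U : X.AffineZariskiSite} {e : Fin 2 → Γ(E, U.toOpens)} (he : IsFrame E U.toOpens e) :
    Spec (.of Γ(X, U.toOpens)[X]) ⟶ projBundle E :=
  lineChart (ι_mem_symPow _ _ (e 0)) (ι_mem_symPow _ _ (e 1)) he.fracHom_bijective ≫ projChart E U

variable {U : X.AffineZariskiSite} {e : Fin 2 → Γ(E, U.toOpens)} (he : IsFrame E U.toOpens e)

instance : IsOpenImmersion (chart he) := by
  unfold chart; infer_instance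

lemma projChart_projBundleπ (U : X.AffineZariskiSite) :
    projChart E U ≫ projBundleπ E = projToSpec E U.toOpens ≫ U.2.fromSpec := by
  refine ((projGluing E).ι_toBase U).trans ?_
  exact Category.assoc _ _ _

lemma opensRange_projChart (U : X.AffineZariskiSite) :
    (projChart E U).opensRange = projBundleπ E ⁻¹ᵁ U.toOpens := by
  have := (projGluing E).toBase_preimage_eq_opensRange_ι U
  refine this.symm.trans ?_
  exact congrArg (fun W => projBundleπ E ⁻¹ᵁ W) (Scheme.Opens.opensRange_ι _)

lemma chart_projBundleπ : chart he ≫ projBundleπ E =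
    Spec.map (CommRingCat.ofHom (C : Γ(X, U.toOpens) →+* Γ(X, U.toOpens)[X])) ≫ U.2.fromSpec := by
  rw [chart, Category.assoc, projChart_projBundleπ, projToSpec, ← Category.assoc,
    lineChart_toSpec]

lemma opensRange_chart : (chart he).opensRange = twistOpen E U (e 0) := by
  refine (Scheme.Hom.opensRange_comp _ _).trans ?_
  rw [opensRange_lineChart]
  rfl

/-- The two members of a frame generate the irrelevant ideal, so the two lines cover the part of the
bundle over `U`. -/
lemma mem_opensRange_chart_or (x : projBundle E) (hx : projBundleπ E x ∈ U.toOpens) :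
    x ∈ (chart he).opensRange ∨ x ∈ (chart he.swap).opensRange := by
  have hx' : x ∈ (projChart E U).opensRange := by rw [opensRange_projChart]; exact hx
  obtain ⟨y, rfl⟩ := hx'
  have hy : y ∈ ⨆ i, Proj.basicOpen (symSec E U.toOpens) (SymmetricAlgebra.ι _ _ (he.basis i)) := by
    rw [iSup_basicOpen_ι]; trivial
  obtain ⟨i, hi⟩ := Opens.mem_iSup.mp hy
  rw [he.basis_apply] at hi
  rw [opensRange_chart, opensRange_chart]
  fin_cases i
  · exact Or.inl ⟨y, hi, rfl⟩
  · exact Or.inr ⟨y, hi, rfl⟩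

lemma chart_mem_opensRange_swap (p : Spec (.of Γ(X, U.toOpens)[X])) (hp : Polynomial.X ∉ p.asIdeal) :
    chart he p ∈ (chart he.swap).opensRange := by
  rw [opensRange_chart]
  exact ⟨_, lineChart_mem_basicOpen _ _ he.fracHom_bijective p hp, rfl⟩

end BundleChart

/-! ### Quasi-coherence of modules with local frames of length one -/

section InvertibleQuasicoherent

variable {X : Scheme.{u}}

/-- The presentation of the structure sheaf by one generator and no relation. -/
def structurePresentation (X : Scheme.{u}) :
    SheafOfModules.Presentation.{u} (SheafOfModules.unit.{u} X.ringCatSheaf) :=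
  let π : SheafOfModules.free PUnit.{u + 1} ⟶ SheafOfModules.unit.{u} X.ringCatSheaf :=
    Cofan.IsColimit.desc (SheafOfModules.isColimitFreeCofan PUnit) fun _ => 𝟙 _
  have hπ : SheafOfModules.ιFree PUnit.unit ≫ π = 𝟙 _ :=
    Cofan.IsColimit.fac (SheafOfModules.isColimitFreeCofan PUnit) _ _
  have hπ' : π ≫ SheafOfModules.ιFree PUnit.unit = 𝟙 _ :=
    Cofan.IsColimit.hom_ext (SheafOfModules.isColimitFreeCofan PUnit) _ _ fun _ => by
      refine (Category.assoc _ _ _).symm.trans ((congrArg (· ≫ _) hπ).trans ?_)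
      exact (Category.id_comp _).trans (Category.comp_id _).symm
  have : IsIso π := ⟨_, hπ', hπ⟩
  let g : (SheafOfModules.free.{u} (R := X.ringCatSheaf) PUnit.{u + 1}).GeneratingSections :=
    SheafOfModules.free.generatingSections PUnit
  let p : (SheafOfModules.free.{u} (R := X.ringCatSheaf) PUnit.{u + 1}).Presentation :=
    { generators := g
      relations.I := ULift Empty
      relations.s j := Empty.rec _ j.down
      relations.epi := IsZero.epi (IsZero.of_iso (isZero_zero _) (Limits.kernel.ofMono _)) _ }
  SheafOfModules.Presentation.ofIsIso π p

lemma exists_iso_structureModule {M : X.Modules} {U : X.Opens} {e : Fin 1 → Γ(M, U)}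
    (he : IsFrame M U e) : Nonempty (structureModule U ≅ M.restrict U.ι) := by
  have hle (W : U.toScheme.Opens) : U.ι ''ᵁ W ≤ U := U.ι_image_le W
  let ψ (W : U.toScheme.Opens) : Γ(X, U.ι ''ᵁ W) →ₗ[Γ(X, U.ι ''ᵁ W)] Γ(M, U.ι ''ᵁ W) :=
    LinearMap.toSpanSingleton _ _ (resMod M (hle W) (e 0))
  let φ : structureModule U ⟶ M.restrict U.ι := modHomMk (fun W =>
    { toFun := ψ W
      map_add' := (ψ W).map_add
      map_smul' := fun r c => by
        have h := congr($(congrArg Iso.inv (U.ι_appIso W)) r)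
        refine ((ψ W).map_smul r c).trans ?_
        exact congrArg (fun z : Γ(X, U.ι ''ᵁ W) => z • ψ W c) h.symm })
    fun W W' h c => by
      refine Eq.trans ?_ (resMod_smul M (U.ι.image_mono h) _ _).symm
      rw [resMod_resMod]
      rfl
  have : IsIso φ := by
    rw [Scheme.Modules.Hom.isIso_iff_isIso_app]
    intro W
    refine (ConcreteCategory.isIso_iff_bijective _).mpr ?_
    have hb : Function.Bijective (ψ W) := by
      have := (he _ (hle W)).comp (Equiv.funUnique (Fin 1) Γ(X, U.ι ''ᵁ W)).symm.bijective
      convert this using 1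
      funext c
      exact (Fin.sum_univ_one fun i : Fin 1 => c • resMod M (hle W) (e i)).symm
    exact hb
  exact ⟨asIso φ⟩

/-- Needed for `𝒪(1)`, which is built by hand from transition functions: the computation of a zero
ideal clears denominators and so requires quasi-coherence. -/
theorem isQuasicoherent_of_isFrame (M : X.Modules)
    (hM : ∀ x, ∃ (U : X.Opens) (_ : x ∈ U) (e : Fin 1 → Γ(M, U)), IsFrame M U e) :
    M.IsQuasicoherent := by
  choose U hx e he using hM
  let φ (x : X) : structureModule (U x) ≅ M.restrict (U x).ι :=
    (exists_iso_structureModule (he x)).some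
  let N : SheafOfModules.{u} X.ringCatSheaf := M
  have q : N.QuasicoherentData :=
    { I := X
      X := U
      coversTop := by
        rw [Opens.coversTop_iff]
        exact IsOpenCover.mk (eq_top_iff.mpr fun x _ => Opens.mem_iSup.mpr ⟨x, hx x⟩)
      presentation := fun x => overPresentation N (U x)
        (presentationOfIso (φ x) (structurePresentation _)) }
  exact q.isQuasicoherent

end InvertibleQuasicoherent

/-! ### Local generators of `𝒪(1)` -/

section TwistFrame

open Scheme.AffineZariskiSite (toOpens_mono)

variable {X : Scheme.{u}} (E : X.Modules) [E.IsQuasicoherent]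

lemma exists_le_affineZariskiSite {U U' : X.AffineZariskiSite} {x : X} (hx : x ∈ U.toOpens)
    (hx' : x ∈ U'.toOpens) : ∃ V : X.AffineZariskiSite, V ≤ U ∧ V ≤ U' ∧ x ∈ V.toOpens := by
  obtain ⟨f, g, e, hf⟩ := exists_basicOpen_le_affine_inter U.2 U'.2 x ⟨hx, hx'⟩
  exact ⟨U.basicOpen f, U.basicOpen_le f, ⟨g, e.symm⟩, hf⟩

variable {E} in
lemma le_of_mem_opensRange_projChart {U : X.AffineZariskiSite} {x : projBundle E} :
    x ∈ (projChart E U).opensRange ↔ projBundleπ E x ∈ U.toOpens := by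
  rw [opensRange_projChart]; rfl

lemma twistOpen_res {U V : X.AffineZariskiSite} (h : V ≤ U) (t : Γ(E, U.toOpens)) :
    twistOpen E V (resMod E (toOpens_mono h) t) =
      (projChart E V).opensRange ⊓ twistOpen E U t := by
  rw [← Scheme.Hom.image_preimage_eq_opensRange_inf, preimage_twistOpen E h]
  rfl

/-- The fraction `e / t` is unchanged on shrinking the affine open, as is seen in the chart over the
smaller one. -/
lemma twistFrac_res {U V : X.AffineZariskiSite} (h : V ≤ U) (t e : Γ(E, U.toOpens))
    {W : (projBundle E).Opens} (hW : W ≤ twistOpen E V (resMod E (toOpens_mono h) t))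
    (hW' : W ≤ twistOpen E U t) :
    res _ hW (twistFrac E V (resMod E (toOpens_mono h) t) (resMod E (toOpens_mono h) e)) =
      res _ hW' (twistFrac E U t e) := by
  apply appLE_injective (projChart E V) (hW.trans (twistOpen_le E _ _))
  have h₁ := ((projChart E V).preimage_mono hW).trans
    (preimage_twistOpen E (le_refl V) (resMod E (toOpens_mono h) t)).le
  have h₂ := ((projChart E V).preimage_mono hW').trans (preimage_twistOpen E h t).le
  refine (appLE_res _ _ _ _).trans ((projChart_appLE_twistFrac E (le_refl V) _ _ _ h₁).trans ?_)
  refine Eq.trans ?_ ((appLE_res _ _ _ _).trans (projChart_appLE_twistFrac E h _ _ _ h₂)).symm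
  exact projFrac_congr _ (congrArg _ (resMod_self E _ _)) (congrArg _ (resMod_self E _ _)) _ _ _ _ _ _

lemma twistFrac_mul {V : X.AffineZariskiSite} (a a' b : Γ(E, V.toOpens))
    {W : (projBundle E).Opens} (h : W ≤ twistOpen E V a) (h' : W ≤ twistOpen E V a') :
    res _ h' (twistFrac E V a' b) = res _ h' (twistFrac E V a' a) * res _ h (twistFrac E V a b) := by
  apply appLE_injective (projChart E V) (h.trans (twistOpen_le E _ _))
  have h₁ := ((projChart E V).preimage_mono h).trans (preimage_twistOpen E (le_refl V) a).le
  have h₂ := ((projChart E V).preimage_mono h').trans (preimage_twistOpen E (le_refl V) a').le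
  refine (appLE_res _ _ _ _).trans ((projChart_appLE_twistFrac E (le_refl V) _ _ _ h₂).trans ?_)
  refine Eq.trans ?_ (map_mul _ _ _).symm
  refine Eq.trans ?_ (congrArg₂ (· * ·)
    ((appLE_res _ _ _ _).trans (projChart_appLE_twistFrac E (le_refl V) _ _ _ h₂))
    ((appLE_res _ _ _ _).trans (projChart_appLE_twistFrac E (le_refl V) _ _ _ h₁))).symm
  exact projFrac_mul _ _ _ _ _ _ _ _ _

lemma twistFrac_self {V : X.AffineZariskiSite} (a : Γ(E, V.toOpens)) : twistFrac E V a a = 1 := by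
  have : Away.mk (symSec E V.toOpens) (ι_mem_symPow _ _ a) 1 (SymmetricAlgebra.ι _ _ a)
      (by simpa using ι_mem_symPow _ _ a) = 1 := by
    ext
    rw [Away.val_mk, val_one]
    refine (Localization.mk_eq_mk_iff.mpr (Localization.r_iff_exists.mpr ⟨1, ?_⟩)).trans
      (Localization.mk_one)
    simp
  have h2 : projFrac (symSec E V.toOpens) _ _ (ι_mem_symPow _ _ a) (ι_mem_symPow _ _ a) = 1 :=
    (congrArg (Proj.awayToSection _ _) this).trans (map_one _)
  exact (congrArg _ h2).trans (map_one _)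

lemma twistFrac_congr {Q : X.AffineZariskiSite} {a a' b b' : Γ(E, Q.toOpens)} (h : a = a')
    (h' : b = b') {W : (projBundle E).Opens} (p : W ≤ twistOpen E Q a) (p' : W ≤ twistOpen E Q a') :
    res (projBundle E) p (twistFrac E Q a b) = res (projBundle E) p' (twistFrac E Q a' b') := by
  subst h h'; rfl

/-- The ratio `t / t'` can be computed over any affine open that is basic in both `U` and `U'`. Two
such are compared over a third one, locally. -/
lemma twistFrac_eq_of_le {U U' V V' : X.AffineZariskiSite} (t : Γ(E, U.toOpens))
    (t' : Γ(E, U'.toOpens)) (h : V ≤ U) (h' : V ≤ U') (k : V' ≤ U) (k' : V' ≤ U')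
    {W : (projBundle E).Opens} (hW : W ≤ twistOpen E V (resMod E (toOpens_mono h') t'))
    (hW' : W ≤ twistOpen E V' (resMod E (toOpens_mono k') t')) :
    res _ hW (twistFrac E V (resMod E (toOpens_mono h') t') (resMod E (toOpens_mono h) t)) =
      res _ hW' (twistFrac E V' (resMod E (toOpens_mono k') t') (resMod E (toOpens_mono k) t)) := by
  refine res_ext (fun Q : {Q : X.AffineZariskiSite // Q ≤ V ∧ Q ≤ V'} =>
    W ⊓ (projChart E Q.1).opensRange) (fun _ => inf_le_left) (fun x hx => ?_) _ _ fun Q => ?_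
  · obtain ⟨Q, hQ, hQ', hxQ⟩ := exists_le_affineZariskiSite
      (le_of_mem_opensRange_projChart.mp (twistOpen_le E _ _ (hW hx)))
      (le_of_mem_opensRange_projChart.mp (twistOpen_le E _ _ (hW' hx)))
    exact Opens.mem_iSup.mpr ⟨⟨Q, hQ, hQ'⟩, hx, le_of_mem_opensRange_projChart.mpr hxQ⟩
  · obtain ⟨Q, hQ, hQ'⟩ := Q
    have e1 : W ⊓ (projChart E Q).opensRange ≤ twistOpen E Q (resMod E (toOpens_mono hQ)
        (resMod E (toOpens_mono h') t')) := by
      rw [twistOpen_res E hQ]; exact le_inf inf_le_right (inf_le_left.trans hW)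
    have e2 : W ⊓ (projChart E Q).opensRange ≤ twistOpen E Q (resMod E (toOpens_mono hQ')
        (resMod E (toOpens_mono k') t')) := by
      rw [twistOpen_res E hQ']; exact le_inf inf_le_right (inf_le_left.trans hW')
    rw [res_res, res_res, ← twistFrac_res E hQ _ _ e1, ← twistFrac_res E hQ' _ _ e2]
    exact twistFrac_congr E (by rw [resMod_resMod, resMod_resMod])
      (by rw [resMod_resMod, resMod_resMod]) _ _

variable {E} in
lemma le_twistOpen_res {U V : X.AffineZariskiSite} (h : V ≤ U) (t : Γ(E, U.toOpens))
    {W : (projBundle E).Opens} (h₁ : W ≤ (projChart E V).opensRange) (h₂ : W ≤ twistOpen E U t) :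
    W ≤ twistOpen E V (resMod E (toOpens_mono h) t) := by
  rw [twistOpen_res E h]; exact le_inf h₁ h₂

/-- The ratio of two local generators of `𝒪(1)`. -/
lemma exists_twistRatio {U U' : X.AffineZariskiSite} (t : Γ(E, U.toOpens)) (t' : Γ(E, U'.toOpens)) :
    ∃ r : Γ(projBundle E, twistOpen E U t ⊓ twistOpen E U' t'),
      ∀ (V : X.AffineZariskiSite) (h : V ≤ U) (h' : V ≤ U') (W : (projBundle E).Opens)
        (hW : W ≤ twistOpen E U t ⊓ twistOpen E U' t')
        (hW' : W ≤ twistOpen E V (resMod E (toOpens_mono h') t')),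
        res _ hW r = res _ hW'
          (twistFrac E V (resMod E (toOpens_mono h') t') (resMod E (toOpens_mono h) t)) := by
  let D := twistOpen E U t ⊓ twistOpen E U' t'
  let I := {Q : X.AffineZariskiSite // Q ≤ U ∧ Q ≤ U'}
  have hO (Q : I) : D ⊓ (projChart E Q.1).opensRange ≤
      twistOpen E Q.1 (resMod E (toOpens_mono Q.2.2) t') :=
    le_twistOpen_res Q.2.2 _ inf_le_right (inf_le_left.trans inf_le_right)
  obtain ⟨r, hr⟩ := res_glue (W := D) (fun Q : I => D ⊓ (projChart E Q.1).opensRange)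
    (fun _ => inf_le_left) (fun x hx => by
      obtain ⟨Q, hQ, hQ', hxQ⟩ := exists_le_affineZariskiSite
        (le_of_mem_opensRange_projChart.mp (twistOpen_le E _ _ hx.1))
        (le_of_mem_opensRange_projChart.mp (twistOpen_le E _ _ hx.2))
      exact Opens.mem_iSup.mpr ⟨⟨Q, hQ, hQ'⟩, hx, le_of_mem_opensRange_projChart.mpr hxQ⟩)
    (fun Q => res _ (hO Q) (twistFrac E Q.1 (resMod E (toOpens_mono Q.2.2) t')
      (resMod E (toOpens_mono Q.2.1) t))) (fun Q Q' => by
        rw [res_res, res_res]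
        exact twistFrac_eq_of_le E t t' Q.2.1 Q.2.2 Q'.2.1 Q'.2.2 _ _)
  refine ⟨r, fun V h h' W hW hW' => ?_⟩
  have := congrArg (res _ (le_inf hW (hW'.trans (twistOpen_le E _ _)))) (hr ⟨V, h, h'⟩)
  rw [res_res, res_res] at this
  exact this

variable {E} in
lemma inf_opensRange_cover {U U' : X.AffineZariskiSite} {W : (projBundle E).Opens}
    (h : W ≤ (projChart E U).opensRange) (h' : W ≤ (projChart E U').opensRange) :
    W ≤ ⨆ Q : {Q : X.AffineZariskiSite // Q ≤ U ∧ Q ≤ U'}, W ⊓ (projChart E Q.1).opensRange := by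
  intro x hx
  obtain ⟨Q, hQ, hQ', hxQ⟩ := exists_le_affineZariskiSite
    (le_of_mem_opensRange_projChart.mp (h hx)) (le_of_mem_opensRange_projChart.mp (h' hx))
  exact Opens.mem_iSup.mpr ⟨⟨Q, hQ, hQ'⟩, hx, le_of_mem_opensRange_projChart.mpr hxQ⟩

/-- The transition data relate an affine open only to its basic opens. To compare the components at
`(U, t)` and at `j`, both are related to the component at `Q` and the restriction of `j.2`; towards
`j` the transition function is `1`, towards `(U, t)` it is the ratio. -/
lemma twist_section_eq {U : X.AffineZariskiSite} (t : Γ(E, U.toOpens)) {V : (projBundle E).Opens}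
    (σ : (twistData E).sections V) (j : (twistData E).ι) (Q : X.AffineZariskiSite) (hQ : Q ≤ U)
    (hQ' : Q ≤ j.1) (W : (projBundle E).Opens) (hV : W ≤ V) (hi : W ≤ twistOpen E U t)
    (hj : W ≤ twistOpen E j.1 j.2) (hW : W ≤ twistOpen E Q (resMod E (toOpens_mono hQ') j.2)) :
    res _ (le_inf hV hj : W ≤ V ⊓ (twistData E).D j) (σ.1 j) =
      res _ hW (twistFrac E Q (resMod E (toOpens_mono hQ') j.2) (resMod E (toOpens_mono hQ) t)) *
        res _ (le_inf hV hi : W ≤ V ⊓ (twistData E).D ⟨U, t⟩) (σ.1 ⟨U, t⟩) := by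
  let k₁ : (twistData E).κ := ⟨Q, j.1, hQ', resMod E (toOpens_mono hQ') j.2, j.2⟩
  let k₂ : (twistData E).κ := ⟨Q, U, hQ, resMod E (toOpens_mono hQ') j.2, t⟩
  have h₁ := (twistData E).sections_compat σ k₁ hV hW hj
  have h₂ := (twistData E).sections_compat σ k₂ hV hW hi
  have g₁ : res _ (le_inf hW hj : W ≤ (twistData E).D ((twistData E).src k₁) ⊓
      (twistData E).D ((twistData E).tgt k₁)) ((twistData E).g k₁) = 1 := by
    refine (res_res _ _ _).trans ?_
    rw [twistFrac_self, map_one]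
  have g₂ : res _ (le_inf hW hi : W ≤ (twistData E).D ((twistData E).src k₂) ⊓
      (twistData E).D ((twistData E).tgt k₂)) ((twistData E).g k₂) =
      res _ hW (twistFrac E Q (resMod E (toOpens_mono hQ') j.2) (resMod E (toOpens_mono hQ) t)) :=
    res_res _ _ _
  rw [g₁, one_mul] at h₁
  rw [g₂] at h₂
  exact h₁.symm.trans h₂

/-- Over the locus where the section `t` of `E` generates `𝒪(1)`, the sheaf `𝒪(1)` is free. -/
theorem exists_isFrame_twist {U : X.AffineZariskiSite} (t : Γ(E, U.toOpens)) :
    ∃ (τ : Fin 1 → Γ(twist E, twistOpen E U t)) (hτ : IsFrame (twist E) (twistOpen E U t) τ),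
      ∀ s : Γ(E, ⊤), hτ.coord le_rfl 0 (resMod (twist E) le_top (twistSection E s)) =
        twistFrac E U t (resMod E le_top s) := by
  let Di := twistOpen E U t
  choose r hr using fun j : (twistData E).ι => exists_twistRatio E t j.2
  -- The generator is `t` itself: its component at an index `j` is the ratio of `t` to the section
  -- of `j`. Compatibility is the cocycle identity for ratios, checked over common basic opens.
  let τ : (twistData E).sections Di := ⟨r, fun k => by
    let T := Di ⊓ (twistOpen E k.V k.t' ⊓ twistOpen E k.U k.t)
    have hT : T ≤ twistOpen E k.V k.t' := inf_le_right.trans inf_le_left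
    have hT' : T ≤ twistOpen E k.U k.t := inf_le_right.trans inf_le_right
    refine res_ext (W := T) _ (fun _ => inf_le_left) (inf_opensRange_cover (U := U) (U' := k.V)
      (inf_le_left.trans (twistOpen_le E _ _)) (hT.trans (twistOpen_le E _ _))) _ _ fun Q => ?_
    obtain ⟨Q, hQ, hQ'⟩ := Q
    let W := T ⊓ (projChart E Q).opensRange
    have hW₁ : W ≤ twistOpen E Q (resMod E (toOpens_mono hQ') k.t') :=
      le_twistOpen_res hQ' _ inf_le_right (inf_le_left.trans hT)
    have hW₂ : W ≤ twistOpen E Q (resMod E (toOpens_mono (hQ'.trans k.le)) k.t) :=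
      le_twistOpen_res (hQ'.trans k.le) _ inf_le_right (inf_le_left.trans hT')
    have h₁ := hr ⟨k.V, k.t'⟩ Q hQ hQ' W
      (le_inf (inf_le_left.trans inf_le_left) (inf_le_left.trans hT)) hW₁
    have h₂ := hr ⟨k.U, k.t⟩ Q hQ (hQ'.trans k.le) W
      (le_inf (inf_le_left.trans inf_le_left) (inf_le_left.trans hT')) hW₂
    have h₃ := twistFrac_res E hQ' k.t' (resMod E (toOpens_mono k.le) k.t) hW₁
      (inf_le_left.trans hT)
    have h₄ := twistFrac_mul E (resMod E (toOpens_mono (hQ'.trans k.le)) k.t)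
      (resMod E (toOpens_mono hQ') k.t') (resMod E (toOpens_mono hQ) t) hW₂ hW₁
    rw [resMod_resMod] at h₃
    rw [← h₁, h₃, ← h₂] at h₄
    refine (res_res _ _ _).trans (h₄.trans (Eq.trans ?_ (map_mul _ _ _).symm))
    refine congrArg₂ (· * ·) ?_ (res_res _ _ _).symm
    exact ((res_res _ _ _).trans (res_res _ _ _)).symm⟩
  let i : (twistData E).ι := ⟨U, t⟩
  have hri : r i = 1 := by
    have h1 := hr i U le_rfl le_rfl (Di ⊓ Di) le_rfl
      (by rw [resMod_self]; exact inf_le_left)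
    rw [res_self] at h1
    exact h1.trans ((congrArg _ (twistFrac_self E _)).trans (map_one _))
  -- The coordinate of a section is its component at the index `(U, t)`, where the generator has
  -- component `1`.
  let θ (V : (projBundle E).Opens) (h : V ≤ Di) (_ : Fin 1) :
      Γ(twist E, V) →ₗ[Γ(projBundle E, V)] Γ(projBundle E, V) :=
    { toFun := fun σ => res _ (le_inf le_rfl h : V ≤ V ⊓ Di)
        ((show (twistData E).sections V from σ).1 i)
      map_add' := fun σ σ' => map_add _ _ _
      map_smul' := fun c σ => by
        refine (map_mul _ _ _).trans ?_
        exact congrArg (· * _) ((res_res _ _ _).trans (res_self _ _)) }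
  have hθ : ∀ V h (m : Γ(twist E, V)), ∑ k, θ V h k m • resMod (twist E) h
      ((fun _ => τ : Fin 1 → Γ(twist E, Di)) k) = m := by
    intro V h m
    refine (Fin.sum_univ_one _).trans ?_
    let σ : (twistData E).sections V := m
    change θ V h 0 σ • (twistData E).restr h τ = σ
    refine Subtype.ext (funext fun j => ?_)
    have hVj : V ⊓ twistOpen E j.1 j.2 ≤ twistOpen E U t := inf_le_left.trans h
    refine res_ext (W := V ⊓ twistOpen E j.1 j.2) _ (fun _ => inf_le_left)
      (inf_opensRange_cover (U := U) (U' := j.1)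
      (hVj.trans (twistOpen_le E _ _)) (inf_le_right.trans (twistOpen_le E _ _))) _ _ fun Q => ?_
    obtain ⟨Q, hQ, hQ'⟩ := Q
    have hW₁ : V ⊓ twistOpen E j.1 j.2 ⊓ (projChart E Q).opensRange ≤
        twistOpen E Q (resMod E (toOpens_mono hQ') j.2) :=
      le_twistOpen_res hQ' _ inf_le_right (inf_le_left.trans inf_le_right)
    have h₁ := twist_section_eq E t σ j Q hQ hQ' _ (inf_le_left.trans inf_le_left)
      (inf_le_left.trans hVj) (inf_le_left.trans inf_le_right) hW₁
    have h₂ := hr j Q hQ hQ' _ (le_inf (inf_le_left.trans hVj) (inf_le_left.trans inf_le_right)) hW₁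
    refine Eq.trans ?_ h₁.symm
    rw [← h₂]
    refine (map_mul _ _ _).trans ((mul_comm _ _).trans (congrArg₂ (· * ·) ?_ ?_))
    · exact res_res _ _ _
    · refine (res_res _ _ _).trans (res_res _ _ _)
  have hτ : IsFrame (twist E) Di (fun _ => τ : Fin 1 → Γ(twist E, Di)) := by
    refine IsFrame.of_coord θ (fun V h k l => ?_) fun V h m => hθ V h m
    rw [Subsingleton.elim k l, if_pos rfl]
    change res _ _ (res _ _ (r i)) = 1
    rw [hri, map_one, map_one]
  refine ⟨_, hτ, fun s => ?_⟩
  have h1 := hθ Di le_rfl (resMod (twist E) le_top (twistSection E s))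
  conv_lhs => rw [← h1]
  refine (hτ.coord_sum le_rfl _ 0).trans ?_
  change res _ _ (res _ _ (res _ _ (twistFrac E U t (resMod E le_top s)))) = _
  exact (res_res _ _ _).trans ((res_res _ _ _).trans (res_self _ _))

end TwistFrame

/-! ### The equation of the section of `𝒪(1)` in a chart -/

section ZeroIdealTwist
open Polynomial

lemma map_eq_span_singleton {R S : Type*} [CommRing R] [CommRing S] (ψ : R →+* S) {I : Ideal R}
    {x : R} {y : S} (h : I = Ideal.span {x}) (hy : ψ x = y) : I.map ψ = Ideal.span {y} := by
  rw [h, Ideal.map_span, Set.image_singleton, hy]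

lemma isAffineOpen_basicOpen_of_mem {A : Type u} [CommRing A] {σ : Type u} [SetLike σ A]
    [AddSubgroupClass σ A] (𝒜 : ℕ → σ) [GradedRing 𝒜] (t : A) {d : ℕ} (ht : t ∈ 𝒜 d)
    (hd : 0 < d) : IsAffineOpen (Proj.basicOpen 𝒜 t) := by
  rw [← Proj.opensRange_awayι 𝒜 t ht hd]
  exact isAffineOpen_opensRange _

lemma specMap_awayToSection_awayι {A : Type u} [CommRing A] {σ : Type u} [SetLike σ A]
    [AddSubgroupClass σ A] (𝒜 : ℕ → σ) [GradedRing 𝒜] (t : A) {d : ℕ} (ht : t ∈ 𝒜 d)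
    (hd : 0 < d) (hU : IsAffineOpen (Proj.basicOpen 𝒜 t)) :
    Spec.map (Proj.awayToSection 𝒜 t) ≫ Proj.awayι 𝒜 t ht hd = hU.fromSpec := by
  rw [← cancel_epi hU.isoSpec.hom, hU.isoSpec_hom, IsAffineOpen.toSpecΓ_fromSpec,
    ← Category.assoc]
  change Proj.basicOpenToSpec 𝒜 t ≫ _ = _
  rw [← Proj.basicOpenIsoSpec_inv_ι, ← Proj.basicOpenIsoSpec_hom 𝒜 t ht hd, Iso.hom_inv_id_assoc]

lemma map_injective_of_isIso {R S : CommRingCat.{u}} (ψ : R ⟶ S) [IsIso ψ] {I J : Ideal R}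
    (h : I.map ψ.hom = J.map ψ.hom) : I = J :=
  le_antisymm ((map_iso_le_iff (asIso ψ) I J).mp h.le) ((map_iso_le_iff (asIso ψ) J I).mp h.ge)

variable {X : Scheme.{u}} {E : X.Modules} [E.IsQuasicoherent]
  {U : X.AffineZariskiSite} {e : Fin 2 → Γ(E, U.toOpens)} (he : IsFrame E U.toOpens e)

lemma isAffineOpen_twistOpen (t : Γ(E, U.toOpens)) : IsAffineOpen (twistOpen E U t) :=
  (isAffineOpen_basicOpen_of_mem _ _ (ι_mem_symPow _ _ t) one_pos).image_of_isOpenImmersion _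

lemma appLE_twistFrac (t m : Γ(E, U.toOpens))
    (hle : Proj.basicOpen (symSec E U.toOpens) (SymmetricAlgebra.ι _ _ t) ≤
      projChart E U ⁻¹ᵁ twistOpen E U t) :
    (projChart E U).appLE (twistOpen E U t) _ hle (twistFrac E U t m) =
      projFrac (symSec E U.toOpens) _ _ (ι_mem_symPow _ _ t) (ι_mem_symPow _ _ m) := by
  have := congr($((projChart E U).appIso_inv_appLE hle)
    (projFrac (symSec E U.toOpens) _ _ (ι_mem_symPow _ _ t) (ι_mem_symPow _ _ m)))
  exact this.trans (res_self (P := Proj (symSec E U.toOpens)) le_rfl _)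

/-- The isomorphism of the chart of a frame with its image. -/
def chartHom (e : Fin 2 → Γ(E, U.toOpens)) : CommRingCat.of Γ(X, U.toOpens)[X] ⟶
    Γ(Proj (symSec E U.toOpens), Proj.basicOpen _ (SymmetricAlgebra.ι _ _ (e 0))) :=
  CommRingCat.ofHom (fracHom (ι_mem_symPow _ _ (e 0)) (ι_mem_symPow _ _ (e 1))) ≫
    Proj.awayToSection (symSec E U.toOpens) (SymmetricAlgebra.ι _ _ (e 0))

lemma isIso_chartHom (he : IsFrame E U.toOpens e) : IsIso (chartHom e) := by
  have : IsIso (CommRingCat.ofHom (fracHom (ι_mem_symPow _ _ (e 0)) (ι_mem_symPow _ _ (e 1)))) :=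
    isIso_fracHom _ _ he.fracHom_bijective
  have hiso : IsIso (Proj.awayToSection (symSec E U.toOpens) (SymmetricAlgebra.ι _ _ (e 0))) :=
    (Proj.basicOpenIsoAway (symSec E U.toOpens) _ (ι_mem_symPow _ _ (e 0)) one_pos).isIso_hom
  unfold chartHom
  infer_instance

/-- The chart and the inclusion of the affine open `twistOpen E U (e 0)` describe the same open
subscheme. This equality lets an ideal known on the open set be read in the polynomial ring. -/
lemma specMap_chartHom_chart (hD : IsAffineOpen (twistOpen E U (e 0)))
    (hle : Proj.basicOpen (symSec E U.toOpens) (SymmetricAlgebra.ι _ _ (e 0)) ≤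
      projChart E U ⁻¹ᵁ twistOpen E U (e 0)) :
    Spec.map (chartHom e) ≫ chart he =
      Spec.map ((projChart E U).appLE (twistOpen E U (e 0)) _ hle) ≫ hD.fromSpec := by
  have ht := ι_mem_symPow Γ(X, U.toOpens) _ (e 0)
  have hU := isAffineOpen_basicOpen_of_mem (symSec E U.toOpens) _ ht one_pos
  rw [IsAffineOpen.SpecMap_appLE_fromSpec (projChart E U) hD hU hle, chartHom, Spec.map_comp,
    Category.assoc, chart, reassoc_of% specMap_fracHom_lineChart,
    reassoc_of% (specMap_awayToSection_awayι (symSec E U.toOpens) _ ht one_pos hU)]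

lemma chartHom_apply (m : Γ(E, U.toOpens)) :
    chartHom e (C (he.coord le_rfl 0 m) + C (he.coord le_rfl 1 m) * Polynomial.X) =
      projFrac (symSec E U.toOpens) _ _ (ι_mem_symPow _ _ (e 0)) (ι_mem_symPow _ _ m) := by
  refine congrArg (Proj.awayToSection _ _) (fracHom_C_add_C_mul_X _ _ ?_)
  have := he.sum_coord le_rfl m
  rw [Fin.sum_univ_two, resMod_self, resMod_self] at this
  exact this.symm

/-- The ideal of a closed subscheme of the bundle that is cut out over the locus where `e 0`
generates `𝒪(1)` by the image of a section of `E`. -/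
lemma pullIdeal_chart_of_ideal_eq (Z : (projBundle E).IdealSheafData) (m : Γ(E, U.toOpens))
    (h : Z.ideal ⟨twistOpen E U (e 0), isAffineOpen_twistOpen _⟩ =
      Ideal.span {twistFrac E U (e 0) m}) :
    pullIdeal Z (chart he) = Ideal.span {C (he.coord le_rfl 0 m) + C (he.coord le_rfl 1 m) * Polynomial.X} := by
  have hle : Proj.basicOpen (symSec E U.toOpens) (SymmetricAlgebra.ι _ _ (e 0)) ≤
      projChart E U ⁻¹ᵁ twistOpen E U (e 0) := (Scheme.Hom.preimage_image_eq _ _).ge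
  have hiso := isIso_chartHom he
  have a₁ := congrArg (pullIdeal Z) (specMap_chartHom_chart he (isAffineOpen_twistOpen _) hle)
  have a₂ := map_eq_span_singleton ((projChart E U).appLE (twistOpen E U (e 0)) _ hle).hom h
    (appLE_twistFrac _ _ hle)
  have a₃ := map_eq_span_singleton (chartHom e).hom rfl (chartHom_apply he m)
  -- Both ideals are compared after the isomorphism `chartHom`, where each is generated by the same
  -- fraction.
  refine map_injective_of_isIso (chartHom e) (Eq.trans ?_ a₃.symm)
  refine (pullIdeal_specMap_comp Z (chartHom e) (chart he)).symm.trans (a₁.trans ?_)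
  refine (pullIdeal_specMap_comp Z _ _).trans (Eq.trans ?_ a₂)
  exact congrArg (Ideal.map _) (pullIdeal_fromSpec Z (isAffineOpen_twistOpen (e 0)))

lemma exists_affine_isFrame {X : Scheme.{u}} (E : X.Modules) [IsRankTwoBundle E] (x : X) : ∃ (U : X.AffineZariskiSite)
    (_ : x ∈ U.toOpens) (e : Fin 2 → Γ(E, U.toOpens)), IsFrame E U.toOpens e := by
  obtain ⟨U, hx, e, he⟩ := exists_isFrame_of_isRankTwoBundle E x
  obtain ⟨V, hV, hxV, hVU⟩ := exists_isAffineOpen_mem_and_subset hx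
  exact ⟨⟨V, hV⟩, hxV, _, he.restrict hVU⟩

variable (E) in
lemma exists_isFrame_twist_mem [IsRankTwoBundle E] (x : projBundle E) :
    ∃ (U : (projBundle E).Opens) (_ : x ∈ U) (e : Fin 1 → Γ(twist E, U)), IsFrame (twist E) U e := by
  obtain ⟨U, hx, e, he⟩ := exists_affine_isFrame E (projBundleπ E x)
  rcases mem_opensRange_chart_or he x hx with h | h
  · rw [opensRange_chart] at h
    obtain ⟨τ, hτ, -⟩ := exists_isFrame_twist E (e 0)
    exact ⟨_, h, τ, hτ⟩
  · rw [opensRange_chart] at h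
    obtain ⟨τ, hτ, -⟩ := exists_isFrame_twist E ((e ∘ Equiv.swap 0 1) 0)
    exact ⟨_, h, τ, hτ⟩

/-- On the chart of a frame, the zero scheme of the section of `𝒪(1)` defined by `s` is cut out by
the linear polynomial whose coefficients are the coordinates of `s`. -/
theorem pullIdeal_zeroIdeal_twist [IsRankTwoBundle E] (s : Γ(E, ⊤)) :
    pullIdeal (zeroIdeal (twist E) (twistSection E s)) (chart he) =
      Ideal.span {C (he.coord le_rfl 0 (resMod E le_top s)) +
        C (he.coord le_rfl 1 (resMod E le_top s)) * Polynomial.X} := by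
  have hqc := isQuasicoherent_of_isFrame (twist E) (exists_isFrame_twist_mem E)
  refine pullIdeal_chart_of_ideal_eq he _ _ ?_
  obtain ⟨τ, hτ, h⟩ := exists_isFrame_twist E (e 0)
  refine (zeroIdeal_ideal (fun x => ⟨1, exists_isFrame_twist_mem E x⟩) _
    ⟨twistOpen E U (e 0), isAffineOpen_twistOpen _⟩ hτ).trans ?_
  congr 1
  rw [← h s]
  ext z
  simp [eq_comm]

end ZeroIdealTwist

/-! ### Local splitting off of the greatest common divisor -/

section GcdChart

variable {X : Scheme.{u}}

lemma map_germ_ideal_eq (Z : X.IdealSheafData) (U V : X.affineOpens) (x : X) (hU : x ∈ U.1)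
    (hV : x ∈ V.1) : (Z.ideal U).map (X.presheaf.germ U.1 x hU).hom =
      (Z.ideal V).map (X.presheaf.germ V.1 x hV).hom := by
  obtain ⟨f, g, e, hf⟩ := exists_basicOpen_le_affine_inter U.2 V.2 x ⟨hU, hV⟩
  have e' : X.affineBasicOpen f = X.affineBasicOpen g := Subtype.ext e
  rw [← map_germ_map_res (X.basicOpen_le f) x hf, ← map_germ_map_res (X.basicOpen_le g) x (e ▸ hf)]
  have h1 : (Z.ideal U).map (res X (X.basicOpen_le f)) = Z.ideal (X.affineBasicOpen f) :=
    Z.map_ideal_basicOpen U f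
  have h2 : (Z.ideal V).map (res X (X.basicOpen_le g)) = Z.ideal (X.affineBasicOpen g) :=
    Z.map_ideal_basicOpen V g
  rw [h1, h2]
  have : ∀ (V W : X.affineOpens) (h : V = W) (hV : x ∈ V.1) (hW : x ∈ W.1),
      (Z.ideal V).map (X.presheaf.germ V.1 x hV).hom =
        (Z.ideal W).map (X.presheaf.germ W.1 x hW).hom := by
    rintro V _ rfl _ _; rfl
  exact this _ _ e' _ _

lemma IsFrame.coord_restrict {M : X.Modules} {n : ℕ} {U V : X.Opens} {e : Fin n → Γ(M, U)}
    (he : IsFrame M U e) (h : V ≤ U) (k : Fin n) (m : Γ(M, V)) :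
    (he.restrict h).coord le_rfl k m = he.coord h k m := by
  conv_rhs => rw [← (he.restrict h).sum_coord le_rfl m]
  simp only [resMod_resMod]
  exact (he.coord_sum h _ k).symm

/-- A frame of `E` over an affine open set, together with a greatest common divisor `d` of the two
coordinates of `s` such that the quotients `a` and `b` have an exact Koszul complex. -/
structure GcdChart (E : X.Modules) (s : Γ(E, ⊤)) (U : X.AffineZariskiSite) where
  /-- the frame -/
  e : Fin 2 → Γ(E, U.toOpens)
  he : IsFrame E U.toOpens e
  /-- the common divisor -/
  d : Γ(X, U.toOpens)
  /-- the first quotient -/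
  a : Γ(X, U.toOpens)
  /-- the second quotient -/
  b : Γ(X, U.toOpens)
  hd : d ∈ nonZeroDivisors Γ(X, U.toOpens)
  coord_zero : he.coord le_rfl 0 (resMod E le_top s) = d * a
  coord_one : he.coord le_rfl 1 (resMod E le_top s) = d * b
  koszul : KoszulExact a b

namespace GcdChart

variable {E : X.Modules} {s : Γ(E, ⊤)} {U : X.AffineZariskiSite} (c : GcdChart E s U)

/-- The chart with the two members of the frame exchanged. -/
def swap : GcdChart E s U where
  e := c.e ∘ Equiv.swap 0 1
  he := c.he.swap
  d := c.d
  a := c.b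
  b := c.a
  hd := c.hd
  coord_zero := by
    rw [← c.coord_one]
    conv_lhs => rw [← c.he.sum_coord le_rfl (resMod E le_top s)]
    have := c.he.swap.coord_sum le_rfl ![c.he.coord le_rfl 1 (resMod E le_top s),
      c.he.coord le_rfl 0 (resMod E le_top s)] 0
    rw [Fin.sum_univ_two] at this ⊢
    rw [add_comm]
    exact this
  coord_one := by
    rw [← c.coord_zero]
    conv_lhs => rw [← c.he.sum_coord le_rfl (resMod E le_top s)]
    have := c.he.swap.coord_sum le_rfl ![c.he.coord le_rfl 1 (resMod E le_top s),
      c.he.coord le_rfl 0 (resMod E le_top s)] 1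
    rw [Fin.sum_univ_two] at this ⊢
    rw [add_comm]
    exact this
  koszul := c.koszul.symm

/-- The chart over a smaller open set, provided that the conditions persist. -/
def ofLE {V : X.AffineZariskiSite} (h : V.toOpens ≤ U.toOpens)
    (hd : res X h c.d ∈ nonZeroDivisors Γ(X, V.toOpens))
    (hk : KoszulExact (res X h c.a) (res X h c.b)) : GcdChart E s V where
  e := fun i => resMod E h (c.e i)
  he := c.he.restrict h
  d := res X h c.d
  a := res X h c.a
  b := res X h c.b
  hd := hd
  coord_zero := by
    rw [c.he.coord_restrict, ← map_mul, ← c.coord_zero, ← c.he.coord_res le_rfl h, resMod_resMod]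
  coord_one := by
    rw [c.he.coord_restrict, ← map_mul, ← c.coord_one, ← c.he.coord_res le_rfl h, resMod_resMod]
  koszul := hk

/-- The chart over a basic open set. -/
def basicOpen (f : Γ(X, U.toOpens)) :
    GcdChart E s (⟨X.basicOpen f, U.2.basicOpen f⟩ : X.AffineZariskiSite) :=
  c.ofLE (X.basicOpen_le f)
    (by
      let := (res X (X.basicOpen_le f)).toAlgebra
      have := isLocalization_res U.2 f
      exact IsLocalization.map_nonZeroDivisors_le (.powers f) _ ⟨_, c.hd, rfl⟩)
    (by
      let := (res X (X.basicOpen_le f)).toAlgebra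
      have := isLocalization_res U.2 f
      exact c.koszul.of_isLocalization (.powers f))

lemma zeroIdeal_ideal [IsRankTwoBundle E] :
    (zeroIdeal E s).ideal ⟨U.toOpens, U.2⟩ = Ideal.span {c.d * c.a, c.d * c.b} := by
  refine (ProjBundle.zeroIdeal_ideal (fun x => ⟨2, exists_isFrame_of_isRankTwoBundle E x⟩) s
    ⟨U.toOpens, U.2⟩ c.he).trans ?_
  rw [← c.coord_zero, ← c.coord_one]
  congr 1
  ext z
  simp [Fin.exists_fin_two, eq_comm]

end GcdChart

variable {E : X.Modules} {s : Γ(E, ⊤)}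

/-- On an integral scheme a function that vanishes on a nonempty open set vanishes. If the
coordinates over one frame were zero, so would be those over every other frame. -/
lemma exists_coord_ne_zero [IsRankTwoBundle E] [IsIntegral X] (hs : s ≠ 0) {U : X.Opens}
    {e : Fin 2 → Γ(E, U)} (he : IsFrame E U e) {x : X} (hx : x ∈ U) :
    ∃ k, he.coord le_rfl k (resMod E le_top s) ≠ 0 := by
  by_contra! h0
  apply hs
  choose V hV e' he' using exists_isFrame_of_isRankTwoBundle E
  refine resMod_ext V (fun _ => le_top) (fun y _ => Opens.mem_iSup.mpr ⟨y, hV y⟩) _ _ fun y => ?_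
  rw [map_zero, ← (he' y).sum_coord le_rfl (resMod E le_top s)]
  refine Finset.sum_eq_zero fun k _ => ?_
  have : (he' y).coord le_rfl k (resMod E le_top s) = 0 := by
    have hne : Nonempty (U ⊓ V y : X.Opens) := by
      obtain ⟨z, hz, hz'⟩ := nonempty_preirreducible_inter U.isOpen (V y).isOpen ⟨x, hx⟩ ⟨y, hV y⟩
      exact ⟨⟨z, hz, hz'⟩⟩
    apply map_injective_of_isIntegral X (homOfLE (inf_le_right : U ⊓ V y ≤ V y))
    rw [map_zero]
    refine ((he' y).coord_res le_rfl inf_le_right _ k).symm.trans ?_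
    have h1 : resMod E (inf_le_left : U ⊓ V y ≤ U) (resMod E le_top s) = 0 := by
      rw [← he.sum_coord le_rfl (resMod E le_top s), map_sum]
      refine Finset.sum_eq_zero fun k _ => ?_
      rw [h0 k, zero_smul, map_zero]
    rw [resMod_resMod] at h1 ⊢
    rw [h1, map_zero]
  rw [this, zero_smul]

/-- Charts exist around every point. -/
theorem exists_gcdChart [IsRankTwoBundle E] [IsIntegral X] [IsLocallyNoetherian X] (x : X)
    [UniqueFactorizationMonoid (X.presheaf.stalk x)] (hs : s ≠ 0) :
    ∃ (U : X.AffineZariskiSite), x ∈ U.toOpens ∧ Nonempty (GcdChart E s U) := by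
  obtain ⟨U, hx, e, he⟩ := exists_isFrame_of_isRankTwoBundle E x
  obtain ⟨k, hk⟩ := exists_coord_ne_zero hs he hx
  let a₀ := he.coord le_rfl 0 (resMod E le_top s)
  let b₀ := he.coord le_rfl 1 (resMod E le_top s)
  have hinj : ∀ (V : X.Opens) (hV : x ∈ V), Function.Injective (X.presheaf.germ V x hV) :=
    fun V hV => germ_injective_of_isIntegral X x hV
  have h0 : X.presheaf.germ U x hx a₀ ≠ 0 ∨ X.presheaf.germ U x hx b₀ ≠ 0 := by
    match k, hk with
    | 0, hk => exact .inl fun h => hk (hinj U hx (h.trans (map_zero _).symm))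
    | 1, hk => exact .inr fun h => hk (hinj U hx (h.trans (map_zero _).symm))
  -- The common divisor is extracted in the factorial stalk at `x`, then extended to a
  -- neighbourhood.
  obtain ⟨d', a', b', hd', ha', hb', hk'⟩ := exists_koszulExact _ _ h0
  obtain ⟨V₁, hV₁, d₁, rfl⟩ := X.presheaf.exists_germ_eq d'
  obtain ⟨V₂, hV₂, a₁, rfl⟩ := X.presheaf.exists_germ_eq a'
  obtain ⟨V₃, hV₃, b₁, rfl⟩ := X.presheaf.exists_germ_eq b'
  obtain ⟨W, hW, hxW, hWU⟩ := exists_isAffineOpen_mem_and_subset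
    (x := x) (U := U ⊓ (V₁ ⊓ (V₂ ⊓ V₃))) ⟨hx, hV₁, hV₂, hV₃⟩
  have hWU : W ≤ U ⊓ (V₁ ⊓ (V₂ ⊓ V₃)) := hWU
  have i₀ : W ≤ U := hWU.trans inf_le_left
  have i₁ : W ≤ V₁ := (hWU.trans inf_le_right).trans inf_le_left
  have i₂ : W ≤ V₂ := (hWU.trans inf_le_right).trans (inf_le_right.trans inf_le_left)
  have i₃ : W ≤ V₃ := (hWU.trans inf_le_right).trans (inf_le_right.trans inf_le_right)
  let d := res X i₁ d₁
  let a := res X i₂ a₁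
  let b := res X i₃ b₁
  have gd : X.presheaf.germ W x hxW d = X.presheaf.germ V₁ x hV₁ d₁ := germ_res_apply' i₁ x hxW d₁
  have ga : X.presheaf.germ W x hxW a = X.presheaf.germ V₂ x hV₂ a₁ := germ_res_apply' i₂ x hxW a₁
  have gb : X.presheaf.germ W x hxW b = X.presheaf.germ V₃ x hV₃ b₁ := germ_res_apply' i₃ x hxW b₁
  -- The factorizations hold on all of `W`, because germs determine functions on an integral scheme.
  have ea : res X i₀ a₀ = d * a := hinj W hxW (by
    rw [map_mul, gd, ga, ← ha']; exact germ_res_apply' i₀ x hxW a₀)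
  have eb : res X i₀ b₀ = d * b := hinj W hxW (by
    rw [map_mul, gd, gb, ← hb']; exact germ_res_apply' i₀ x hxW b₀)
  have hne : Nonempty W := ⟨⟨x, hxW⟩⟩
  have : IsNoetherianRing Γ(X, W) := IsLocallyNoetherian.component_noetherian ⟨W, hW⟩
  let := X.presheaf.algebra_section_stalk ⟨x, hxW⟩
  have : IsLocalization.AtPrime (X.presheaf.stalk x) (hW.primeIdealOf ⟨x, hxW⟩).asIdeal :=
    hW.isLocalization_stalk ⟨x, hxW⟩
  -- Koszul exactness at `x` persists on a basic open neighbourhood `D(f)`.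
  obtain ⟨f, hf, hfk⟩ := KoszulExact.exists_of_localization (a := a) (b := b)
    (hW.primeIdealOf ⟨x, hxW⟩).asIdeal (S := X.presheaf.stalk x) (by
      change KoszulExact (X.presheaf.germ W x hxW a) (X.presheaf.germ W x hxW b)
      rwa [ga, gb])
  have hxf : x ∈ X.basicOpen f := by
    rw [X.mem_basicOpen f x hxW]
    exact IsLocalization.map_units (X.presheaf.stalk x)
      (⟨f, hf⟩ : (hW.primeIdealOf ⟨x, hxW⟩).asIdeal.primeCompl)
  have hd : d ∈ nonZeroDivisors Γ(X, W) := by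
    apply mem_nonZeroDivisors_of_ne_zero
    intro h
    apply hd'
    rw [← gd, h, map_zero]
  have hle := X.basicOpen_le f
  refine ⟨⟨X.basicOpen f, hW.basicOpen f⟩, hxf, ⟨⟨_, he.restrict (hle.trans i₀), res X hle d,
    res X hle a, res X hle b, ?_, ?_, ?_, ?_⟩⟩⟩
  · let := (res X (X.basicOpen_le f)).toAlgebra
    have := isLocalization_res hW f
    exact IsLocalization.map_nonZeroDivisors_le (.powers f) _ ⟨_, hd, rfl⟩
  · rw [he.coord_restrict, ← map_mul, ← ea, res_res]
    exact Eq.trans (by rw [resMod_resMod]) (he.coord_res le_rfl (hle.trans i₀) _ _)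
  · rw [he.coord_restrict, ← map_mul, ← eb, res_res]
    exact Eq.trans (by rw [resMod_resMod]) (he.coord_res le_rfl (hle.trans i₀) _ _)
  · let := (res X (X.basicOpen_le f)).toAlgebra
    have := isLocalization_res hW f
    exact KoszulExact.of_mem_of_isLocalization (.powers f) (Submonoid.mem_powers f) hfk

end GcdChart

/-! ### The divisorial and the residual ideal in a chart -/

section DivisorialPart

/-- In a factorial noetherian domain, prime elements generate primes of height one. -/
lemma height_span_singleton_of_prime {R : Type*} [CommRing R] [IsDomain R] [IsNoetherianRing R]
    {π : R} (hπ : Prime π) : (Ideal.span {π}).height = 1 := by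
  have hp : (Ideal.span {π}).IsPrime := (Ideal.span_singleton_prime hπ.ne_zero).mpr hπ
  refine le_antisymm ?_ ?_
  · refine Ideal.height_le_one_of_isPrincipal_of_mem_minimalPrimes (Ideal.span {π}) _ ?_
    rw [Ideal.minimalPrimes_eq_subsingleton_self]
    rfl
  · rw [Order.one_le_iff_ne_zero]
    intro h
    rw [Ideal.height_eq_zero_iff,
      IsDomain.minimalPrimes_eq_singleton_bot, Set.mem_singleton_iff,
      Ideal.span_singleton_eq_bot] at h
    exact hπ.ne_zero h

variable {X : Scheme.{u}} [IsIntegral X] [IsLocallyNoetherian X]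

/-- Divisibility is local, and in a factorial stalk it can be tested at the prime elements. A prime
element `π` of the stalk at `y` generates a prime of height one, whose contraction to `Γ(X, U)` is a
point `x` of codimension one. Divisibility at `x` holds up to a denominator prime to `π`. -/
lemma dvd_of_germ_dvd {U : X.Opens} (hU : IsAffineOpen U)
    (hX : ∀ x : X, UniqueFactorizationMonoid (X.presheaf.stalk x)) (d g : Γ(X, U)) (hd : d ≠ 0)
    (h : ∀ (x : X) (hx : x ∈ U), ringKrullDim (X.presheaf.stalk x) = 1 →
      X.presheaf.germ U x hx d ∣ X.presheaf.germ U x hx g) : d ∣ g := by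
  rw [← Ideal.mem_span_singleton, hU.mem_ideal_iff]
  intro y hy
  rw [Ideal.map_span, Set.image_singleton, Ideal.mem_span_singleton]
  have := hX y
  have hne : Nonempty U := ⟨⟨y, hy⟩⟩
  have hN : IsNoetherianRing Γ(X, U) := IsLocallyNoetherian.component_noetherian ⟨U, hU⟩
  refine dvd_of_forall_prime _ ?_ _ fun π hπ => ?_
  · exact fun h => hd (germ_injective_of_isIntegral X y hy (h.trans (map_zero _).symm))
  let := X.presheaf.algebra_section_stalk ⟨y, hy⟩
  have hloc : IsLocalization.AtPrime (X.presheaf.stalk y) (hU.primeIdealOf ⟨y, hy⟩).asIdeal :=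
    hU.isLocalization_stalk ⟨y, hy⟩
  have hNy : IsNoetherianRing (X.presheaf.stalk y) :=
    IsLocalization.isNoetherianRing (hU.primeIdealOf ⟨y, hy⟩).asIdeal.primeCompl _ hN
  have hp : (Ideal.span {π}).IsPrime := (Ideal.span_singleton_prime hπ.ne_zero).mpr hπ
  let q : Ideal Γ(X, U) := (Ideal.span {π}).comap (X.presheaf.germ U y hy).hom
  have hq : q.IsPrime := Ideal.comap_isPrime _ _
  have hqh : q.height = 1 := by
    rw [← height_span_singleton_of_prime hπ]
    exact IsLocalization.height_under (hU.primeIdealOf ⟨y, hy⟩).asIdeal.primeCompl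
      (Ideal.span {π})
  let x : X := hU.fromSpec ⟨q, hq⟩
  have hx : x ∈ U := hU.range_fromSpec.le (Set.mem_range_self _)
  let := X.presheaf.algebra_section_stalk ⟨x, hx⟩
  have hlocx : IsLocalization.AtPrime (X.presheaf.stalk x) q :=
    hU.isLocalization_stalk' ⟨q, hq⟩ hx
  have hdim : ringKrullDim (X.presheaf.stalk x) = 1 := by
    rw [IsLocalization.AtPrime.ringKrullDim_eq_height q, hqh]; rfl
  obtain ⟨r, hr⟩ := h x hx hdim
  obtain ⟨⟨r', t⟩, hrt⟩ := IsLocalization.surj q.primeCompl r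
  refine ⟨X.presheaf.germ U y hy t.1, fun h => t.2 (Ideal.mem_span_singleton.mpr h), ?_⟩
  -- Clearing the denominator of the quotient at `x` gives an identity over `U`, which can then be
  -- read at `y`.
  have h1 : t.1 * g = d * r' := by
    apply germ_injective_of_isIntegral X x hx
    rw [map_mul, map_mul, hr]
    have : r * X.presheaf.germ U x hx t.1 = X.presheaf.germ U x hx r' := hrt
    rw [← this]
    ring
  rw [← map_mul, h1, map_mul]
  exact dvd_mul_right _ _

variable {E : X.Modules} {s : Γ(E, ⊤)}

/-- The affine opens over which there is a chart. -/
def gcdOpens (E : X.Modules) (s : Γ(E, ⊤)) : Set X.affineOpens :=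
  {U | Nonempty (GcdChart E s (⟨U.1, U.2⟩ : X.AffineZariskiSite))}

lemma affineBasicOpen_mem_gcdOpens {X : Scheme.{u}} {E : X.Modules} {s : Γ(E, ⊤)}
    (U : X.affineOpens) (hU : U ∈ gcdOpens E s) (f : Γ(X, U.1)) :
    X.affineBasicOpen f ∈ gcdOpens E s := by
  obtain ⟨c⟩ := hU
  exact ⟨c.basicOpen f⟩

variable [IsRankTwoBundle E]

/-- An element of the left side is divisible by `d` at every point of codimension one, hence over
`U`. Conversely, at such a point the Koszul exact pair contains a unit, so the ideal of `Z(s)` is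
already generated by `d` there. -/
lemma iInf_comap_germ_eq (hX : ∀ x : X, UniqueFactorizationMonoid (X.presheaf.stalk x))
    {U : X.AffineZariskiSite} (c : GcdChart E s U) :
    ⨅ (x : X) (hx : x ∈ U.toOpens) (_ : ringKrullDim (X.presheaf.stalk x) = 1),
      (((zeroIdeal E s).ideal ⟨U.toOpens, U.2⟩).map (X.presheaf.germ U.toOpens x hx).hom).comap
        (X.presheaf.germ U.toOpens x hx).hom = Ideal.span {c.d} := by
  have hmap : ∀ (x : X) (hx : x ∈ U.toOpens),
      ((zeroIdeal E s).ideal ⟨U.toOpens, U.2⟩).map (X.presheaf.germ U.toOpens x hx).hom =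
      Ideal.span {X.presheaf.germ U.toOpens x hx c.d * X.presheaf.germ U.toOpens x hx c.a,
        X.presheaf.germ U.toOpens x hx c.d * X.presheaf.germ U.toOpens x hx c.b} := by
    intro x hx
    rw [c.zeroIdeal_ideal, Ideal.map_span, Set.image_pair]
    simp only [map_mul]
  refine le_antisymm (fun g hg => ?_) ?_
  · rw [Ideal.mem_span_singleton]
    -- The empty open set is treated apart, since its ring of functions is zero and `d ≠ 0` fails.
    rcases (U.toOpens : Set X).eq_empty_or_nonempty with h | ⟨y, hy⟩
    · have : U.toOpens = ⊥ := Opens.ext h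
      have : Subsingleton Γ(X, U.toOpens) := by rw [this]; infer_instance
      rw [Subsingleton.elim g 0]
      exact dvd_zero _
    have hne : Nonempty U.toOpens := ⟨⟨y, hy⟩⟩
    refine dvd_of_germ_dvd U.2 hX _ _ (nonZeroDivisors.ne_zero c.hd) fun x hx hdim => ?_
    simp only [Ideal.mem_iInf] at hg
    have := hg x hx hdim
    rw [Ideal.mem_comap, hmap, Ideal.mem_span_pair] at this
    obtain ⟨v, w, h⟩ := this
    exact ⟨v * X.presheaf.germ U.toOpens x hx c.a + w * X.presheaf.germ U.toOpens x hx c.b, by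
      refine h.symm.trans ?_
      ring⟩
  · rw [Ideal.span_singleton_le_iff_mem]
    simp only [Ideal.mem_iInf]
    intro x hx hdim
    rw [Ideal.mem_comap, hmap]
    have hk : KoszulExact (X.presheaf.germ U.toOpens x hx c.a)
        (X.presheaf.germ U.toOpens x hx c.b) := by
      let := X.presheaf.algebra_section_stalk ⟨x, hx⟩
      have hloc : IsLocalization.AtPrime (X.presheaf.stalk x) (U.2.primeIdealOf ⟨x, hx⟩).asIdeal :=
        U.2.isLocalization_stalk ⟨x, hx⟩
      exact c.koszul.of_isLocalization (U.2.primeIdealOf ⟨x, hx⟩).asIdeal.primeCompl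
    have : Ring.KrullDimLE 1 (X.presheaf.stalk x) := by
      rw [Ring.krullDimLE_iff, hdim]; rfl
    rcases hk.isUnit_or_isUnit with h | h
    · refine Ideal.mem_of_dvd _ ?_ (Ideal.subset_span (Set.mem_insert _ _))
      exact h.mul_right_dvd.mpr dvd_rfl
    · refine Ideal.mem_of_dvd _ ?_ (Ideal.subset_span (Set.mem_insert_of_mem _ rfl))
      exact h.mul_right_dvd.mpr dvd_rfl

/-- `ofIdeals` is the largest ideal sheaf inside a family of ideals, and may be smaller than the
family. Over charts the family is `(d)`, hence compatible with restriction; the ideal sheaf glued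
there has the prescribed germ condition on all affine opens, so it is this largest one. -/
theorem GcdChart.divisorialPart_ideal
    (hX : ∀ x : X, UniqueFactorizationMonoid (X.presheaf.stalk x)) (hs : s ≠ 0)
    {U : X.AffineZariskiSite} (c : GcdChart E s U) :
    (divisorialPart (zeroIdeal E s)).ideal ⟨U.toOpens, U.2⟩ = Ideal.span {c.d} := by
  let K (U : X.affineOpens) : Ideal Γ(X, U) :=
    ⨅ (x : X) (hx : x ∈ U.1) (_ : ringKrullDim (X.presheaf.stalk x) = 1),
    (((zeroIdeal E s).ideal U).map (X.presheaf.germ U.1 x hx).hom).comap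
      (X.presheaf.germ U.1 x hx).hom
  have hcov : ∀ x, ∃ U ∈ gcdOpens E s, x ∈ U.1 := fun x => by
    have := hX x
    obtain ⟨U, hx, hc⟩ := exists_gcdChart (E := E) x hs
    exact ⟨⟨U.toOpens, U.2⟩, hc, hx⟩
  obtain ⟨Z, hZ⟩ := exists_idealSheafData (gcdOpens E s) K hcov affineBasicOpen_mem_gcdOpens (by
    rintro U ⟨c⟩ f
    refine Eq.trans ?_ (iInf_comap_germ_eq hX (c.basicOpen f)).symm
    exact map_eq_span_singleton _ (iInf_comap_germ_eq hX c) rfl)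
  have hF : divisorialPart (zeroIdeal E s) = Z := by
    refine le_antisymm ?_ ?_
    · refine Scheme.IdealSheafData.le_of_iSup_eq_top (fun U : gcdOpens E s => U.1) ?_ fun U => ?_
      · refine eq_top_iff.mpr fun x _ => ?_
        obtain ⟨U, hU, hx⟩ := hcov x
        exact Opens.mem_iSup.mpr ⟨⟨U, hU⟩, hx⟩
      · rw [hZ U.1 U.2]
        exact Scheme.IdealSheafData.ideal_ofIdeals_le _ _
    · refine Scheme.IdealSheafData.le_ofIdeals_iff.mpr fun V g hg => ?_
      simp only [Ideal.mem_iInf]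
      intro x hx hdim
      obtain ⟨U, hU, hxU⟩ := hcov x
      rw [Ideal.mem_comap, map_germ_ideal_eq _ V U x hx hxU]
      have h1 := Ideal.mem_map_of_mem (X.presheaf.germ V.1 x hx).hom hg
      rw [map_germ_ideal_eq _ V U x hx hxU, hZ U hU] at h1
      refine (Ideal.map_le_iff_le_comap.mpr fun a ha => ?_) h1
      simp only [K, Ideal.mem_iInf] at ha
      exact ha x hxU hdim
  rw [hF]
  exact (hZ _ ⟨c⟩).trans (iInf_comap_germ_eq hX c)

/-- Locally this is `(d (a, b) : d) = (a, b)`. A colon ideal is intrinsic, so the ideals of the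
various charts agree on overlaps and glue. -/
theorem GcdChart.residualPart_ideal
    (hX : ∀ x : X, UniqueFactorizationMonoid (X.presheaf.stalk x)) (hs : s ≠ 0)
    {U : X.AffineZariskiSite} (c : GcdChart E s U) :
    (residualPart (zeroIdeal E s)).ideal ⟨U.toOpens, U.2⟩ = Ideal.span {c.a, c.b} := by
  have hcov : ∀ x, ∃ U ∈ gcdOpens E s, x ∈ U.1 := fun x => by
    have := hX x
    obtain ⟨U, hx, hc⟩ := exists_gcdChart (E := E) x hs
    exact ⟨⟨U.toOpens, U.2⟩, hc, hx⟩
  let I := zeroIdeal E s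
  let F := divisorialPart I
  have hcolon : ∀ {U : X.AffineZariskiSite} (c : GcdChart E s U) (L : Ideal Γ(X, U.toOpens)),
      L * F.ideal ⟨U.toOpens, U.2⟩ ≤ I.ideal ⟨U.toOpens, U.2⟩ ↔ L ≤ Ideal.span {c.a, c.b} := by
    intro U c L
    rw [c.divisorialPart_ideal hX hs]
    refine colon_span_singleton c.hd _ _ ?_ L
    rw [c.zeroIdeal_ideal, Ideal.span_mul_span', Set.singleton_mul, Set.image_pair]
  let K (U : X.affineOpens) : Ideal Γ(X, U) := sSup {L | L * F.ideal U ≤ I.ideal U}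
  have hK : ∀ {U : X.AffineZariskiSite} (c : GcdChart E s U),
      K ⟨U.toOpens, U.2⟩ = Ideal.span {c.a, c.b} := fun c =>
    le_antisymm (sSup_le fun L hL => (hcolon c L).mp hL) (le_sSup ((hcolon c _).mpr le_rfl))
  obtain ⟨Z, hZ⟩ := exists_idealSheafData (gcdOpens E s) K hcov affineBasicOpen_mem_gcdOpens (by
    rintro U ⟨c⟩ f
    refine Eq.trans ?_ (hK (c.basicOpen f)).symm
    refine (congrArg (Ideal.map _) (hK c)).trans ((Ideal.map_span _ _).trans ?_)
    rw [Set.image_pair]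
    rfl)
  have htop : ⨆ U : gcdOpens E s, U.1.1 = ⊤ := by
    refine eq_top_iff.mpr fun x _ => ?_
    obtain ⟨U, hU, hx⟩ := hcov x
    exact Opens.mem_iSup.mpr ⟨⟨U, hU⟩, hx⟩
  -- Products and inclusions of ideal sheaves are tested on the charts, so the glued sheaf is the
  -- largest ideal sheaf in the defining family.
  have hres : residualPart I = Z := by
    refine le_antisymm (sSup_le fun L hL => ?_) (le_sSup ?_)
    · refine Scheme.IdealSheafData.le_of_iSup_eq_top (fun U : gcdOpens E s => U.1) htop fun U => ?_
      rw [hZ U.1 U.2]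
      exact le_sSup (hL U.1)
    · refine Scheme.IdealSheafData.le_of_iSup_eq_top (fun U : gcdOpens E s => U.1) htop fun U => ?_
      obtain ⟨U, ⟨c⟩⟩ := U
      refine (hcolon c _).mpr ?_
      exact ((hZ U ⟨c⟩).trans (hK c)).le
  rw [hres]
  exact (hZ _ ⟨c⟩).trans (hK c)

end DivisorialPart

/-! ### The two components of the zero scheme -/

section Components
open Polynomial

lemma C_mem_nonZeroDivisors {R : Type*} [CommRing R] {d : R} (hd : d ∈ nonZeroDivisors R) :
    C d ∈ nonZeroDivisors R[X] := by
  rw [mem_nonZeroDivisors_iff_right] at hd ⊢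
  intro p hp
  ext n
  rw [coeff_zero]
  refine hd _ ?_
  have := congrArg (coeff · n) hp
  simpa using this

lemma mem_nonZeroDivisors_of_injective {R S : Type*} [CommRing R] [CommRing S] (φ : R →+* S)
    (hφ : Function.Injective φ) {x : R} (hx : φ x ∈ nonZeroDivisors S) : x ∈ nonZeroDivisors R := by
  rw [mem_nonZeroDivisors_iff_right] at hx ⊢
  intro y hy
  apply hφ
  rw [map_zero]
  exact hx _ (by rw [← map_mul, hy, map_zero])

lemma res_mem_nonZeroDivisors {P : Scheme.{u}} {V : P.Opens} (hV : IsAffineOpen V) (f : Γ(P, V))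
    {d : Γ(P, V)} (hd : d ∈ nonZeroDivisors Γ(P, V)) :
    res P (P.basicOpen_le f) d ∈ nonZeroDivisors Γ(P, P.basicOpen f) := by
  let := (res P (P.basicOpen_le f)).toAlgebra
  have := isLocalization_res hV f
  exact IsLocalization.map_nonZeroDivisors_le (.powers f) _ ⟨_, hd, rfl⟩

/-- The residual of the closed subscheme defined by `I` with respect to the effective Cartier
divisor defined by `F`, locally described. -/
theorem exists_residual {P : Scheme.{u}} (I F : P.IdealSheafData)
    (h : ∀ x : P, ∃ (R : CommRingCat.{u}) (c : Spec R ⟶ P), IsOpenImmersion c ∧ x ∈ Set.range c ∧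
      ∃ d ∈ nonZeroDivisors R, ∃ w : R, pullIdeal I c = Ideal.span {d * w} ∧
        pullIdeal F c = Ideal.span {d}) :
    ∃ W : P.IdealSheafData, ∀ (R : CommRingCat.{u}) (c : Spec R ⟶ P) [IsOpenImmersion c]
      (d w : R), d ∈ nonZeroDivisors R → pullIdeal I c = Ideal.span {d * w} →
        pullIdeal F c = Ideal.span {d} → pullIdeal W c = Ideal.span {w} := by
  let Q (V : P.affineOpens) (d w : Γ(P, V.1)) : Prop := d ∈ nonZeroDivisors Γ(P, V.1) ∧
    I.ideal V = Ideal.span {d * w} ∧ F.ideal V = Ideal.span {d}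
  -- The colon ideal `(I : F)` does not involve the chosen generators, which makes the ideals `(w)`
  -- compatible and gives the conclusion for every chart.
  let K (V : P.affineOpens) : Ideal Γ(P, V.1) := sSup {L | L * F.ideal V ≤ I.ideal V}
  let N : Set P.affineOpens := {V | ∃ d w, Q V d w}
  have hK : ∀ V d w, Q V d w → K V = Ideal.span {w} := by
    rintro V d w ⟨hd, hI, hF⟩
    have key : ∀ L, L * F.ideal V ≤ I.ideal V ↔ L ≤ Ideal.span {w} := fun L => by
      rw [hF]
      exact colon_span_singleton hd _ _ (by rw [hI, Ideal.span_singleton_mul_span_singleton]) L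
    exact le_antisymm (sSup_le fun L hL => (key L).mp hL) (le_sSup ((key _).mpr le_rfl))
  have hQ : ∀ V d w, Q V d w → ∀ f : Γ(P, V.1), Q (P.affineBasicOpen f)
      (res P (P.basicOpen_le f) d) (res P (P.basicOpen_le f) w) := by
    rintro V d w ⟨hd, hI, hF⟩ f
    refine ⟨?_, ?_, ?_⟩
    · exact res_mem_nonZeroDivisors V.2 f hd
    · rw [← I.map_ideal_basicOpen V f]
      exact map_eq_span_singleton _ hI (map_mul (res P (P.basicOpen_le f)) _ _)
    · rw [← F.map_ideal_basicOpen V f]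
      exact map_eq_span_singleton _ hF rfl
  have hchart : ∀ (R : CommRingCat.{u}) (c : Spec R ⟶ P) [IsOpenImmersion c]
      (φ : Γ(P, c.opensRange) ≅ R)
      (_ : c = Spec.map φ.hom ≫ (isAffineOpen_opensRange c).fromSpec)
      (d w : R), d ∈ nonZeroDivisors R → pullIdeal I c = Ideal.span {d * w} →
        pullIdeal F c = Ideal.span {d} →
        Q ⟨c.opensRange, isAffineOpen_opensRange c⟩ (φ.inv d) (φ.inv w) := by
    intro R c _ φ hφ d w hd hI hF
    rw [pullIdeal_eq_map _ _ _ _ hφ] at hI hF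
    have hinv : ∀ z, φ.hom (φ.inv z) = z := fun z => congr($(φ.inv_hom_id) z)
    refine ⟨?_, ?_, ?_⟩
    · refine mem_nonZeroDivisors_of_injective φ.hom.hom
        (ConcreteCategory.bijective_of_isIso φ.hom).1 ?_
      exact (hinv d).symm ▸ hd
    · refine map_injective_of_isIso φ.hom (hI.trans (map_eq_span_singleton _ rfl ?_).symm)
      refine (map_mul φ.hom.hom _ _).trans (congrArg₂ (· * ·) (hinv d) (hinv w))
    · exact map_injective_of_isIso φ.hom (hF.trans (map_eq_span_singleton _ rfl (hinv d)).symm)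
  obtain ⟨W, hW⟩ := exists_idealSheafData N K (fun x => by
    obtain ⟨R, c, hc, hx, d, hd, w, hI, hF⟩ := h x
    obtain ⟨φ, hφ⟩ := exists_iso_fromSpec c
    exact ⟨_, ⟨_, _, hchart R c φ hφ d w hd hI hF⟩, hx⟩) (fun V hV f => by
      obtain ⟨d, w, h⟩ := hV
      exact ⟨_, _, hQ V d w h f⟩) (fun V hV f => by
      obtain ⟨d, w, h⟩ := hV
      refine Eq.trans ?_ (hK _ _ _ (hQ V d w h f)).symm
      exact map_eq_span_singleton _ (hK V d w h) rfl)
  refine ⟨W, fun R c _ d w hd hI hF => ?_⟩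
  obtain ⟨φ, hφ⟩ := exists_iso_fromSpec c
  have hq := hchart R c φ hφ d w hd hI hF
  rw [pullIdeal_eq_map _ _ _ _ hφ]
  exact map_eq_span_singleton _ ((hW _ ⟨_, _, hq⟩).trans (hK _ _ _ hq)) congr($(φ.inv_hom_id) w)

variable {X : Scheme.{u}} {E : X.Modules} [IsRankTwoBundle E] {s : Γ(E, ⊤)}

lemma GcdChart.pullIdeal_zeroIdeal_twist {U : X.AffineZariskiSite} (c : GcdChart E s U) :
    pullIdeal (zeroIdeal (twist E) (twistSection E s)) (chart c.he) =
      Ideal.span {C c.d * (C c.a + C c.b * Polynomial.X)} := by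
  rw [ProjBundle.pullIdeal_zeroIdeal_twist, c.coord_zero, c.coord_one]
  congr 2
  rw [map_mul, map_mul]
  ring

lemma pullIdeal_comap_chart (F : X.IdealSheafData) {U : X.AffineZariskiSite}
    {e : Fin 2 → Γ(E, U.toOpens)} (he : IsFrame E U.toOpens e) :
    pullIdeal (F.comap (projBundleπ E)) (chart he) =
      (F.ideal ⟨U.toOpens, U.2⟩).map (C : Γ(X, U.toOpens) →+* Γ(X, U.toOpens)[X]) := by
  rw [pullIdeal_comap, chart_projBundleπ, pullIdeal_specMap_comp, pullIdeal_fromSpec]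
  rfl

variable [IsIntegral X] [IsLocallyNoetherian X]

lemma GcdChart.pullIdeal_divisorialPart
    (hX : ∀ x : X, UniqueFactorizationMonoid (X.presheaf.stalk x)) (hs : s ≠ 0)
    {U : X.AffineZariskiSite} (c : GcdChart E s U) :
    pullIdeal ((divisorialPart (zeroIdeal E s)).comap (projBundleπ E)) (chart c.he) =
      Ideal.span {C c.d} :=
  (pullIdeal_comap_chart _ _).trans
    (map_eq_span_singleton _ (c.divisorialPart_ideal hX hs) rfl)

lemma exists_gcdChart_chart (hX : ∀ x : X, UniqueFactorizationMonoid (X.presheaf.stalk x))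
    (hs : s ≠ 0) (x : projBundle E) :
    ∃ (U : X.AffineZariskiSite) (c : GcdChart E s U),
      projBundleπ E x ∈ U.toOpens ∧ x ∈ Set.range (chart c.he) := by
  have := hX (projBundleπ E x)
  obtain ⟨U, hx, ⟨c⟩⟩ := exists_gcdChart (E := E) (projBundleπ E x) hs
  rcases mem_opensRange_chart_or c.he x hx with h | h
  · exact ⟨U, c, hx, h⟩
  · exact ⟨U, c.swap, hx, h⟩

/-- `W` is the residual of the zero scheme with respect to the inverse image of the divisorial part.
As the zero scheme is `d (a + b X)` on charts, dividing by `d` leaves `a + b X`, and the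
intersection formula for `d` and `a + b X` gives the decomposition. -/
theorem exists_component (hX : ∀ x : X, UniqueFactorizationMonoid (X.presheaf.stalk x))
    (hs : s ≠ 0) :
    ∃ W : (projBundle E).IdealSheafData,
      (∀ (U : X.AffineZariskiSite) (c : GcdChart E s U),
        pullIdeal W (chart c.he) = Ideal.span {C c.a + C c.b * Polynomial.X}) ∧
      zeroIdeal (twist E) (twistSection E s) =
        W ⊓ (divisorialPart (zeroIdeal E s)).comap (projBundleπ E) := by
  obtain ⟨W, hW⟩ := exists_residual (zeroIdeal (twist E) (twistSection E s))
    ((divisorialPart (zeroIdeal E s)).comap (projBundleπ E)) (fun x => by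
      obtain ⟨U, c, -, hx⟩ := exists_gcdChart_chart hX hs x
      exact ⟨_, chart c.he, inferInstance, hx, _, C_mem_nonZeroDivisors c.hd, _,
        c.pullIdeal_zeroIdeal_twist, c.pullIdeal_divisorialPart hX hs⟩)
  have hW' : ∀ (U : X.AffineZariskiSite) (c : GcdChart E s U),
      pullIdeal W (chart c.he) = Ideal.span {C c.a + C c.b * Polynomial.X} := fun U c =>
    hW _ (chart c.he) _ _ (C_mem_nonZeroDivisors c.hd) c.pullIdeal_zeroIdeal_twist
      (c.pullIdeal_divisorialPart hX hs)
  refine ⟨W, hW', eq_of_pullIdeal_eq fun x => ?_⟩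
  obtain ⟨U, c, hU, hx⟩ := exists_gcdChart_chart hX hs x
  refine ⟨_, chart c.he, inferInstance, hx, ?_⟩
  have hne : Nonempty U.toOpens := ⟨⟨_, hU⟩⟩
  rw [pullIdeal_inf, hW', c.pullIdeal_zeroIdeal_twist, c.pullIdeal_divisorialPart hX hs, inf_comm]
  exact (c.koszul.span_inf_span (nonZeroDivisors.ne_zero c.hd)).symm

end Components

/-! ### The universal property of the blow-up -/

section Blowup
open Polynomial

lemma isEffectiveCartier_of_chart {P : Scheme.{u}} (I : P.IdealSheafData)
    (h : ∀ x : P, ∃ (R : CommRingCat.{u}) (c : Spec R ⟶ P), IsOpenImmersion c ∧ x ∈ Set.range c ∧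
      ∃ t ∈ nonZeroDivisors R, pullIdeal I c = Ideal.span {t}) : IsEffectiveCartier I := by
  intro x
  obtain ⟨R, c, hc, hx, t, ht, hI⟩ := h x
  obtain ⟨φ, hφ⟩ := exists_iso_fromSpec c
  rw [pullIdeal_eq_map _ _ _ _ hφ] at hI
  have hinv : φ.hom (φ.inv t) = t := congr($(φ.inv_hom_id) t)
  refine ⟨⟨c.opensRange, isAffineOpen_opensRange c⟩, hx, φ.inv t, ?_, ?_⟩
  · refine mem_nonZeroDivisors_of_injective φ.hom.hom
      (ConcreteCategory.bijective_of_isIso φ.hom).1 ?_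
    exact hinv.symm ▸ ht
  · exact map_injective_of_isIso φ.hom (hI.trans (map_eq_span_singleton _ rfl hinv).symm)

lemma IsEffectiveCartier.exists_affine_le {T : Scheme.{u}} {I : T.IdealSheafData}
    (hI : IsEffectiveCartier I) (x : T) (W : T.Opens) (hx : x ∈ W) :
    ∃ V : T.affineOpens, x ∈ V.1 ∧ V.1 ≤ W ∧
      ∃ t ∈ nonZeroDivisors Γ(T, V.1), I.ideal V = Ideal.span {t} := by
  obtain ⟨V, hxV, t, ht, h⟩ := hI x
  obtain ⟨r, hr, hxr⟩ := V.2.exists_basicOpen_le ⟨x, hx⟩ hxV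
  refine ⟨T.affineBasicOpen r, hxr, hr, res T (T.basicOpen_le r) t,
    res_mem_nonZeroDivisors V.2 r ht, ?_⟩
  rw [← I.map_ideal_basicOpen V r]
  exact map_eq_span_singleton _ h rfl

lemma IsEffectiveCartier.comap {S T : Scheme.{u}} {I : T.IdealSheafData}
    (hI : IsEffectiveCartier I) (j : S ⟶ T) [IsOpenImmersion j] :
    IsEffectiveCartier (I.comap j) := by
  refine isEffectiveCartier_of_chart _ fun y => ?_
  obtain ⟨V, hyV, hV, t, ht, h⟩ := hI.exists_affine_le (j y) j.opensRange ⟨y, rfl⟩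
  have hVa : IsAffineOpen V.1 := V.2
  have hr : Set.range hVa.fromSpec ⊆ Set.range j := by rw [hVa.range_fromSpec]; exact hV
  have hlift := IsOpenImmersion.lift_fac j hVa.fromSpec hr
  have hoi : IsOpenImmersion (IsOpenImmersion.lift j hVa.fromSpec hr) := by
    have : IsOpenImmersion (IsOpenImmersion.lift j hVa.fromSpec hr ≫ j) :=
      hlift.symm ▸ inferInstance
    exact .of_comp _ j
  refine ⟨_, IsOpenImmersion.lift j hVa.fromSpec hr, hoi, ?_, t, ht, ?_⟩
  · have : j y ∈ Set.range hVa.fromSpec := by rw [hVa.range_fromSpec]; exact hyV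
    obtain ⟨z, hz⟩ := this
    refine ⟨z, j.isOpenEmbedding.injective ?_⟩
    rw [← hz, ← Scheme.Hom.comp_apply, hlift]
  · rw [pullIdeal_comap, hlift, pullIdeal_fromSpec]
    exact h

/-- Writing `t = v a + w b = t (v α + w β)` and cancelling `t` shows that the quotients generate the
unit ideal. -/
lemma exists_isUnit_of_span_pair {B : Type*} [CommRing B] {t a b : B}
    (ht : t ∈ nonZeroDivisors B) (h : Ideal.span {a, b} = Ideal.span {t}) :
    ∃ α β v w, a = t * α ∧ b = t * β ∧ v * α + w * β = 1 := by
  obtain ⟨α, hα⟩ : t ∣ a := Ideal.mem_span_singleton.mp (h ▸ Ideal.subset_span (by simp))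
  obtain ⟨β, hβ⟩ : t ∣ b := Ideal.mem_span_singleton.mp (h ▸ Ideal.subset_span (by simp))
  have h1 : t ∈ Ideal.span {a, b} := h ▸ Ideal.mem_span_singleton_self t
  obtain ⟨v, w, hvw⟩ := Ideal.mem_span_pair.mp h1
  refine ⟨α, β, v, w, hα, hβ, ?_⟩
  rw [mem_nonZeroDivisors_iff_right] at ht
  refine sub_eq_zero.mp (ht _ ?_)
  linear_combination hvw - v * hα - w * hβ

variable {X : Scheme.{u}} {E : X.Modules} [IsRankTwoBundle E] {s : Γ(E, ⊤)}

lemma exists_specMap_chart {U : X.AffineZariskiSite} {e : Fin 2 → Γ(E, U.toOpens)}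
    (he : IsFrame E U.toOpens e) {B : CommRingCat.{u}} (φ : Γ(X, U.toOpens) ⟶ B)
    (h : Spec B ⟶ projBundle E) (hπ : h ≫ projBundleπ E = Spec.map φ ≫ U.2.fromSpec)
    (hr : Set.range h ⊆ Set.range (chart he)) :
    ∃ ψ : CommRingCat.of Γ(X, U.toOpens)[X] ⟶ B, h = Spec.map ψ ≫ chart he ∧
      ∀ r, ψ (C r) = φ r := by
  refine ⟨Spec.preimage (IsOpenImmersion.lift (chart he) h hr), ?_, fun r => ?_⟩
  · rw [Spec.map_preimage, IsOpenImmersion.lift_fac]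
  · have h1 : Spec.map (CommRingCat.ofHom (C : Γ(X, U.toOpens) →+* Γ(X, U.toOpens)[X]) ≫
        Spec.preimage (IsOpenImmersion.lift (chart he) h hr)) = Spec.map φ := by
      rw [← cancel_mono U.2.fromSpec, ← hπ, Spec.map_comp, Spec.map_preimage, Category.assoc,
        ← chart_projBundleπ he, IsOpenImmersion.lift_fac_assoc]
    exact congr($(Spec.map_injective h1) r)

variable {W : (projBundle E).IdealSheafData}

/-- A lift through a chart satisfies the equation that defines the closed subscheme. -/
lemma GcdChart.specMap_chart_eq {U : X.AffineZariskiSite} (c : GcdChart E s U)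
    (hW : pullIdeal W (chart c.he) = Ideal.span {C c.a + C c.b * Polynomial.X})
    {B : CommRingCat.{u}} (φ : Γ(X, U.toOpens) ⟶ B)
    (ψ : CommRingCat.of Γ(X, U.toOpens)[X] ⟶ B) (hψ : ∀ r, ψ (C r) = φ r)
    (h : pullIdeal W (Spec.map ψ ≫ chart c.he) = ⊥)
    {t α β : B} (ht : t ∈ nonZeroDivisors B) (hα : φ c.a = t * α) (hβ : φ c.b = t * β) :
    α + β * ψ (Polynomial.X : Γ(X, U.toOpens)[X]) = 0 := by
  rw [pullIdeal_specMap_comp] at h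
  have h1 := (map_eq_span_singleton ψ.hom hW rfl).symm.trans h
  rw [Ideal.span_singleton_eq_bot] at h1
  have h2 : φ c.a + φ c.b * ψ (Polynomial.X : Γ(X, U.toOpens)[X]) = 0 := by
    rw [← hψ, ← hψ]
    refine Eq.trans ?_ h1
    refine Eq.trans ?_ (map_add ψ.hom _ _).symm
    exact congrArg _ (map_mul ψ.hom _ _).symm
  rw [mem_nonZeroDivisors_iff_right] at ht
  refine ht _ ?_
  rw [hα, hβ] at h2
  linear_combination h2

/-- A lift through the line satisfies `t (α + β X) = 0`, so `X` goes to `-α / β`; this value also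
defines a lift. The work lies in showing that every lift stays in this line. At a point seen in the
other line, with coordinate `Y`, the equation `β + α Y = 0` makes `Y` invertible, so the point lies
in both lines. -/
theorem GcdChart.existsUnique_lift {U : X.AffineZariskiSite} (c : GcdChart E s U)
    (hW : pullIdeal W (chart c.he) = Ideal.span {C c.a + C c.b * Polynomial.X})
    (hW' : pullIdeal W (chart c.swap.he) = Ideal.span {C c.b + C c.a * Polynomial.X})
    {B : CommRingCat.{u}} (φ : Γ(X, U.toOpens) ⟶ B) {t α β : B} (ht : t ∈ nonZeroDivisors B)
    (hα : φ c.a = t * α) (hβ : φ c.b = t * β) (hu : IsUnit β) :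
    ∃! g : Spec B ⟶ W.subscheme,
      g ≫ W.subschemeι ≫ projBundleπ E = Spec.map φ ≫ U.2.fromSpec := by
  obtain ⟨γ, hγ⟩ := hu.exists_right_inv
  have key : ∀ h : Spec B ⟶ projBundle E, pullIdeal W h = ⊥ →
      h ≫ projBundleπ E = Spec.map φ ≫ U.2.fromSpec →
      ∃ ψ : CommRingCat.of Γ(X, U.toOpens)[X] ⟶ B, h = Spec.map ψ ≫ chart c.he ∧
      (∀ r, ψ (C r) = φ r) ∧ ψ (Polynomial.X : Γ(X, U.toOpens)[X]) = -(α * γ) := by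
    intro h h0 hπ
    have hr : Set.range h ⊆ Set.range (chart c.he) := by
      rintro _ ⟨p, rfl⟩
      have hpU : projBundleπ E (h p) ∈ U.toOpens := by
        rw [← Scheme.Hom.comp_apply, hπ]
        exact U.2.range_fromSpec.le ⟨_, rfl⟩
      rcases mem_opensRange_chart_or c.he (h p) hpU with hp | hp
      · exact hp
      have hprime : p.asIdeal.IsPrime := p.isPrime
      -- A lift is known to meet the other line only at `p`. Localization at `p` makes it factor
      -- through that line, since an open set containing the closed point of a local scheme is
      -- everything.
      let L := CommRingCat.of (Localization.AtPrime p.asIdeal)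
      let ℓ : B ⟶ L := CommRingCat.ofHom (algebraMap B (Localization.AtPrime p.asIdeal))
      let cp : Spec L := IsLocalRing.closedPoint (Localization.AtPrime p.asIdeal)
      have hcl : Spec.map ℓ cp = p :=
        PrimeSpectrum.ext (IsLocalization.AtPrime.under_maximalIdeal _ p.asIdeal)
      have hr' : Set.range (Spec.map ℓ ≫ h) ⊆ Set.range (chart c.swap.he) := by
        have : (Spec.map ℓ ≫ h) ⁻¹ᵁ (chart c.swap.he).opensRange = ⊤ := by
          refine IsLocalRing.closed_point_mem_iff.mp ?_
          change (Spec.map ℓ ≫ h) cp ∈ (chart c.swap.he).opensRange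
          rw [Scheme.Hom.comp_apply, hcl]
          exact hp
        rintro _ ⟨q, rfl⟩
        exact this.ge (Set.mem_univ q)
      obtain ⟨ψ, hψ, hψC⟩ := exists_specMap_chart c.swap.he (φ ≫ ℓ) (Spec.map ℓ ≫ h)
        (by rw [Category.assoc, hπ, Spec.map_comp, Category.assoc]) hr'
      have htL : ℓ t ∈ nonZeroDivisors L :=
        IsLocalization.map_nonZeroDivisors_le p.asIdeal.primeCompl _ ⟨_, ht, rfl⟩
      have heq := c.swap.specMap_chart_eq hW' (φ ≫ ℓ) ψ hψC
        (by rw [← hψ, pullIdeal_specMap_comp, h0, Ideal.map_bot]) htL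
        ((congrArg ℓ hβ).trans (map_mul ℓ.hom _ _))
        ((congrArg ℓ hα).trans (map_mul ℓ.hom _ _))
      have hX : IsUnit (ψ (Polynomial.X : Γ(X, U.toOpens)[X])) := by
        have h1 : IsUnit (ℓ β) := hu.map ℓ.hom
        have h2 : ℓ β = -(ℓ α) * ψ (Polynomial.X : Γ(X, U.toOpens)[X]) := by
          linear_combination heq
        exact isUnit_of_mul_isUnit_right (h2 ▸ h1)
      have h3 := chart_mem_opensRange_swap c.swap.he
        (Spec.map ψ cp) (fun hmem => by
          exact (IsLocalRing.mem_maximalIdeal _).mp hmem hX)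
      have h5 : h (Spec.map ℓ cp) = chart c.swap.he (Spec.map ψ cp) :=
        congrArg (fun f : Spec L ⟶ projBundle E => f cp) hψ
      -- Exchanging the frame twice gives back the first line, definitionally.
      rw [← h5, hcl, opensRange_chart] at h3
      have h4 : h p ∈ (chart c.he).opensRange := by
        rw [opensRange_chart]; exact h3
      exact h4
    obtain ⟨ψ, hψ, hψC⟩ := exists_specMap_chart c.he φ h hπ hr
    refine ⟨ψ, hψ, hψC, ?_⟩
    have := c.specMap_chart_eq hW φ ψ hψC (hψ ▸ h0) ht hα hβ
    linear_combination γ * this - ψ (Polynomial.X : Γ(X, U.toOpens)[X]) * hγ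
  -- Existence: `γ` is the inverse of `β`, so `X` is sent to `-α / β`, and `a + b X` to zero.
  let ψ : CommRingCat.of Γ(X, U.toOpens)[X] ⟶ B :=
    CommRingCat.ofHom (eval₂RingHom φ.hom (-(α * γ)))
  have hψC : ∀ r, ψ (C r) = φ r := fun r => eval₂_C _ _
  have hψX : ψ (Polynomial.X : Γ(X, U.toOpens)[X]) = -(α * γ) := eval₂_X _ _
  obtain ⟨g, hg⟩ := (exists_lift_iff W (Spec.map ψ ≫ chart c.he)).mpr (by
    rw [pullIdeal_specMap_comp]
    refine (map_eq_span_singleton ψ.hom hW rfl).trans ?_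
    rw [Ideal.span_singleton_eq_bot]
    refine (map_add ψ.hom _ _).trans ((congrArg _ (map_mul ψ.hom _ _)).trans ?_)
    change ψ (C c.a) + ψ (C c.b) * ψ (Polynomial.X : Γ(X, U.toOpens)[X]) = 0
    rw [hψC, hψC, hψX, hα, hβ]
    linear_combination - t * α * hγ)
  refine ⟨g, ?_, fun g' hg' => ?_⟩
  · dsimp only
    rw [reassoc_of% hg, chart_projBundleπ, ← Category.assoc, ← Spec.map_comp]
    congr 2
    ext r
    exact hψC r
  · rw [← cancel_mono W.subschemeι, hg]
    obtain ⟨ψ', h1, h2, h3⟩ := key (g' ≫ W.subschemeι)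
      ((exists_lift_iff W _).mp ⟨g', rfl⟩) (by rw [Category.assoc]; exact hg')
    rw [h1]
    congr 2
    refine CommRingCat.hom_ext (Polynomial.ringHom_ext (fun r => ?_) ?_)
    · exact (h2 r).trans (hψC r).symm
    · exact h3.trans hψX.symm

/-- On `W` the equation gives `a = -b X`, so the inverse image of the ideal `(a, b)` is generated by
`b`. -/
lemma GcdChart.pullIdeal_subscheme_chart [IsIntegral X] [IsLocallyNoetherian X]
    (hX : ∀ x : X, UniqueFactorizationMonoid (X.presheaf.stalk x)) (hs : s ≠ 0)
    {U : X.AffineZariskiSite} (c : GcdChart E s U) {R : CommRingCat.{u}}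
    (q : CommRingCat.of Γ(X, U.toOpens)[X] ⟶ R) (p : Spec R ⟶ W.subscheme)
    (hp : p ≫ W.subschemeι = Spec.map q ≫ chart c.he)
    (hq : q (C c.a + C c.b * Polynomial.X : Γ(X, U.toOpens)[X]) = 0) :
    pullIdeal ((residualPart (zeroIdeal E s)).comap (W.subschemeι ≫ projBundleπ E)) p =
      Ideal.span {q (C c.b)} := by
  have h1 : p ≫ W.subschemeι ≫ projBundleπ E = Spec.map (CommRingCat.ofHom
      (C : Γ(X, U.toOpens) →+* Γ(X, U.toOpens)[X]) ≫ q) ≫ U.2.fromSpec := by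
    rw [reassoc_of% hp, chart_projBundleπ, Spec.map_comp, Category.assoc]
  rw [pullIdeal_comap, h1, pullIdeal_specMap_comp, pullIdeal_fromSpec,
    c.residualPart_ideal hX hs, Ideal.map_span, Set.image_pair]
  change Ideal.span {q (C c.a), q (C c.b)} = _
  have h2 : q (C c.a) = -q (C c.b) * q (Polynomial.X : Γ(X, U.toOpens)[X]) := by
    have h3 : q (C c.a) + q (C c.b) * q (Polynomial.X : Γ(X, U.toOpens)[X]) = 0 := by
      refine Eq.trans ?_ hq
      refine Eq.trans ?_ (map_add q.hom _ _).symm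
      exact congrArg _ (map_mul q.hom _ _).symm
    linear_combination h3
  refine le_antisymm ?_ (Ideal.span_mono (by simp))
  rw [Ideal.span_le]
  rintro _ (rfl | rfl)
  · rw [SetLike.mem_coe, Ideal.mem_span_singleton, h2]
    exact ⟨-q (Polynomial.X : Γ(X, U.toOpens)[X]), by ring⟩
  · exact Ideal.mem_span_singleton_self _

section Integral

variable [IsIntegral X] [IsLocallyNoetherian X]

/-- The local generator `b` is a nonzerodivisor modulo `a + b X`, by Koszul exactness. -/
lemma isEffectiveCartier_comap_subscheme
    (hW : ∀ (U : X.AffineZariskiSite) (c : GcdChart E s U),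
      pullIdeal W (chart c.he) = Ideal.span {C c.a + C c.b * Polynomial.X})
    (hX : ∀ x : X, UniqueFactorizationMonoid (X.presheaf.stalk x)) (hs : s ≠ 0) :
    IsEffectiveCartier
      ((residualPart (zeroIdeal E s)).comap (W.subschemeι ≫ projBundleπ E)) := by
  refine isEffectiveCartier_of_chart _ fun z => ?_
  obtain ⟨U, c, -, hz⟩ := exists_gcdChart_chart hX hs (W.subschemeι z)
  obtain ⟨p, hp, hpq, hr⟩ := exists_subscheme_chart W (chart c.he)
  have hker : ∀ g : Γ(X, U.toOpens)[X], Ideal.Quotient.mk (pullIdeal W (chart c.he)) g = 0 ↔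
      C c.a + C c.b * Polynomial.X ∣ g := fun g => by
    rw [Ideal.Quotient.eq_zero_iff_mem, hW, Ideal.mem_span_singleton]
  refine ⟨_, p, hp, hr z hz, Ideal.Quotient.mk (pullIdeal W (chart c.he)) (C c.b), ?_,
    c.pullIdeal_subscheme_chart hX hs _ p hpq ((hker _).mpr dvd_rfl)⟩
  rw [mem_nonZeroDivisors_iff_right]
  intro g hg
  obtain ⟨g, rfl⟩ := Ideal.Quotient.mk_surjective g
  refine (hker g).mpr (c.koszul.dvd_of_dvd_C_mul ((hker _).mp ?_))
  rw [mul_comm]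
  exact (map_mul _ _ _).trans hg

/-- Near `x` the inverse image of `(a, b)` is `(t)`, and the quotients `α`, `β` generate the unit
ideal. One of them is invertible at `x`, hence after one localization; if only `α` is, the exchanged
chart is used. -/
lemma exists_chart_existsUnique_lift
    (hW : ∀ (U : X.AffineZariskiSite) (c : GcdChart E s U),
      pullIdeal W (chart c.he) = Ideal.span {C c.a + C c.b * Polynomial.X})
    (hX : ∀ x : X, UniqueFactorizationMonoid (X.presheaf.stalk x)) (hs : s ≠ 0)
    {T : Scheme.{u}} (f : T ⟶ X)
    (hf : IsEffectiveCartier ((residualPart (zeroIdeal E s)).comap f)) (x : T) :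
    ∃ (B : CommRingCat.{u}) (p : Spec B ⟶ T), IsOpenImmersion p ∧ x ∈ Set.range p ∧
      ∃! g : Spec B ⟶ W.subscheme, g ≫ W.subschemeι ≫ projBundleπ E = p ≫ f := by
  have := hX (f x)
  obtain ⟨U, hxU, ⟨c⟩⟩ := exists_gcdChart (E := E) (f x) hs
  obtain ⟨V, hxV, hVU, t, ht, hV⟩ := hf.exists_affine_le x (f ⁻¹ᵁ U.toOpens) hxU
  have hVa : IsAffineOpen V.1 := V.2
  obtain ⟨φ, hφ⟩ := exists_specMap_fromSpec U.2 (hVa.fromSpec ≫ f) (by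
    rintro _ ⟨p, rfl⟩
    exact hVU (hVa.range_fromSpec.le ⟨p, rfl⟩))
  have hspan : Ideal.span {φ c.a, φ c.b} = Ideal.span {t} := by
    have h1 := pullIdeal_fromSpec ((residualPart (zeroIdeal E s)).comap f) hVa
    rw [pullIdeal_comap, hφ, pullIdeal_specMap_comp, pullIdeal_fromSpec,
      c.residualPart_ideal hX hs, Ideal.map_span, Set.image_pair] at h1
    exact h1.trans hV
  obtain ⟨α, β, v, w, hα, hβ, hvw⟩ := exists_isUnit_of_span_pair ht hspan
  obtain ⟨y, hy⟩ : x ∈ Set.range hVa.fromSpec := hVa.range_fromSpec.ge hxV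
  have hyp : y.asIdeal.IsPrime := y.isPrime
  have key : ∀ (r : Γ(T, V.1)), r ∉ y.asIdeal →
      x ∈ Set.range (Spec.map (CommRingCat.ofHom (algebraMap Γ(T, V.1) (Localization.Away r))) ≫
        hVa.fromSpec) := by
    intro r hr
    have : y ∈ Set.range (Spec.map (CommRingCat.ofHom
        (algebraMap Γ(T, V.1) (Localization.Away r)))) :=
      (PrimeSpectrum.localization_away_comap_range (Localization.Away r) r).ge hr
    obtain ⟨z, hz⟩ := this
    exact ⟨z, by rw [Scheme.Hom.comp_apply, hz, hy]⟩
  have main : ∀ (c : GcdChart E s U) (α β : Γ(T, V.1)), φ c.a = t * α → φ c.b = t * β →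
      β ∉ y.asIdeal → ∃ (B : CommRingCat.{u}) (p : Spec B ⟶ T), IsOpenImmersion p ∧
        x ∈ Set.range p ∧
        ∃! g : Spec B ⟶ W.subscheme, g ≫ W.subschemeι ≫ projBundleπ E = p ≫ f := by
    intro c α β hα hβ hr
    let ℓ : Γ(T, V.1) ⟶ CommRingCat.of (Localization.Away β) :=
      CommRingCat.ofHom (algebraMap Γ(T, V.1) (Localization.Away β))
    have ho : IsOpenImmersion (Spec.map ℓ) := Scheme.isOpenImmersion_SpecMap_localizationAway β
    refine ⟨_, Spec.map ℓ ≫ hVa.fromSpec, inferInstance, key β hr, ?_⟩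
    rw [Category.assoc, hφ, ← Category.assoc, ← Spec.map_comp]
    exact c.existsUnique_lift (hW U c) (hW U c.swap) (φ ≫ ℓ) (t := ℓ t) (α := ℓ α) (β := ℓ β)
      (IsLocalization.map_nonZeroDivisors_le (.powers β) _ ⟨_, ht, rfl⟩)
      ((congrArg ℓ hα).trans (map_mul ℓ.hom _ _)) ((congrArg ℓ hβ).trans (map_mul ℓ.hom _ _))
      (IsLocalization.Away.algebraMap_isUnit β)
  by_cases hr : β ∈ y.asIdeal
  · refine main c.swap β α hβ hα fun hr' => hyp.ne_top ((Ideal.eq_top_iff_one _).mpr ?_)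
    exact hvw ▸ add_mem (Ideal.mul_mem_left _ _ hr') (Ideal.mul_mem_left _ _ hr)
  · exact main c α β hα hβ hr

lemma lift_unique
    (hW : ∀ (U : X.AffineZariskiSite) (c : GcdChart E s U),
      pullIdeal W (chart c.he) = Ideal.span {C c.a + C c.b * Polynomial.X})
    (hX : ∀ x : X, UniqueFactorizationMonoid (X.presheaf.stalk x)) (hs : s ≠ 0)
    {T : Scheme.{u}} (f : T ⟶ X)
    (hf : IsEffectiveCartier ((residualPart (zeroIdeal E s)).comap f)) (g g' : T ⟶ W.subscheme)
    (hg : g ≫ W.subschemeι ≫ projBundleπ E = f) (hg' : g' ≫ W.subschemeι ≫ projBundleπ E = f) :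
    g = g' := by
  choose B p hp hx hu using exists_chart_existsUnique_lift hW hX hs f hf
  let 𝒰 : T.OpenCover := Scheme.Cover.mkOfCovers T _ p (fun x => ⟨x, hx x⟩) hp
  refine 𝒰.hom_ext _ _ fun x => (hu x).unique ?_ ?_
  · change (p x ≫ g) ≫ _ = _
    rw [Category.assoc, hg]
  · change (p x ≫ g') ≫ _ = _
    rw [Category.assoc, hg']

/-- The closed subscheme `W` is the blow-up of `X` along the residual part of the zero scheme. -/
theorem isBlowup_subscheme
    (hW : ∀ (U : X.AffineZariskiSite) (c : GcdChart E s U),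
      pullIdeal W (chart c.he) = Ideal.span {C c.a + C c.b * Polynomial.X})
    (hX : ∀ x : X, UniqueFactorizationMonoid (X.presheaf.stalk x)) (hs : s ≠ 0) :
    IsBlowup (residualPart (zeroIdeal E s)) (W.subschemeι ≫ projBundleπ E) := by
  refine ⟨isEffectiveCartier_comap_subscheme hW hX hs, fun T f hf => ?_⟩
  choose B p hp hx hu using exists_chart_existsUnique_lift hW hX hs f hf
  choose g hg using fun x => (hu x).exists
  let 𝒰 : T.OpenCover := Scheme.Cover.mkOfCovers T _ p (fun x => ⟨x, hx x⟩) hp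
  -- On an overlap the inverse image of the centre is still an effective Cartier divisor, so
  -- uniqueness of lifts applies there.
  have hglue : ∀ x y : T, pullback.fst (p x) (p y) ≫ g x = pullback.snd (p x) (p y) ≫ g y := by
    intro x y
    refine lift_unique hW hX hs ((pullback.fst (p x) (p y) ≫ p x) ≫ f) ?_ _ _ ?_ ?_
    · rw [Scheme.IdealSheafData.comap_comp]
      exact hf.comap _
    · rw [Category.assoc, hg, Category.assoc]
    · rw [Category.assoc, hg, pullback.condition, Category.assoc]
  refine ⟨𝒰.glueMorphisms g hglue, ?_, fun g' hg' => lift_unique hW hX hs f hf _ _ hg' ?_⟩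
  all_goals
    refine 𝒰.hom_ext _ _ fun x => ?_
    exact (Category.assoc _ _ _).symm.trans
      ((congrArg (· ≫ _) (𝒰.ι_glueMorphisms g hglue x)).trans (hg x))

end Integral

end Blowup

/-! ### Pullback of projective bundles along affine morphisms -/

section BaseChange
open Polynomial

/-- Morphisms on the members of an open cover glue if they agree locally. -/
lemma exists_glue_of_locally_eq {P Q : Scheme.{u}} {ι : Type u} {S : ι → Scheme.{u}}
    (p : ∀ i, S i ⟶ P) [∀ i, IsOpenImmersion (p i)] (hp : ∀ x : P, ∃ i, x ∈ Set.range (p i))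
    (g : ∀ i, S i ⟶ Q)
    (h : ∀ (i k : ι) (x : P), x ∈ Set.range (p i) → x ∈ Set.range (p k) →
      ∃ (Z : Scheme.{u}) (u : Z ⟶ S i) (v : Z ⟶ S k) (q : Z ⟶ P), IsOpenImmersion q ∧
        u ≫ p i = q ∧ v ≫ p k = q ∧ x ∈ Set.range q ∧ u ≫ g i = v ≫ g k) :
    ∃ Φ : P ⟶ Q, ∀ i, p i ≫ Φ = g i := by
  let 𝒰 : P.OpenCover := Scheme.Cover.mkOfCovers ι _ p hp inferInstance
  have hglue : ∀ i k, pullback.fst (p i) (p k) ≫ g i = pullback.snd (p i) (p k) ≫ g k := by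
    intro i k
    let m := pullback.fst (p i) (p k) ≫ p i
    have hx : ∀ y, ∃ (Z : Scheme.{u}) (w : Z ⟶ pullback (p i) (p k)), IsOpenImmersion w ∧
        y ∈ Set.range w ∧ w ≫ pullback.fst (p i) (p k) ≫ g i =
          w ≫ pullback.snd (p i) (p k) ≫ g k := by
      intro y
      obtain ⟨Z, u, v, q, hq, hu, hv, ⟨z, hz⟩, he⟩ := h i k (m y) ⟨pullback.fst (p i) (p k) y, by
        rw [← Scheme.Hom.comp_apply]⟩ ⟨pullback.snd (p i) (p k) y, by
        rw [← Scheme.Hom.comp_apply, ← pullback.condition]⟩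
      -- The open set on which the two morphisms agree is placed in the overlap; it is open there
      -- because its image in `P` is.
      let w : Z ⟶ pullback (p i) (p k) := pullback.lift u v (hu.trans hv.symm)
      have hwm : w ≫ m = q := (pullback.lift_fst_assoc _ _ _ _).trans hu
      have hw : IsOpenImmersion w := by
        have : IsOpenImmersion (w ≫ m) := hwm ▸ hq
        exact .of_comp _ m
      refine ⟨Z, w, hw, ⟨z, m.isOpenEmbedding.injective ?_⟩, ?_⟩
      · rw [← Scheme.Hom.comp_apply, hwm, hz]
      · simp [w, pullback.lift_fst_assoc, pullback.lift_snd_assoc, he]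
    choose Z w hw hy he using hx
    let 𝒱 : (pullback (p i) (p k)).OpenCover :=
      Scheme.Cover.mkOfCovers _ _ w (fun y => ⟨y, hy y⟩) hw
    exact 𝒱.hom_ext _ _ he
  exact ⟨𝒰.glueMorphisms g hglue, 𝒰.ι_glueMorphisms g hglue⟩

/-- The map on `Proj` is everywhere defined since the images of the degree one elements include a
basis, which generates the irrelevant ideal. This is why frames enter the construction. -/
lemma irrelevant_le_map_symGradedMap {R M R' M' : Type u} [CommRing R] [AddCommGroup M]
    [Module R M] [CommRing R'] [AddCommGroup M'] [Module R' M'] (φ : R →+* R') (g : M →ₛₗ[φ] M')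
    (b : Fin 2 → M) (b' : Module.Basis (Fin 2) R' M') (h : ∀ i, b' i = g (b i)) :
    (symPow R' M')₊ ≤ (symPow R M)₊.map (symGradedMap φ g) := by
  have h1 : (symPow R' M')₊.toIdeal ≤ ((symPow R M)₊.map (symGradedMap φ g)).toIdeal := by
    refine (irrelevant_le_span b').trans ?_
    rw [Ideal.span_le]
    rintro _ ⟨i, rfl⟩
    dsimp only
    rw [h, ← symMap_ι]
    exact Ideal.mem_map_of_mem _
      (HomogeneousIdeal.mem_irrelevant_of_mem _ one_pos (ι_mem_symPow _ _ _))
  exact h1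

variable {X Y : Scheme.{u}} (j : Y ⟶ X) (E : X.Modules)

/-- The graded map of symmetric algebras given by pullback of sections. -/
def symPullback (U : X.Opens) :
    symSec E U →+*ᵍ symSec ((Scheme.Modules.pullback j).obj E) (j ⁻¹ᵁ U) :=
  symGradedMap (j.app U).hom (pullbackMap j E U)

lemma symPullback_symRes {U V : X.Opens} (h : V ≤ U) :
    (symRes ((Scheme.Modules.pullback j).obj E) (j.preimage_mono h)).comp (symPullback j E U) =
      (symPullback j E V).comp (symRes E h) := by
  apply GradedRingHom.ext
  intro x
  refine RingHom.congr_fun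
    (f := (symRes ((Scheme.Modules.pullback j).obj E) (j.preimage_mono h)).toRingHom.comp
      (symPullback j E U).toRingHom)
    (g := (symPullback j E V).toRingHom.comp (symRes E h).toRingHom)
    (sym_ringHom_ext (fun r => ?_) fun m => ?_) x
  · change symMap _ _ (symMap _ _ _) = symMap _ _ (symMap _ _ _)
    rw [symMap_algebraMap, symMap_algebraMap, symMap_algebraMap, symMap_algebraMap]
    exact congrArg _ (app_res j h r).symm
  · change symMap _ _ (symMap _ _ _) = symMap _ _ (symMap _ _ _)
    rw [symMap_ι, symMap_ι, symMap_ι, symMap_ι]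
    exact congrArg _ (pullbackMap_res j E h m).symm

variable {E}

lemma IsFrame.irrelevant_le {U : X.Opens} {e : Fin 2 → Γ(E, U)} (he : IsFrame E U e) :
    (symSec ((Scheme.Modules.pullback j).obj E) (j ⁻¹ᵁ U))₊ ≤
      (symSec E U)₊.map (symPullback j E U) :=
  irrelevant_le_map_symGradedMap _ _ e (he.pullback j).basis fun i => (he.pullback j).basis_apply i

variable [IsAffineHom j]

/-- The inverse image of an affine open set under an affine morphism. -/
def preimageSite (U : X.AffineZariskiSite) : Y.AffineZariskiSite :=
  ⟨j ⁻¹ᵁ U.toOpens, U.2.preimage j⟩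

lemma preimageSite_mono {U V : X.AffineZariskiSite} (h : V ≤ U) :
    preimageSite j V ≤ preimageSite j U := by
  obtain ⟨f, hf⟩ := h
  exact ⟨j.app _ f, (Scheme.preimage_basicOpen j f).symm.trans (congrArg (fun W => j ⁻¹ᵁ W) hf)⟩

/-- The pulled back sections, over the inverse image of `U`. -/
def pullbackFrame {U : X.AffineZariskiSite} (e : Fin 2 → Γ(E, U.toOpens)) (k : Fin 2) :
    Γ((Scheme.Modules.pullback j).obj E, (preimageSite j U).toOpens) :=
  pullbackMap j E U.toOpens (e k)

lemma IsFrame.preimage {U : X.AffineZariskiSite} {e : Fin 2 → Γ(E, U.toOpens)}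
    (he : IsFrame E U.toOpens e) :
    IsFrame ((Scheme.Modules.pullback j).obj E) (preimageSite j U).toOpens (pullbackFrame j e) :=
  he.pullback j

/-- The map of polynomial rings given by pullback of functions. -/
def polyPullback (U : X.AffineZariskiSite) : CommRingCat.of Γ(X, U.toOpens)[X] ⟶
    CommRingCat.of Γ(Y, (preimageSite j U).toOpens)[X] :=
  CommRingCat.ofHom (mapRingHom (j.app U.toOpens).hom)

variable [E.IsQuasicoherent]

/-- The restriction over `U` of the morphism of projective bundles given by pullback. -/
def pullbackChart {U : X.AffineZariskiSite} {e : Fin 2 → Γ(E, U.toOpens)}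
    (he : IsFrame E U.toOpens e) :
    Proj (symSec ((Scheme.Modules.pullback j).obj E) (preimageSite j U).toOpens) ⟶ projBundle E :=
  Proj.map (symPullback j E U.toOpens) (he.irrelevant_le j) ≫ projChart E U

lemma projRes_pullbackChart {U V : X.AffineZariskiSite} (h : V ≤ U)
    {e : Fin 2 → Γ(E, U.toOpens)} (he : IsFrame E U.toOpens e)
    {e' : Fin 2 → Γ(E, V.toOpens)} (he' : IsFrame E V.toOpens e') :
    projRes ((Scheme.Modules.pullback j).obj E) (preimageSite_mono j h) ≫ pullbackChart j he =
      pullbackChart j he' := by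
  rw [pullbackChart, pullbackChart, ← projRes_projChart E h, ← Category.assoc, ← Category.assoc]
  congr 1
  rw [projRes, projRes]
  refine (Proj.map_comp _ _ _ _).symm.trans (Eq.trans ?_ (Proj.map_comp _ _ _ _))
  congr 1
  exact symPullback_symRes j E (Scheme.AffineZariskiSite.toOpens_mono h)

/-- The morphism of projective bundles given by pullback along an affine morphism. -/
theorem exists_pullbackBundle [IsRankTwoBundle E] :
    ∃ Φ : projBundle ((Scheme.Modules.pullback j).obj E) ⟶ projBundle E,
      ∀ (U : X.AffineZariskiSite) (e : Fin 2 → Γ(E, U.toOpens)) (he : IsFrame E U.toOpens e),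
        projChart ((Scheme.Modules.pullback j).obj E) (preimageSite j U) ≫ Φ =
          pullbackChart j he := by
  let E' := (Scheme.Modules.pullback j).obj E
  let ι := {U : X.AffineZariskiSite // ∃ e : Fin 2 → Γ(E, U.toOpens), IsFrame E U.toOpens e}
  choose e he using fun i : ι => i.2
  have hmem : ∀ (U : X.AffineZariskiSite) (x : projBundle E'),
      x ∈ Set.range (projChart E' (preimageSite j U)) ↔ j (projBundleπ E' x) ∈ U.toOpens :=
    fun U x => le_of_mem_opensRange_projChart
  obtain ⟨Φ, hΦ⟩ := exists_glue_of_locally_eq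
    (fun i : ι => projChart E' (preimageSite j i.1)) (fun x => by
      obtain ⟨U, hU, e, he⟩ := exists_affine_isFrame E (j (projBundleπ E' x))
      exact ⟨⟨U, e, he⟩, (hmem U x).mpr hU⟩)
    -- The frame only witnesses that the map is defined. Over a common basic open both morphisms
    -- restrict to the same pullback map.
    (fun i => pullbackChart j (he i)) (fun i k x hi hk => by
      obtain ⟨Q, hQ, hQ', hx⟩ := exists_le_affineZariskiSite ((hmem _ _).mp hi) ((hmem _ _).mp hk)
      have hf := (he i).restrict (Scheme.AffineZariskiSite.toOpens_mono hQ)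
      exact ⟨_, projRes E' (preimageSite_mono j hQ), projRes E' (preimageSite_mono j hQ'),
        projChart E' (preimageSite j Q), inferInstance, projRes_projChart _ _,
        projRes_projChart _ _, (hmem _ _).mpr hx,
        (projRes_pullbackChart j hQ (he i) hf).trans (projRes_pullbackChart j hQ' (he k) hf).symm⟩)
  exact ⟨Φ, fun U e he' => hΦ ⟨U, e, he'⟩⟩

variable {j} {Φ : projBundle ((Scheme.Modules.pullback j).obj E) ⟶ projBundle E}

section Properties

variable {U : X.AffineZariskiSite} {e : Fin 2 → Γ(E, U.toOpens)} (he : IsFrame E U.toOpens e)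

/-- In coordinates the morphism of bundles is pullback of the coefficients, the frame on `Y` being
the pulled back one. -/
lemma chart_pullbackBundle
    (hΦ : projChart ((Scheme.Modules.pullback j).obj E) (preimageSite j U) ≫ Φ =
      pullbackChart j he) :
    chart (he.preimage j) ≫ Φ = Spec.map (polyPullback j U) ≫ chart he := by
  have h1 : lineChart (ι_mem_symPow _ _ _) (ι_mem_symPow _ _ _) (he.preimage j).fracHom_bijective ≫
      Proj.map (symPullback j E U.toOpens) (he.irrelevant_le j) = Spec.map (polyPullback j U) ≫
        lineChart (ι_mem_symPow _ _ (e 0)) (ι_mem_symPow _ _ (e 1)) he.fracHom_bijective :=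
    lineChart_map _ _ he.fracHom_bijective _ _ _ _ _ _ (symMap_ι _ _ _) (symMap_ι _ _ _)
  refine (Category.assoc _ _ _).trans ?_
  rw [hΦ, pullbackChart]
  refine (Category.assoc _ _ _).symm.trans ((congrArg (· ≫ projChart E U) h1).trans ?_)
  exact Category.assoc _ _ _

lemma C_comp_polyPullback (j : Y ⟶ X) [IsAffineHom j] (U : X.AffineZariskiSite) :
    CommRingCat.ofHom (C : Γ(X, U.toOpens) →+* Γ(X, U.toOpens)[X]) ≫ polyPullback j U =
      j.appLE U.toOpens (preimageSite j U).toOpens le_rfl ≫ CommRingCat.ofHom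
        (C : Γ(Y, (preimageSite j U).toOpens) →+* Γ(Y, (preimageSite j U).toOpens)[X]) := by
  refine CommRingCat.hom_ext (RingHom.ext fun r => ?_)
  have h2 : j.appLE U.toOpens (preimageSite j U).toOpens le_rfl = j.app U.toOpens :=
    (Scheme.Hom.app_eq_appLE j).symm
  refine (Polynomial.map_C (j.app U.toOpens).hom).trans ?_
  exact congrArg (fun ψ : Γ(X, U.toOpens) ⟶ Γ(Y, (preimageSite j U).toOpens) => C (ψ.hom r)) h2.symm

lemma chart_pullbackBundle_projBundleπ
    (hΦ : projChart ((Scheme.Modules.pullback j).obj E) (preimageSite j U) ≫ Φ =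
      pullbackChart j he) :
    chart (he.preimage j) ≫ Φ ≫ projBundleπ E =
      chart (he.preimage j) ≫ projBundleπ ((Scheme.Modules.pullback j).obj E) ≫ j := by
  have h1 := IsAffineOpen.SpecMap_appLE_fromSpec j U.2 (preimageSite j U).2 (le_refl _)
  have h2 : Spec.map (CommRingCat.ofHom C ≫ polyPullback j U) ≫ U.2.fromSpec = _ :=
    congrArg (fun ψ => Spec.map ψ ≫ U.2.fromSpec) (C_comp_polyPullback j U)
  rw [Spec.map_comp, Spec.map_comp, Category.assoc, Category.assoc, h1] at h2
  rw [reassoc_of% (chart_pullbackBundle he hΦ), chart_projBundleπ,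
    reassoc_of% (chart_projBundleπ (he.preimage j))]
  exact h2

/-- The inverse image of `D₊(e 0)` is `D₊` of the pulled back section, so the inverse image of a
line is exactly the corresponding line. -/
lemma mem_range_chart_of_pullbackBundle
    (hΦ : projChart ((Scheme.Modules.pullback j).obj E) (preimageSite j U) ≫ Φ =
      pullbackChart j he)
    (hπ : Φ ≫ projBundleπ E = projBundleπ ((Scheme.Modules.pullback j).obj E) ≫ j)
    (z : projBundle ((Scheme.Modules.pullback j).obj E)) (hz : Φ z ∈ Set.range (chart he)) :
    z ∈ Set.range (chart (he.preimage j)) := by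
  let E' := (Scheme.Modules.pullback j).obj E
  have hz' : Φ z ∈ twistOpen E U (e 0) := by rw [← opensRange_chart he]; exact hz
  have h1 : z ∈ (projChart E' (preimageSite j U)).opensRange := by
    rw [le_of_mem_opensRange_projChart]
    change (projBundleπ E' ≫ j) z ∈ U.toOpens
    rw [← hπ]
    exact le_of_mem_opensRange_projChart.mp (twistOpen_le E _ _ hz')
  obtain ⟨w, rfl⟩ := h1
  have h2 : projChart E U (Proj.map (symPullback j E U.toOpens) (he.irrelevant_le j) w) ∈
      twistOpen E U (e 0) := by
    have := congrArg (fun f => f w) hΦ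
    exact this ▸ hz'
  have h3 : Proj.map (symPullback j E U.toOpens) (he.irrelevant_le j) w ∈
      Proj.basicOpen (symSec E U.toOpens) (SymmetricAlgebra.ι _ _ (e 0)) := by
    obtain ⟨v, hv, hv'⟩ := h2
    rwa [← (projChart E U).isOpenEmbedding.injective hv']
  have h4 : w ∈ Proj.basicOpen (symSec E' (preimageSite j U).toOpens)
      (symPullback j E U.toOpens (SymmetricAlgebra.ι _ _ (e 0))) := by
    have := Proj.map_preimage_basicOpen (symPullback j E U.toOpens) (he.irrelevant_le j)
      (SymmetricAlgebra.ι _ _ (e 0))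
    exact this.le h3
  have h5 : projChart E' (preimageSite j U) w ∈ (chart (he.preimage j)).opensRange := by
    rw [opensRange_chart]
    refine ⟨w, ?_, rfl⟩
    have h6 : symPullback j E U.toOpens (SymmetricAlgebra.ι _ _ (e 0)) =
      SymmetricAlgebra.ι _ _ (pullbackMap j E U.toOpens (e 0)) := symMap_ι _ _ _
    exact h6 ▸ h4
  exact h5

end Properties

end BaseChange

/-! ### The projective bundle over a closed subscheme -/

section ClosedBaseChange
open Polynomial

variable {X : Scheme.{u}} {E : X.Modules} [IsRankTwoBundle E]

lemma comap_subschemeι_eq_bot (F : X.IdealSheafData) : F.comap F.subschemeι = ⊥ := by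
  rw [eq_bot_iff, ← Scheme.IdealSheafData.le_map_iff_comap_le, Scheme.IdealSheafData.map_bot,
    Scheme.IdealSheafData.ker_subschemeι]

lemma exists_lift_subscheme {P Q : Scheme.{u}} (I : Q.IdealSheafData) (Φ : P ⟶ Q)
    (h : I.comap Φ = ⊥) : ∃ Ψ : P ⟶ I.subscheme, Ψ ≫ I.subschemeι = Φ := by
  have hk : I.subschemeι.ker ≤ Φ.ker := by
    rw [Scheme.IdealSheafData.ker_subschemeι, ← Scheme.IdealSheafData.map_bot,
      Scheme.IdealSheafData.le_map_iff_comap_le, h]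
  exact ⟨IsClosedImmersion.lift I.subschemeι Φ hk, IsClosedImmersion.lift_fac _ _ _⟩

lemma polyPullback_surjective (F : X.IdealSheafData) (U : X.AffineZariskiSite) :
    Function.Surjective (polyPullback F.subschemeι U) :=
  Polynomial.map_surjective _ (F.subschemeι_app_surjective ⟨U.toOpens, U.2⟩)

lemma ker_polyPullback (F : X.IdealSheafData) (U : X.AffineZariskiSite) :
    RingHom.ker (polyPullback F.subschemeι U).hom =
      (F.ideal ⟨U.toOpens, U.2⟩).map (C : Γ(X, U.toOpens) →+* Γ(X, U.toOpens)[X]) := by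
  rw [← F.ker_subschemeι_app ⟨U.toOpens, U.2⟩]
  exact Polynomial.ker_mapRingHom _

lemma exists_isIso_specMap {R S : CommRingCat.{u}} (q : R ⟶ S) (hq : Function.Surjective q)
    (K : Ideal R) (hK : RingHom.ker q.hom = K) :
    ∃ θ : CommRingCat.of (R ⧸ K) ⟶ S, IsIso (Spec.map θ) ∧
      Spec.map θ ≫ Spec.map (CommRingCat.ofHom (Ideal.Quotient.mk K)) = Spec.map q := by
  subst hK
  let ε : (R ⧸ RingHom.ker q.hom) ≃+* S := RingHom.quotientKerEquivOfSurjective hq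
  refine ⟨ε.toCommRingCatIso.hom, inferInstance, ?_⟩
  rw [← Spec.map_comp]
  rfl

/-- With `A` the ring of `U` and `F` the ideal, the closed subscheme of the line is the spectrum of
`A[X] / F A[X]`, and the line of the restricted bundle is that of `(A / F)[X]`. These rings
coincide, since reduction of coefficients is surjective with kernel `F A[X]`. -/
lemma exists_chart_isIso_pullback (F : X.IdealSheafData) {U : X.AffineZariskiSite}
    {e : Fin 2 → Γ(E, U.toOpens)} (he : IsFrame E U.toOpens e)
    {Φ : projBundle ((Scheme.Modules.pullback F.subschemeι).obj E) ⟶ projBundle E}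
    (hΦ : projChart ((Scheme.Modules.pullback F.subschemeι).obj E)
      (preimageSite F.subschemeι U) ≫ Φ = pullbackChart F.subschemeι he)
    (hπ : Φ ≫ projBundleπ E =
      projBundleπ ((Scheme.Modules.pullback F.subschemeι).obj E) ≫ F.subschemeι)
    (Ψ : projBundle ((Scheme.Modules.pullback F.subschemeι).obj E) ⟶
      (F.comap (projBundleπ E)).subscheme)
    (hΨ : Ψ ≫ (F.comap (projBundleπ E)).subschemeι = Φ) (z : (F.comap (projBundleπ E)).subscheme)
    (hz : (F.comap (projBundleπ E)).subschemeι z ∈ Set.range (chart he)) :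
    ∃ (R : CommRingCat.{u}) (c : Spec R ⟶ (F.comap (projBundleπ E)).subscheme),
      IsOpenImmersion c ∧ z ∈ Set.range c ∧ IsIso (pullback.snd Ψ c) := by
  obtain ⟨c, hc, hcι, hcr⟩ := exists_subscheme_chart (F.comap (projBundleπ E)) (chart he)
  refine ⟨_, c, hc, hcr z hz, ?_⟩
  obtain ⟨θ, hθ, hθq⟩ := exists_isIso_specMap (polyPullback F.subschemeι U)
    (polyPullback_surjective F U) (pullIdeal (F.comap (projBundleπ E)) (chart he))
    ((ker_polyPullback F U).trans (pullIdeal_comap_chart F he).symm)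
  have hsq : chart (he.preimage F.subschemeι) ≫ Ψ = Spec.map θ ≫ c := by
    rw [← cancel_mono (F.comap (projBundleπ E)).subschemeι, Category.assoc, hΨ, Category.assoc,
      hcι, chart_pullbackBundle he hΦ, ← hθq, Category.assoc]
  have hrange : Ψ ⁻¹ᵁ c.opensRange = (chart (he.preimage F.subschemeι)).opensRange := by
    ext y
    constructor
    · rintro ⟨w, hw⟩
      refine mem_range_chart_of_pullbackBundle he hΦ hπ y ?_
      have h1 : Φ y = (F.comap (projBundleπ E)).subschemeι (c w) := by
        rw [hw, ← hΨ]; rfl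
      have h2 := congrArg (fun f => f w) hcι
      exact ⟨_, h2.symm.trans h1.symm⟩
    · rintro ⟨w, rfl⟩
      exact ⟨Spec.map θ w, (congrArg (fun f => f w) hsq).symm⟩
  -- The line upstairs is the whole inverse image of the chart `c`, so the base change of `Ψ` to `c`
  -- is the isomorphism `Spec θ`.
  have hpb := IsOpenImmersion.isPullback (Spec.map θ) (chart (he.preimage F.subschemeι)) c Ψ hsq
    hrange
  rw [← hpb.flip.isoPullback_inv_snd]
  infer_instance

/-- The projective bundle of the restriction of `E` to a closed subscheme is the inverse image of
that subscheme in the projective bundle of `E`. -/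
theorem exists_iso_projBundle_pullback (F : X.IdealSheafData) :
    ∃ ε : (F.comap (projBundleπ E)).subscheme ≅
        projBundle ((Scheme.Modules.pullback F.subschemeι).obj E),
      ε.hom ≫ projBundleπ _ ≫ F.subschemeι =
        (F.comap (projBundleπ E)).subschemeι ≫ projBundleπ E := by
  let j := F.subschemeι
  let E' := (Scheme.Modules.pullback j).obj E
  let W := F.comap (projBundleπ E)
  obtain ⟨Φ, hΦ⟩ := exists_pullbackBundle (E := E) j
  have hcov : ∀ y : projBundle E, ∃ (U : X.AffineZariskiSite) (e : Fin 2 → Γ(E, U.toOpens))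
      (he : IsFrame E U.toOpens e), y ∈ Set.range (chart he) := by
    intro y
    obtain ⟨U, hU, e, he⟩ := exists_affine_isFrame E (projBundleπ E y)
    rcases mem_opensRange_chart_or he y hU with h | h
    · exact ⟨U, e, he, h⟩
    · exact ⟨U, _, he.swap, h⟩
  have hcov' : ∀ z : projBundle E', ∃ (U : X.AffineZariskiSite) (e : Fin 2 → Γ(E, U.toOpens))
      (he : IsFrame E U.toOpens e), z ∈ Set.range (chart (he.preimage j)) := by
    intro z
    obtain ⟨U, hU, e, he⟩ := exists_affine_isFrame E (j (projBundleπ E' z))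
    rcases mem_opensRange_chart_or (he.preimage j) z hU with h | h
    · exact ⟨U, e, he, h⟩
    · exact ⟨U, _, he.swap, h⟩
  have hπ : Φ ≫ projBundleπ E = projBundleπ E' ≫ j := by
    choose U e he hz using hcov'
    let 𝒰 : (projBundle E').OpenCover := Scheme.Cover.mkOfCovers _ _
      (fun z => chart ((he z).preimage j)) (fun z => ⟨z, hz z⟩) fun z => inferInstance
    exact 𝒰.hom_ext _ _ fun z => chart_pullbackBundle_projBundleπ (he z) (hΦ _ _ (he z))
  -- The bundle over the subscheme maps to `X` through the subscheme, so the ideal pulls back to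
  -- zero and `Φ` factors.
  obtain ⟨Ψ, hΨ⟩ := exists_lift_subscheme W Φ (by
    rw [← Scheme.IdealSheafData.comap_comp, hπ, Scheme.IdealSheafData.comap_comp,
      comap_subschemeι_eq_bot, eq_bot_iff, ← Scheme.IdealSheafData.le_map_iff_comap_le]
    exact bot_le)
  -- Being an isomorphism is local on the target, and the charts of the closed subscheme cover it.
  have hiso : IsIso Ψ := by
    have hloc : ∀ z : W.subscheme, ∃ (R : CommRingCat.{u}) (c : Spec R ⟶ W.subscheme),
        IsOpenImmersion c ∧ z ∈ Set.range c ∧ IsIso (pullback.snd Ψ c) := by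
      intro z
      obtain ⟨U, e, he, hz⟩ := hcov (W.subschemeι z)
      exact exists_chart_isIso_pullback F he (hΦ _ _ he) hπ Ψ hΨ z hz
    choose R c hc hz hi using hloc
    let 𝒰 : W.subscheme.OpenCover := Scheme.Cover.mkOfCovers _ _ c (fun z => ⟨z, hz z⟩) hc
    exact IsZariskiLocalAtTarget.of_openCover (P := MorphismProperty.isomorphisms Scheme) 𝒰 hi
  refine ⟨(asIso Ψ).symm, ?_⟩
  rw [Iso.symm_hom, asIso_inv, IsIso.inv_comp_eq, reassoc_of% hΨ, hπ]

end ClosedBaseChange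

end ProjBundle

end

/-! ### The decomposition of the zero scheme -/

theorem lemma1 {k : Type u} [Field k] {X : Scheme.{u}} (f : X ⟶ Spec (CommRingCat.of k))
    [IsIntegral X] [SmoothOfRelativeDimension 2 f] (hf : IsProjectiveOver k f)
    (E : X.Modules) [IsRankTwoBundle E] (s : Γ(E, ⊤)) (hs : s ≠ 0) :
    ∃ W₀ W₁ : (projBundle E).IdealSheafData,
      zeroIdeal (twist E) (twistSection E s) = W₀ ⊓ W₁ ∧
      IsBlowup (residualPart (zeroIdeal E s)) (W₀.subschemeι ≫ projBundleπ E) ∧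
      ∃ e : W₁.subscheme ≅
          projBundle ((Scheme.Modules.pullback
            (divisorialPart (zeroIdeal E s)).subschemeι).obj E),
        e.hom ≫ projBundleπ _ ≫ (divisorialPart (zeroIdeal E s)).subschemeι =
          W₁.subschemeι ≫ projBundleπ E := by
  have hnoeth := isLocallyNoetherian_of_smooth f
  have hX := uniqueFactorizationMonoid_stalk f
  obtain ⟨W, hW, hZ⟩ := exists_component hX hs
  exact ⟨W, (divisorialPart (zeroIdeal E s)).comap (projBundleπ E), hZ,
    isBlowup_subscheme hW hX hs, exists_iso_projBundle_pullback _⟩
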